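/- Let $(M^{4n},g_M,I_1,I_2,I_3)$ be a hyperKähler manifold with Kähler forms $\sigma_i=g_M(I_i\cdot,\cdot)$, where $I_iI_j=I_k=-I_jI_i$ for cyclic permutations $(i,j,k)$ of $(1,2,3)$. Let $\gamma$ be a closed $2$-form on $M$ lying in the subbundle $\mathfrak{sp}(n)\subset\mathfrak{so}(4n)\cong\Lambda^2(M)$, i.e. $\gamma=g_M(B\cdot,\cdot)$ with $B$ commuting with $I_1,I_2,I_3$. Let $\pi:X^{4n+4}\to M$ be a smooth principal $\mathbb{T}^4$-bundle, $\mathbb{T}^4=(\mathbb{R}/2\pi\mathbb{Z})^4$, with a principal connection whose four components are the $1$-forms $\alpha,\xi,\eta,\nu$ on $X$, such that (omitting $\pi^*$ from the notation) $$d\alpha=\sigma_1,\qquad d\xi=-\sigma_2,\qquad d\eta=-\sigma_3,\qquad d\nu=\gamma .$$ (Such a bundle and connection exist exactly when $[\sigma_1],[\sigma_2],[\sigma_3],[\gamma]\in H^2(M,2\pi\mathbb{Z})$.) Put $$\check g=g_M+\alpha^2+\xi^2+\eta^2+\nu^2,$$ $$\check\omega_1=\sigma_1+\xi\wedge\eta+\nu\wedge\alpha,\qquad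 \check\omega_2=\sigma_2+\xi\wedge\nu+\alpha\wedge\eta,\qquad \check\omega_3=\sigma_3+\xi\wedge\alpha+\eta\wedge\nu .$$ Then $\check g$ is a Riemannian metric on $X$, and $(\check g,\check\omega_1,\check\omega_2,\check\omega_3)$ defines a hyper-Hermitian $Sp(n+1)$-structure on $X$: at every point the data are linearly equivalent to the standard metric and the three standard $2$-forms of $\mathbb{H}^{n+1}$, and the almost complex structures $\check I_i$ given by $\check g(\check I_i\cdot,\cdot)=\check\omega_i$ satisfy the quaternion relations, are compatible with $\check g$, and are all integrable (their Nijenhuis tensors vanish). Moreover, the complex forms $$\check\Upsilon_1=(\sigma_2+i\sigma_3)^n\wedge(\xi+i\eta)\wedge(\nu+i\alpha),\quad \check\Upsilon_2=(\sigma_3+i\sigma_1)^n\wedge(\xi+i\nu)\wedge(\alpha+i\eta),\quad \check\Upsilon_3=(\sigma_1+i\sigma_2)^n\wedge(\xi+i\alpha)\wedge(\eta+i\nu)$$ are of type $(2n+2,0)$ with respect to $\check I_1,\check I_2,\check I_3$ respectively, and they are closed. -/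

import Mathlib

open scoped Manifold ContDiff TensorProduct

namespace HKTorus

noncomputable section

/-! ### Wedge product of alternating forms on one vector space -/

section Wedge

variable {V : Type*} [AddCommGroup V] [Module ℝ V] [TopologicalSpace V]
  {A : Type*} [CommRing A] [Algebra ℝ A] [TopologicalSpace A] [IsTopologicalRing A]

/-- The algebraic wedge product: the signed sum over shuffles, without any factorial, so that
`(a ∧ b)(v, w) = a v * b w - a w * b v` for `1`-forms. -/
def wedgeAlt {k l : ℕ} (a : V [⋀^Fin k]→L[ℝ] A) (b : V [⋀^Fin l]→L[ℝ] A) :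
    V [⋀^Fin (k + l)]→ₗ[ℝ] A :=
  ((LinearMap.mul' ℝ A).compAlternatingMap
    (a.toAlternatingMap.domCoprod b.toAlternatingMap)).domDomCongr finSumFinEquiv

theorem wedgeAlt_continuous {k l : ℕ} (a : V [⋀^Fin k]→L[ℝ] A) (b : V [⋀^Fin l]→L[ℝ] A) :
    Continuous (wedgeAlt a b) := by
  have h : ∀ v, wedgeAlt a b v = ∑ s : Equiv.Perm.ModSumCongr (Fin k) (Fin l),
      LinearMap.mul' ℝ A (AlternatingMap.domCoprod.summand a.toAlternatingMap b.toAlternatingMap s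
        (fun i => v (finSumFinEquiv i))) := by
    intro v
    simp [wedgeAlt, AlternatingMap.domCoprod_apply, Function.comp_def]
  have h' : (wedgeAlt a b : (Fin (k + l) → V) → A) = _ := funext h
  rw [h']
  refine continuous_finsetSum _ fun s _ => ?_
  induction s using Quotient.inductionOn' with
  | h s =>
    have hs : ∀ u, LinearMap.mul' ℝ A (AlternatingMap.domCoprod.summand a.toAlternatingMap
        b.toAlternatingMap (Quotient.mk'' s) u) =
          (Equiv.Perm.sign s : ℤ) •
            (a (fun i => u (s (Sum.inl i))) * b (fun i => u (s (Sum.inr i)))) := by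
      intro u
      rw [AlternatingMap.domCoprod.summand_mk'']
      change LinearMap.mul' ℝ A (Equiv.Perm.sign s •
        (a (fun i => u (s (Sum.inl i))) ⊗ₜ[ℝ] b (fun i => u (s (Sum.inr i))))) = _
      rw [Units.smul_def, map_zsmul, LinearMap.mul'_apply]
    simp only [hs]
    refine Continuous.zsmul (Continuous.mul ?_ ?_) _
    · exact a.cont.comp (continuous_pi fun i => continuous_apply _)
    · exact b.cont.comp (continuous_pi fun i => continuous_apply _)

/-- The wedge product of continuous alternating forms with values in `A` (`ℝ` or `ℂ`). -/
def wedge {k l : ℕ} (a : V [⋀^Fin k]→L[ℝ] A) (b : V [⋀^Fin l]→L[ℝ] A) :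
    V [⋀^Fin (k + l)]→L[ℝ] A :=
  { wedgeAlt a b with cont := wedgeAlt_continuous a b }

/-- The `m`-th exterior power `a ∧ ⋯ ∧ a` of a `2`-form (the constant `1` for `m = 0`). -/
def wedgePow (a : V [⋀^Fin 2]→L[ℝ] A) : (m : ℕ) → V [⋀^Fin (2 * m)]→L[ℝ] A
  | 0 => ContinuousAlternatingMap.constOfIsEmpty ℝ V (Fin 0) 1
  | m + 1 => wedge (wedgePow a m) a

/-- The complex-valued form `a + i b` built from two real-valued forms. -/
def complexForm {k : ℕ} (a b : V [⋀^Fin k]→L[ℝ] ℝ) : V [⋀^Fin k]→L[ℝ] ℂ :=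
  Complex.ofRealCLM.compContinuousAlternatingMap a +
    (Complex.I • Complex.ofRealCLM).compContinuousAlternatingMap b

end Wedge

/-! ### Differential forms, metrics and endomorphism fields on a manifold -/

section Forms

/-- The model space of `d`-dimensional manifolds. -/
abbrev Euc (d : ℕ) : Type := EuclideanSpace ℝ (Fin d)

/-- Differential `k`-forms on the `d`-dimensional manifold `X` with values in `A`
(no regularity yet). -/
abbrev DForm (d : ℕ) (X : Type*) [TopologicalSpace X] [ChartedSpace (Euc d) X] (k : ℕ)
    (A : Type*) [NormedAddCommGroup A] [NormedSpace ℝ A] : Type _ :=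
  ∀ x : X, TangentSpace (𝓡 d) x [⋀^Fin k]→L[ℝ] A

/-- Fields of endomorphisms of the tangent spaces of `X`. -/
abbrev EndField (d : ℕ) (X : Type*) [TopologicalSpace X] [ChartedSpace (Euc d) X] : Type _ :=
  ∀ x : X, TangentSpace (𝓡 d) x →L[ℝ] TangentSpace (𝓡 d) x

/-- Smooth Riemannian metrics on `X`. -/
abbrev RiemMetric (d : ℕ) (X : Type*) [TopologicalSpace X] [ChartedSpace (Euc d) X]
    [IsManifold (𝓡 d) ∞ X] : Type _ :=
  Bundle.ContMDiffRiemannianMetric (𝓡 d) ∞ (Euc d) (fun x : X => TangentSpace (𝓡 d) x)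

variable {d e : ℕ} {X : Type*} [TopologicalSpace X] [ChartedSpace (Euc d) X]
  {Y : Type*} [TopologicalSpace Y] [ChartedSpace (Euc e) Y]
  {A : Type*} [NormedAddCommGroup A] [NormedSpace ℝ A] {k : ℕ}

/-- The pullback `f^* τ` of a form. -/
def pullback (f : Y → X) (τ : DForm d X k A) : DForm e Y k A :=
  fun y => (τ (f y)).compContinuousLinearMap (mfderiv (𝓡 e) (𝓡 d) f y)

/-- The form `τ` written in the preferred chart at `x₀`: its pullback under the inverse chart
(meaningful on the open target of the chart). -/
def inChart (x₀ : X) (τ : DForm d X k A) : Euc d → Euc d [⋀^Fin k]→L[ℝ] A :=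
  fun y => (τ ((extChartAt (𝓡 d) x₀).symm y)).compContinuousLinearMap
    (mfderiv 𝓘(ℝ, Euc d) (𝓡 d) (extChartAt (𝓡 d) x₀).symm y)

/-- A form is smooth if it is smooth in charts. -/
def SmoothForm (τ : DForm d X k A) : Prop :=
  ∀ x₀ : X, ContDiffOn ℝ ∞ (inChart x₀ τ) (extChartAt (𝓡 d) x₀).target

/-- The exterior derivative of a form, computed at each point `x` in the chart at `x`. -/
def dForm (τ : DForm d X k A) : DForm d X (k + 1) A :=
  fun x => (extDeriv (inChart x τ) (extChartAt (𝓡 d) x x)).compContinuousLinearMap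
    (mfderiv (𝓡 d) 𝓘(ℝ, Euc d) (extChartAt (𝓡 d) x) x)

/-- The Nijenhuis expression `[JV, JW] - J[JV, W] - J[V, JW] - [V, W]`. -/
def nijenhuis (J : EndField d X) (V W : ∀ x : X, TangentSpace (𝓡 d) x) (x : X) :
    TangentSpace (𝓡 d) x :=
  VectorField.mlieBracket (𝓡 d) (fun y => J y (V y)) (fun y => J y (W y)) x
    - J x (VectorField.mlieBracket (𝓡 d) (fun y => J y (V y)) W x)
    - J x (VectorField.mlieBracket (𝓡 d) V (fun y => J y (W y)) x)
    - VectorField.mlieBracket (𝓡 d) V W x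

/-- The complex form `Ω` of degree `k` is of type `(k, 0)` with respect to `J`: it is complex
linear in every argument. For `k = 1` this is `θ ∘ J = i θ`. -/
def IsTypeTop (J : EndField d X) (Ω : DForm d X k ℂ) : Prop :=
  ∀ (x : X) (v : Fin k → TangentSpace (𝓡 d) x) (j : Fin k),
    Ω x (Function.update v j (J x (v j))) = Complex.I * Ω x v

variable [IsManifold (𝓡 d) ∞ X]

/-- A smooth endomorphism field, as a section of the endomorphism bundle. -/
def SmoothEnd (J : EndField d X) : Prop :=
  ContMDiff (𝓡 d) ((𝓡 d).prod 𝓘(ℝ, Euc d →L[ℝ] Euc d)) ∞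
    (fun x => (Bundle.TotalSpace.mk' (Euc d →L[ℝ] Euc d) x (J x) :
      Bundle.TotalSpace (Euc d →L[ℝ] Euc d)
        (fun x : X => TangentSpace (𝓡 d) x →L[ℝ] TangentSpace (𝓡 d) x)))

/-- `V` is a vector field that is smooth near `x`. -/
def SmoothFieldAt (V : ∀ x : X, TangentSpace (𝓡 d) x) (x : X) : Prop :=
  ContMDiffAt (𝓡 d) ((𝓡 d).prod 𝓘(ℝ, Euc d)) ∞
    (fun y => (Bundle.TotalSpace.mk' (Euc d) y (V y) : TangentBundle (𝓡 d) X)) x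

/-- `J` is an integrable almost complex structure: smooth, with `J² = -1` and vanishing
Nijenhuis tensor. -/
structure IsComplexStructure (J : EndField d X) : Prop where
  smooth : SmoothEnd J
  sq : ∀ (x : X) (v : TangentSpace (𝓡 d) x), J x (J x v) = -v
  nijenhuis_eq_zero : ∀ (V W : ∀ x : X, TangentSpace (𝓡 d) x) (x : X),
    SmoothFieldAt V x → SmoothFieldAt W x → nijenhuis J V W x = 0

/-- `(g, I₁, I₂, I₃)` is a hyper-Hermitian structure with fundamental forms
`τᵢ = g(Iᵢ ·, ·)`: the `Iᵢ` are integrable complex structures satisfying the quaternion relations,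
and `g` is Hermitian for each of them. The indices `1, 2, 3` are `0, 1, 2 : Fin 3`, with cyclic
addition. -/
structure IsHyperHermitian (g : RiemMetric d X) (I : Fin 3 → EndField d X)
    (τ : Fin 3 → DForm d X 2 ℝ) : Prop where
  complex : ∀ i, IsComplexStructure (I i)
  mul : ∀ i x v, I i x (I (i + 1) x v) = I (i + 2) x v
  anticomm : ∀ i x v, I i x (I (i + 1) x v) = -I (i + 1) x (I i x v)
  hermitian : ∀ i x v w, g.inner x (I i x v) (I i x w) = g.inner x v w
  fundamental : ∀ i x v w, g.inner x (I i x v) w = τ i x ![v, w]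
  smooth : ∀ i, SmoothForm (τ i)

/-- A hyperKähler structure: hyper-Hermitian with closed fundamental forms. -/
structure IsHyperKahler (g : RiemMetric d X) (I : Fin 3 → EndField d X)
    (σ : Fin 3 → DForm d X 2 ℝ) : Prop extends IsHyperHermitian g I σ where
  closed : ∀ i, dForm (σ i) = 0

/-- The `2`-form `γ` lies in the subbundle `𝔰𝔭(n) ⊆ 𝔰𝔬(4n) ≅ Λ²`: under the metric it corresponds
to a (necessarily skew) endomorphism commuting with `I₁, I₂, I₃`. -/
def IsInSp (g : RiemMetric d X) (I : Fin 3 → EndField d X) (γ : DForm d X 2 ℝ) : Prop :=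
  ∀ x : X, ∃ B : TangentSpace (𝓡 d) x →L[ℝ] TangentSpace (𝓡 d) x,
    (∀ v w, g.inner x (B v) w = γ x ![v, w]) ∧ ∀ i v, B (I i x v) = I i x (B v)

/-- The three standard `2`-forms of `ℝ⁴ = ℍ`, as matrices: `e¹² + e³⁴`, `e¹³ + e⁴²`,
`e¹⁴ + e²³`. -/
def stdForm : Fin 3 → Matrix (Fin 4) (Fin 4) ℝ :=
  ![!![0, 1, 0, 0; -1, 0, 0, 0; 0, 0, 0, 1; 0, 0, -1, 0],
    !![0, 0, 1, 0; 0, 0, 0, -1; -1, 0, 0, 0; 0, 1, 0, 0],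
    !![0, 0, 0, 1; 0, 0, 1, 0; 0, -1, 0, 0; -1, 0, 0, 0]]

/-- The metric `g` and the `2`-forms `τ₁, τ₂, τ₃` define an `Sp(m)`-structure on `X`: they are
smooth, and every tangent space has a basis (indexed by `Fin m × Fin 4`) in which they are the
standard metric and the standard forms of `ℝ⁴ᵐ = ℍᵐ`. The common stabilizer of these in
`GL(4m, ℝ)` is `Sp(m)`, so the adapted bases form an `Sp(m)`-reduction of the frame bundle. -/
structure IsSpStructure (m : ℕ) (g : RiemMetric d X) (τ : Fin 3 → DForm d X 2 ℝ) : Prop where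
  smooth : ∀ i, SmoothForm (τ i)
  adapted : ∀ x : X, ∃ b : Module.Basis (Fin m × Fin 4) ℝ (TangentSpace (𝓡 d) x),
    (∀ p q, g.inner x (b p) (b q) = if p = q then 1 else 0) ∧
    ∀ i p q, τ i x ![b p, b q] = if p.1 = q.1 then stdForm i p.2 q.2 else 0

end Forms

/-! ### The forms on the total space -/

section Check

variable {d e : ℕ} {M : Type*} [TopologicalSpace M] [ChartedSpace (Euc d) M]
  {X : Type*} [TopologicalSpace X] [ChartedSpace (Euc e) X]

/-- The forms `ω̌₁ = σ₁ + ξ ∧ η + ν ∧ α`, `ω̌₂ = σ₂ + ξ ∧ ν + α ∧ η`, `ω̌₃ = σ₃ + ξ ∧ α + η ∧ ν`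
on `X`. -/
def omegaCheck (π : X → M) (σ : Fin 3 → DForm d M 2 ℝ) (α ξ η ν : DForm e X 1 ℝ) :
    Fin 3 → DForm e X 2 ℝ :=
  ![fun x => pullback π (σ 0) x + wedge (ξ x) (η x) + wedge (ν x) (α x),
    fun x => pullback π (σ 1) x + wedge (ξ x) (ν x) + wedge (α x) (η x),
    fun x => pullback π (σ 2) x + wedge (ξ x) (α x) + wedge (η x) (ν x)]

/-- `(a + i b)ⁿ ∧ (p + i q) ∧ (r + i s)` for real `2`-forms `a, b` and `1`-forms `p, q, r, s`. -/
def volForm (n : ℕ) (a b : DForm e X 2 ℝ) (p q r s : DForm e X 1 ℝ) :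
    DForm e X (2 * n + 1 + 1) ℂ :=
  fun x => wedge (wedge (wedgePow (complexForm (a x) (b x)) n) (complexForm (p x) (q x)))
    (complexForm (r x) (s x))

/-- The forms `Υ̌₁ = (σ₂ + iσ₃)ⁿ ∧ (ξ + iη) ∧ (ν + iα)`, `Υ̌₂ = (σ₃ + iσ₁)ⁿ ∧ (ξ + iν) ∧ (α + iη)`,
`Υ̌₃ = (σ₁ + iσ₂)ⁿ ∧ (ξ + iα) ∧ (η + iν)` on `X`. -/
def upsilonCheck (n : ℕ) (π : X → M) (σ : Fin 3 → DForm d M 2 ℝ) (α ξ η ν : DForm e X 1 ℝ) :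
    Fin 3 → DForm e X (2 * n + 1 + 1) ℂ :=
  ![volForm n (pullback π (σ 1)) (pullback π (σ 2)) ξ η ν α,
    volForm n (pullback π (σ 2)) (pullback π (σ 0)) ξ ν α η,
    volForm n (pullback π (σ 0)) (pullback π (σ 1)) ξ α η ν]

end Check

/-! ### Principal torus bundles and connections -/

section Bundle

/-- The torus `𝕋⁴ = U(1)⁴`. -/
abbrev Torus4 : Type := Circle × Circle × Circle × Circle

/-- The model with corners of `𝕋⁴`. -/
abbrev torusModel := (𝓡 1).prod ((𝓡 1).prod ((𝓡 1).prod (𝓡 1)))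

/-- `t ↦ exp(i t e_j)`, the `j`-th standard one-parameter subgroup of `𝕋⁴`, of period `2π`. -/
def torusExp : Fin 4 → ℝ → Torus4 :=
  ![fun t => (Circle.exp t, 1, 1, 1), fun t => (1, Circle.exp t, 1, 1),
    fun t => (1, 1, Circle.exp t, 1), fun t => (1, 1, 1, Circle.exp t)]

variable {d e : ℕ} {M : Type*} [TopologicalSpace M] [ChartedSpace (Euc d) M]
  {X : Type*} [TopologicalSpace X] [ChartedSpace (Euc e) X] [MulAction Torus4 X]

variable (d e) in
/-- `π : X → M` is a smooth principal `𝕋⁴`-bundle: `𝕋⁴` acts smoothly on `X`, and `X` is locally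
equivariantly diffeomorphic over `M` to `U × 𝕋⁴`. -/
structure IsPrincipalTorusBundle (π : X → M) : Prop where
  smooth_action : ContMDiff (torusModel.prod (𝓡 e)) (𝓡 e) ∞ (fun p : Torus4 × X => p.1 • p.2)
  smooth_proj : ContMDiff (𝓡 e) (𝓡 d) ∞ π
  locally_trivial : ∀ m : M, ∃ (U : Set M) (φ : OpenPartialHomeomorph X (M × Torus4)),
    IsOpen U ∧ m ∈ U ∧ φ.source = π ⁻¹' U ∧ φ.target = U ×ˢ Set.univ ∧
    ContMDiffOn (𝓡 e) ((𝓡 d).prod torusModel) ∞ φ φ.source ∧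
    ContMDiffOn ((𝓡 d).prod torusModel) (𝓡 e) ∞ φ.symm φ.target ∧
    ∀ x ∈ φ.source, (φ x).1 = π x ∧
      ∀ t : Torus4, t • x ∈ φ.source ∧ φ (t • x) = (π x, t * (φ x).2)

/-- The vector field on `X` generated by the `j`-th circle factor of `𝕋⁴`. -/
def fundamentalField (j : Fin 4) (x : X) : TangentSpace (𝓡 e) x :=
  (mfderiv 𝓘(ℝ, ℝ) (𝓡 e) (fun t : ℝ => torusExp j t • x) 0 (1 : ℝ) : Euc e)

/-- `θ₁, …, θ₄` are the components of a principal connection on the `𝕋⁴`-bundle `X`: smooth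
invariant `1`-forms, dual to the generators of the action. -/
structure IsConnection (θ : Fin 4 → DForm e X 1 ℝ) : Prop where
  smooth : ∀ j, SmoothForm (θ j)
  invariant : ∀ j (t : Torus4), pullback (fun x => t • x) (θ j) = θ j
  vertical : ∀ i j x, θ i x ![fundamentalField j x] = if i = j then 1 else 0

end Bundle

end

end HKTorus

open HKTorus

namespace HKTorus

/-! The differential of `π` and the connection forms identify `T_x X` with `T_{π x} M ⊕ ℝ⁴`. Taken
in the order `ξ, η, ν, α`, the connection forms are coordinates of a quaternionic line, and the
structures on `X` are the direct sums of the `Iᵢ` with the standard ones. The pointwise algebra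
therefore splits into the two summands (`exists_quaternionic_lift`), and adapted bases come from
Gram–Schmidt over the quaternions (`exists_quaternionic_basis`).

Integrability and closedness both rest on the types of differentials on `M`. For each `i` let `S =
σ_{i+1} + i σ_{i+2}` and let `a`, `b` be the two complex `1`-form factors of the `i`-th volume form.
Then `S` is closed of type `(2,0)`, and `a`, `b` are of type `(1,0)`. Their differentials are pulled
back from `M`: one is a constant multiple of `S`, hence `(2,0)`; the other combines `γ` with a
multiple of `σᵢ`, hence is `(1,1)`. For `γ` this holds with respect to all three structures because
its endomorphism commutes with them.

Integrability (`nijenhuis_eq_zero`): for a `(1,0)`-form `θ`, the number `θ(N(v, w))` is the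
`(0,2)`-component of `dθ`, which vanishes for `a` and `b`. Similarly `S(N(v, w), ·) = 0` because `S`
is closed. The common kernel of `a`, `b`, `S` is zero, so the Nijenhuis tensor `N` vanishes.

Closedness (`dForm_volForm_eq_zero`): since `dS = 0`, each term of the Leibniz expansion contains
`Sⁿ ∧ da` or `Sⁿ ∧ db`. These are pullbacks from `M`, of complex dimension `2n`, where the
`(2n,0)`-form `Sⁿ` annihilates every `(1,0)`-form and therefore every `2`-form without `(0,2)`-part.

Wedge products are handled through `altSum`: `k! l! (a ∧ b)` is the signed sum of `a ⊗ b` over all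
permutations (`wedge_eq_altSum`). Regrouping factors becomes a reindexing, and as only vanishing
statements are needed for products of several factors, no signs have to be followed. -/

set_option linter.unusedSectionVars false

/-! ### Signed sums over permutations -/

section AltSum

open Equiv

variable {V A : Type*} {ι κ μ : Type*} [Fintype ι] [DecidableEq ι] [Fintype κ] [DecidableEq κ]
  [Fintype μ] [DecidableEq μ]

/-- The signed sum of a function of several vectors over all permutations of its arguments. -/
def altSum [AddCommGroup A] (F : (ι → V) → A) (v : ι → V) : A :=
  ∑ s : Perm ι, Perm.sign s • F (fun i => v (s i))

theorem altSum_reindex [AddCommGroup A] (e : ι ≃ κ) (F : (ι → V) → A) (v : κ → V) :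
    altSum F (fun i => v (e i)) = altSum (fun u : κ → V => F (fun i => u (e i))) v := by
  unfold altSum
  refine Fintype.sum_equiv e.permCongr _ _ fun s => ?_
  simp [Equiv.permCongr_apply]

/-- The permutations `s` and `s * r` run over the same group, and their signs differ by that of `r`.
-/
theorem altSum_comp_perm [AddCommGroup A] (r : Perm ι) (F : (ι → V) → A) (v : ι → V) :
    altSum (fun u => F (fun i => u (r i))) v = Perm.sign r • altSum F v := by
  unfold altSum
  rw [Finset.smul_sum]
  refine Fintype.sum_equiv (Equiv.mulRight r) _ _ fun s => ?_
  simp [smul_smul, mul_comm (Perm.sign s), ← mul_assoc]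

theorem altSum_congr [AddCommGroup A] {F G : (ι → V) → A} (h : ∀ u, F u = G u) (v : ι → V) :
    altSum F v = altSum G v := by
  simp [altSum, h]

theorem altSum_zero [AddCommGroup A] (v : ι → V) : altSum (fun _ => (0 : A)) v = 0 := by
  simp [altSum]

theorem altSum_add [AddCommGroup A] (F G : (ι → V) → A) (v : ι → V) :
    altSum (fun u => F u + G u) v = altSum F v + altSum G v := by
  simp [altSum, Finset.sum_add_distrib]

theorem altSum_nsmul [AddCommGroup A] (n : ℕ) (F : (ι → V) → A) (v : ι → V) :
    altSum (fun u => n • F u) v = n • altSum F v := by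
  simp [altSum, Finset.smul_sum, smul_comm n]

theorem altSum_zsmul [AddCommGroup A] (n : ℤˣ) (F : (ι → V) → A) (v : ι → V) :
    altSum (fun u => n • F u) v = n • altSum F v := by
  simp [altSum, Finset.smul_sum, smul_comm n]

theorem altSum_real_smul [AddCommGroup A] [Module ℝ A] (c : ℝ) (F : (ι → V) → A)
    (v : ι → V) : altSum (fun u => c • F u) v = c • altSum F v := by
  simp [altSum, Finset.smul_sum, smul_comm c]

theorem altSum_sum [AddCommGroup A] {τ : Type*} (t : Finset τ) (F : τ → (ι → V) → A)
    (v : ι → V) : altSum (fun u => ∑ j ∈ t, F j u) v = ∑ j ∈ t, altSum (F j) v := by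
  simp only [altSum, Finset.smul_sum]
  exact Finset.sum_comm

/-- Alternating over some of the arguments before alternating over all of them only contributes
a factorial. -/
theorem altSum_partial [AddCommGroup A] (K : (κ → V) → (μ → V) → A) (v : κ ⊕ μ → V) :
    altSum (fun u : κ ⊕ μ → V => altSum (fun p => K p (fun j => u (Sum.inr j)))
      (fun i => u (Sum.inl i))) v =
    (Fintype.card κ).factorial • altSum (fun u : κ ⊕ μ → V =>
      K (fun i => u (Sum.inl i)) (fun j => u (Sum.inr j))) v := by
  have h : ∀ u : κ ⊕ μ → V, altSum (fun p => K p (fun j => u (Sum.inr j)))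
      (fun i => u (Sum.inl i)) = ∑ t : Perm κ, Perm.sign t •
        (fun w : κ ⊕ μ → V => K (fun i => w (Sum.inl i)) (fun j => w (Sum.inr j)))
          (fun i => u ((Equiv.sumCongr t (Equiv.refl μ)) i)) := by
    intro u; simp [altSum]
  rw [altSum_congr h, altSum_sum]
  -- The sign of `t` occurs twice, once as a coefficient and once from extending `t` by the identity
  -- on `μ`. The two cancel, so all `(card κ)!` summands agree.
  have h2 : ∀ t : Perm κ, altSum (fun u : κ ⊕ μ → V => Perm.sign t •
        (fun w : κ ⊕ μ → V => K (fun i => w (Sum.inl i)) (fun j => w (Sum.inr j)))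
          (fun i => u ((Equiv.sumCongr t (Equiv.refl μ)) i))) v =
      altSum (fun u : κ ⊕ μ → V =>
        K (fun i => u (Sum.inl i)) (fun j => u (Sum.inr j))) v := by
    intro t
    rw [altSum_zsmul, altSum_comp_perm (Equiv.sumCongr t (Equiv.refl μ))
      (fun w : κ ⊕ μ → V => K (fun i => w (Sum.inl i)) (fun j => w (Sum.inr j)))]
    have : Perm.sign (Equiv.sumCongr t (Equiv.refl μ)) = Perm.sign t := by
      simp
    rw [this, smul_smul, Int.units_mul_self, one_smul]
  rw [Finset.sum_congr rfl fun t _ => h2 t]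
  simp [Fintype.card_perm]

theorem altSum_partial_right [AddCommGroup A] (K : (κ → V) → (μ → V) → A) (v : κ ⊕ μ → V) :
    altSum (fun u : κ ⊕ μ → V => altSum (fun p => K (fun i => u (Sum.inl i)) p)
      (fun j => u (Sum.inr j))) v =
    (Fintype.card μ).factorial • altSum (fun u : κ ⊕ μ → V =>
      K (fun i => u (Sum.inl i)) (fun j => u (Sum.inr j))) v := by
  have := altSum_partial (fun p q => K q p) (fun i => v (Equiv.sumComm μ κ i))
  rw [altSum_reindex (Equiv.sumComm μ κ), altSum_reindex (Equiv.sumComm μ κ)] at this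
  exact this

/-- Removes the factorials created by summing over all permutations instead of shuffles. -/
theorem nsmul_left_cancel_of_real [AddCommGroup A] [Module ℝ A] {n : ℕ} (hn : n ≠ 0) {x y : A}
    (h : n • x = n • y) : x = y := by
  rw [← Nat.cast_smul_eq_nsmul ℝ, ← Nat.cast_smul_eq_nsmul ℝ] at h
  exact smul_right_injective A (Nat.cast_ne_zero.2 hn) h

theorem nsmul_eq_zero_of_real [AddCommGroup A] [Module ℝ A] {n : ℕ} (hn : n ≠ 0) {x : A}
    (h : n • x = 0) : x = 0 :=
  nsmul_left_cancel_of_real hn (by rw [h, smul_zero])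

end AltSum

/-! ### Wedge products as signed sums over all permutations. -/

section WedgeAlgebra

open Equiv

variable {V : Type*} [AddCommGroup V] [Module ℝ V] [TopologicalSpace V]
  {A : Type*} [CommRing A] [Algebra ℝ A] [TopologicalSpace A] [IsTopologicalRing A]
  {k l m : ℕ}

theorem altSum_alternating {ι : Type*} [Fintype ι] [DecidableEq ι] (a : V [⋀^ι]→L[ℝ] A)
    (v : ι → V) : altSum a v = (Fintype.card ι).factorial • a v := by
  have : ∀ s : Perm ι, Perm.sign s • a (fun i => v (s i)) = a v := by
    intro s
    have := a.toAlternatingMap.map_perm v s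
    have h2 : a (fun i => v (s i)) = Perm.sign s • a v := this
    rw [h2, smul_smul, Int.units_mul_self, one_smul]
  simp [altSum, this, Fintype.card_perm]

/-- The wedge product as a sum over all permutations. -/
theorem wedge_eq_altSum (a : V [⋀^Fin k]→L[ℝ] A) (b : V [⋀^Fin l]→L[ℝ] A)
    (v : Fin k ⊕ Fin l → V) :
    (k.factorial * l.factorial) • wedge a b (fun i => v (finSumFinEquiv.symm i)) =
      altSum (fun u : Fin k ⊕ Fin l → V =>
        a (fun i => u (Sum.inl i)) * b (fun i => u (Sum.inr i))) v := by
  have h := MultilinearMap.domCoprod_alternization_eq a.toAlternatingMap b.toAlternatingMap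
  have h2 := congrArg (fun f => LinearMap.mul' ℝ A (f v)) h
  simp only [Fintype.card_fin, AlternatingMap.smul_apply, map_nsmul,
    MultilinearMap.alternatization_apply, map_sum] at h2
  have h3 : wedge a b (fun i => v (finSumFinEquiv.symm i)) =
      LinearMap.mul' ℝ A ((a.toAlternatingMap.domCoprod b.toAlternatingMap) v) := by
    change (wedgeAlt a b) _ = _
    unfold wedgeAlt
    rw [AlternatingMap.domDomCongr_apply, LinearMap.compAlternatingMap_apply]
    congr 2
    ext i
    simp
  rw [h3, ← h2]
  unfold altSum
  refine Finset.sum_congr rfl fun s _ => ?_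
  rw [Units.smul_def, Units.smul_def, map_zsmul,
    MultilinearMap.domDomCongr_apply, MultilinearMap.domCoprod_apply, LinearMap.mul'_apply]
  rfl

theorem wedge_eq_altSum' (a : V [⋀^Fin k]→L[ℝ] A) (b : V [⋀^Fin l]→L[ℝ] A)
    (v : Fin (k + l) → V) :
    (k.factorial * l.factorial) • wedge a b v =
      altSum (fun u : Fin k ⊕ Fin l → V =>
        a (fun i => u (Sum.inl i)) * b (fun i => u (Sum.inr i)))
        (fun i => v (finSumFinEquiv i)) := by
  rw [← wedge_eq_altSum]; simp

/-- The factor `k! l!` is what turns a wedge product into an `altSum`, so identities between wedge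
products can be tested there. -/
theorem wedge_ext {a a' : V [⋀^Fin (k + l)]→L[ℝ] A}
    (h : ∀ v, (k.factorial * l.factorial) • a v = (k.factorial * l.factorial) • a' v) : a = a' := by
  ext v
  exact nsmul_left_cancel_of_real (by positivity) (h v)

theorem wedge_compContinuousLinearMap {W : Type*} [AddCommGroup W] [Module ℝ W]
    [TopologicalSpace W] (f : W →L[ℝ] V) (a : V [⋀^Fin k]→L[ℝ] A) (b : V [⋀^Fin l]→L[ℝ] A) :
    (wedge a b).compContinuousLinearMap f =
      wedge (a.compContinuousLinearMap f) (b.compContinuousLinearMap f) := by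
  refine wedge_ext fun v => ?_
  rw [wedge_eq_altSum', ContinuousAlternatingMap.compContinuousLinearMap_apply, wedge_eq_altSum']
  rfl

theorem wedge_add_left (a a' : V [⋀^Fin k]→L[ℝ] A) (b : V [⋀^Fin l]→L[ℝ] A) :
    wedge (a + a') b = wedge a b + wedge a' b := by
  refine wedge_ext fun v => ?_
  simp only [ContinuousAlternatingMap.add_apply, smul_add, wedge_eq_altSum', add_mul, altSum_add]

theorem wedge_add_right (a : V [⋀^Fin k]→L[ℝ] A) (b b' : V [⋀^Fin l]→L[ℝ] A) :
    wedge a (b + b') = wedge a b + wedge a b' := by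
  refine wedge_ext fun v => ?_
  simp only [ContinuousAlternatingMap.add_apply, smul_add, wedge_eq_altSum', mul_add, altSum_add]

theorem wedge_smul_left (c : ℝ) (a : V [⋀^Fin k]→L[ℝ] A) (b : V [⋀^Fin l]→L[ℝ] A)
    [ContinuousConstSMul ℝ A] :
    wedge (c • a) b = c • wedge a b := by
  refine wedge_ext fun v => ?_
  rw [ContinuousAlternatingMap.smul_apply, smul_comm]
  simp only [wedge_eq_altSum', ContinuousAlternatingMap.smul_apply, smul_mul_assoc,
    altSum_real_smul]

theorem wedge_smul_right (c : ℝ) (a : V [⋀^Fin k]→L[ℝ] A) (b : V [⋀^Fin l]→L[ℝ] A)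
    [ContinuousConstSMul ℝ A] :
    wedge a (c • b) = c • wedge a b := by
  refine wedge_ext fun v => ?_
  rw [ContinuousAlternatingMap.smul_apply, smul_comm]
  simp only [wedge_eq_altSum', ContinuousAlternatingMap.smul_apply, mul_smul_comm,
    altSum_real_smul]

theorem wedge_one_one (a b : V [⋀^Fin 1]→L[ℝ] A) (v w : V) :
    wedge a b ![v, w] = a ![v] * b ![w] - a ![w] * b ![v] := by
  have h := wedge_eq_altSum' a b ![v, w]
  simp only [Nat.factorial_one, mul_one, one_smul] at h
  have h2 := altSum_reindex (finSumFinEquiv (m := 1) (n := 1)) (fun u : Fin 1 ⊕ Fin 1 → V =>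
        a (fun i => u (Sum.inl i)) * b (fun i => u (Sum.inr i))) ![v, w]
  rw [h, h2]
  have hu : (Finset.univ : Finset (Perm (Fin (1 + 1)))) = {1, swap 0 1} := by decide
  have e1 : ∀ x : Fin 1 → V, x = ![x 0] := fun x => by ext i; fin_cases i; rfl
  unfold altSum
  rw [hu, Finset.sum_insert (by decide), Finset.sum_singleton]
  have s : Perm.sign (swap (0 : Fin (1 + 1)) 1) = -1 := Perm.sign_swap (by decide)
  rw [s, Perm.sign_one, one_smul, Units.neg_smul, one_smul, sub_eq_add_neg]
  beta_reduce
  congr 3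
  all_goals first | exact e1 _ | (congr 1; exact e1 _)

end WedgeAlgebra

/-! ### Vanishing of wedge products and exterior derivatives -/

section WedgeVanishing

open Equiv

variable {V : Type*} [AddCommGroup V] [Module ℝ V] [TopologicalSpace V]
  {A : Type*} [CommRing A] [Algebra ℝ A] [TopologicalSpace A] [IsTopologicalRing A]
  {k l m : ℕ}

theorem altSum_mul_eq_zero_of_wedge_eq_zero {a : V [⋀^Fin k]→L[ℝ] A} {b : V [⋀^Fin l]→L[ℝ] A}
    (h : wedge a b = 0) (v : Fin k ⊕ Fin l → V) :
    altSum (fun u : Fin k ⊕ Fin l → V =>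
        a (fun i => u (Sum.inl i)) * b (fun i => u (Sum.inr i))) v = 0 := by
  rw [← wedge_eq_altSum, h]
  simp

theorem wedge_eq_zero_of_altSum_mul_eq_zero {a : V [⋀^Fin k]→L[ℝ] A} {b : V [⋀^Fin l]→L[ℝ] A}
    (h : ∀ v, altSum (fun u : Fin k ⊕ Fin l → V =>
        a (fun i => u (Sum.inl i)) * b (fun i => u (Sum.inr i))) v = 0) : wedge a b = 0 := by
  refine wedge_ext fun v => ?_
  rw [wedge_eq_altSum', h]
  simp

theorem altSum_mul_right {κ μ : Type*} [Fintype κ] [DecidableEq κ] [Fintype μ] [DecidableEq μ]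
    (F : (κ → V) → A) (c : A) (v : κ → V) :
    altSum (fun u => F u * c) v = altSum F v * c := by
  simp [altSum, Finset.sum_mul, smul_mul_assoc]

theorem altSum_mul_left {κ : Type*} [Fintype κ] [DecidableEq κ]
    (F : (κ → V) → A) (c : A) (v : κ → V) :
    altSum (fun u => c * F u) v = c * altSum F v := by
  simp [altSum, Finset.mul_sum, mul_smul_comm]

/-- Wedging with a further form `a` in the middle preserves the vanishing of `p ∧ c`. -/
theorem wedge_wedge_eq_zero {p : V [⋀^Fin k]→L[ℝ] A} (a : V [⋀^Fin m]→L[ℝ] A)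
    {c : V [⋀^Fin l]→L[ℝ] A} (h : wedge p c = 0) : wedge (wedge p a) c = 0 := by
  refine wedge_eq_zero_of_altSum_mul_eq_zero fun v => ?_
  refine nsmul_eq_zero_of_real (n := k.factorial * m.factorial) (by positivity) ?_
  rw [← altSum_nsmul]
  have h1 : ∀ u : Fin (k + m) ⊕ Fin l → V, (k.factorial * m.factorial) •
      (wedge p a (fun i => u (Sum.inl i)) * c (fun i => u (Sum.inr i))) =
      altSum (fun w : Fin k ⊕ Fin m → V => p (fun i => w (Sum.inl i)) * a (fun i => w (Sum.inr i)) *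
        c (fun i => u (Sum.inr i))) (fun i => u (Sum.inl (finSumFinEquiv i))) := by
    intro u
    rw [← smul_mul_assoc, wedge_eq_altSum', altSum_mul_right (μ := Fin l)]
  rw [altSum_congr h1]
  let e : (Fin k ⊕ Fin m) ⊕ Fin l ≃ Fin (k + m) ⊕ Fin l :=
    Equiv.sumCongr finSumFinEquiv (Equiv.refl _)
  -- Brings the arguments of `c` next to those of `p`, so that the inner alternation produces `p ∧
  -- c`. Reindexing also transports the vectors, hence costs no sign.
  let e' : (Fin k ⊕ Fin m) ⊕ Fin l ≃ (Fin k ⊕ Fin l) ⊕ Fin m :=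
    ((Equiv.sumAssoc _ _ _).trans (Equiv.sumCongr (Equiv.refl _) (Equiv.sumComm _ _))).trans
      (Equiv.sumAssoc _ _ _).symm
  let K : (Fin k ⊕ Fin m → V) → (Fin l → V) → A := fun w q =>
    p (fun i => w (Sum.inl i)) * a (fun i => w (Sum.inr i)) * c q
  let K' : (Fin k ⊕ Fin l → V) → (Fin m → V) → A := fun w q =>
    p (fun i => w (Sum.inl i)) * c (fun i => w (Sum.inr i)) * a q
  have h2 := altSum_partial K (fun i => v (e i))
  rw [altSum_reindex e] at h2
  have h3 : altSum (fun u : (Fin k ⊕ Fin m) ⊕ Fin l → V =>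
      K (fun i => u (Sum.inl i)) (fun j => u (Sum.inr j))) (fun i => v (e i)) = 0 := by
    have h4 : ∀ u : (Fin k ⊕ Fin m) ⊕ Fin l → V,
        K (fun i => u (Sum.inl i)) (fun j => u (Sum.inr j)) =
        (fun w : (Fin k ⊕ Fin l) ⊕ Fin m → V =>
          K' (fun i => w (Sum.inl i)) (fun j => w (Sum.inr j))) (fun i => u (e'.symm i)) := by
      intro u
      simp only [K, K']
      exact mul_right_comm _ _ _
    rw [altSum_congr h4, ← altSum_reindex e'.symm (fun w : (Fin k ⊕ Fin l) ⊕ Fin m → V =>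
      K' (fun i => w (Sum.inl i)) (fun j => w (Sum.inr j)))]
    refine nsmul_eq_zero_of_real (n := (Fintype.card (Fin k ⊕ Fin l)).factorial) (by positivity) ?_
    rw [← altSum_partial]
    have h5 : ∀ (w : Fin k ⊕ Fin l → V) (q : Fin m → V), altSum (fun p => K' p q) w = 0 := by
      intro w q
      simp only [K']
      rw [altSum_mul_right (μ := Fin l), altSum_mul_eq_zero_of_wedge_eq_zero h, zero_mul]
    simp only [h5]
    exact altSum_zero _
  rw [h3, smul_zero] at h2
  exact h2

/-- If a `2`-form is the skew-symmetrization of `h` and `p` is annihilated by all `h w`, then it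
is annihilated by the `2`-form. -/
theorem wedge_eq_zero_of_skew {p : V [⋀^Fin k]→L[ℝ] A} {h : V → V [⋀^Fin 1]→L[ℝ] A}
    {b : V [⋀^Fin 2]→L[ℝ] A} (hb : ∀ x y, b ![x, y] = h y ![x] - h x ![y])
    (hp : ∀ w, wedge p (h w) = 0) : wedge p b = 0 := by
  refine wedge_eq_zero_of_altSum_mul_eq_zero fun v => ?_
  let G : (Fin k ⊕ Fin 2 → V) → A := fun u =>
    p (fun i => u (Sum.inl i)) * h (u (Sum.inr 1)) ![u (Sum.inr 0)]
  -- The two halves of `b` differ by exchanging its arguments, so after alternation both contribute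
  -- `altSum G`.
  let r : Perm (Fin k ⊕ Fin 2) := swap (Sum.inr 0) (Sum.inr 1)
  have h1 : ∀ u : Fin k ⊕ Fin 2 → V, p (fun i => u (Sum.inl i)) * b (fun i => u (Sum.inr i)) =
      G u + (-1 : ℤˣ) • G (fun i => u (r i)) := by
    intro u
    have hu : (fun i => u (Sum.inr i)) = ![u (Sum.inr 0), u (Sum.inr 1)] := by
      ext i; fin_cases i <;> rfl
    have hr : ∀ i : Fin k, r (Sum.inl i) = Sum.inl i := fun i =>
      swap_apply_of_ne_of_ne (by simp) (by simp)
    simp only [G, hr]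
    rw [hu, hb, swap_apply_left, swap_apply_right, Units.neg_smul, one_smul, mul_sub,
      sub_eq_add_neg]
  rw [altSum_congr h1, altSum_add, altSum_zsmul, altSum_comp_perm,
    show Perm.sign r = -1 from Perm.sign_swap (by simp)]
  suffices altSum G v = 0 by simp [this]
  let e : (Fin k ⊕ Fin 1) ⊕ Fin 1 ≃ Fin k ⊕ Fin 2 :=
    (Equiv.sumAssoc _ _ _).trans (Equiv.sumCongr (Equiv.refl _) (finSumFinEquiv (m := 1) (n := 1)))
  -- With the last vector `q 0` frozen as a parameter, alternating over the remaining slots gives `p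
  -- ∧ h (q 0)`, which vanishes.
  let K : (Fin k ⊕ Fin 1 → V) → (Fin 1 → V) → A := fun w q =>
    p (fun i => w (Sum.inl i)) * h (q 0) (fun i => w (Sum.inr i))
  have h2 : ∀ u, G u = (fun w : (Fin k ⊕ Fin 1) ⊕ Fin 1 → V =>
      K (fun i => w (Sum.inl i)) (fun j => w (Sum.inr j))) (fun i => u (e i)) := by
    intro u
    simp only [G, K]
    congr 2
    ext i
    fin_cases i
    rfl
  rw [altSum_congr h2, ← altSum_reindex e (fun w : (Fin k ⊕ Fin 1) ⊕ Fin 1 → V =>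
    K (fun i => w (Sum.inl i)) (fun j => w (Sum.inr j)))]
  refine nsmul_eq_zero_of_real (n := (Fintype.card (Fin k ⊕ Fin 1)).factorial) (by positivity) ?_
  rw [← altSum_partial]
  have h5 : ∀ (w : Fin k ⊕ Fin 1 → V) (q : Fin 1 → V), altSum (fun p => K p q) w = 0 :=
    fun w q => altSum_mul_eq_zero_of_wedge_eq_zero (hp (q 0)) w
  simp only [h5]
  exact altSum_zero _

end WedgeVanishing

/-! ### Alternated derivatives and the Leibniz rule. -/

section Uncurry

open Equiv

variable {V : Type*} [NormedAddCommGroup V] [NormedSpace ℝ V]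
  {A : Type*} [NormedCommRing A] [NormedAlgebra ℝ A] {k l : ℕ}

/-- The `i`-th term of the alternated derivative is the `0`-th one with its arguments permuted by a
cycle of sign `(-1)^i`. After a full alternation all `k + 1` terms coincide, and `(k + 1)! = (k + 1)
* k!` leaves the factor `k!`. -/
theorem altSum_alternatizeUncurryFin (f : V →L[ℝ] V [⋀^Fin k]→L[ℝ] A) (v : Fin (k + 1) → V) :
    k.factorial • ContinuousAlternatingMap.alternatizeUncurryFin f v =
      altSum (fun u : Fin (k + 1) → V => f (u 0) (fun i => u i.succ)) v := by
  have h1 := altSum_alternating (ContinuousAlternatingMap.alternatizeUncurryFin f) v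
  have h2 : ∀ u : Fin (k + 1) → V, ContinuousAlternatingMap.alternatizeUncurryFin f u =
      ∑ i : Fin (k + 1), Perm.sign (i.cycleRange.symm) •
        (fun u : Fin (k + 1) → V => f (u 0) (fun i => u i.succ))
          (fun j => u (i.cycleRange.symm j)) := by
    intro u
    rw [ContinuousAlternatingMap.alternatizeUncurryFin_apply]
    refine Finset.sum_congr rfl fun i _ => ?_
    rw [Perm.sign_symm, Fin.sign_cycleRange]
    simp only [Fin.cycleRange_symm_zero, Fin.cycleRange_symm_succ]
    rw [Units.smul_def]
    push_cast
    rfl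
  rw [altSum_congr h2, altSum_sum] at h1
  have h3 : ∀ i : Fin (k + 1), altSum (fun u : Fin (k + 1) → V => Perm.sign (i.cycleRange.symm) •
        (fun u : Fin (k + 1) → V => f (u 0) (fun i => u i.succ))
          (fun j => u (i.cycleRange.symm j))) v =
      altSum (fun u : Fin (k + 1) → V => f (u 0) (fun i => u i.succ)) v := by
    intro i
    rw [altSum_zsmul, altSum_comp_perm i.cycleRange.symm
      (fun u : Fin (k + 1) → V => f (u 0) (fun i => u i.succ)), smul_smul, Int.units_mul_self,
      one_smul]
  rw [Finset.sum_congr rfl fun i _ => h3 i] at h1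
  simp only [Finset.sum_const, Finset.card_univ, Fintype.card_fin] at h1
  refine (nsmul_left_cancel_of_real (n := k + 1) (by positivity) ?_).symm
  rw [h1, smul_smul, Nat.factorial_succ]

/-- The algebraic core of the Leibniz rule, for vanishing derivatives. -/
theorem alternatizeUncurryFin_eq_zero_of_wedge {f : V →L[ℝ] V [⋀^Fin k]→L[ℝ] A}
    {g : V →L[ℝ] V [⋀^Fin l]→L[ℝ] A} {a : V [⋀^Fin k]→L[ℝ] A} {b : V [⋀^Fin l]→L[ℝ] A}
    {F : V →L[ℝ] V [⋀^Fin (k + l)]→L[ℝ] A}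
    (hF : ∀ u, F u = wedge (f u) b + wedge a (g u))
    (hf : wedge (ContinuousAlternatingMap.alternatizeUncurryFin f) b = 0)
    (hg : wedge a (ContinuousAlternatingMap.alternatizeUncurryFin g) = 0) :
    ContinuousAlternatingMap.alternatizeUncurryFin F = 0 := by
  let c (j : ℕ) : Fin 1 ⊕ Fin j ≃ Fin (j + 1) :=
    finSumFinEquiv.trans (finCongr (add_comm 1 j))
  have c_zero (j : ℕ) : c j (Sum.inl 0) = 0 := by
    ext; simp [c]
  have c_succ (j : ℕ) (i : Fin j) : c j (Sum.inr i) = i.succ := by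
    ext; simp [c]
  have key {j : ℕ} (f : V →L[ℝ] V [⋀^Fin j]→L[ℝ] A) (u : Fin (j + 1) → V) :
      j.factorial • ContinuousAlternatingMap.alternatizeUncurryFin f u =
        altSum (fun u : Fin 1 ⊕ Fin j → V => f (u (Sum.inl 0)) (fun i => u (Sum.inr i)))
          (fun i => u (c j i)) := by
    rw [altSum_alternatizeUncurryFin, altSum_reindex (c j)]
    simp only [c_zero, c_succ]
  ext v
  change _ = (0 : A)
  refine nsmul_eq_zero_of_real (n := (k.factorial * l.factorial) * (k + l).factorial)
    (by positivity) ?_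
  rw [mul_smul, key, ← altSum_nsmul]
  -- The two Leibniz terms before alternation; `q 0` is the direction of differentiation.
  let K₁ : (Fin 1 → V) → (Fin k ⊕ Fin l → V) → A := fun q w =>
    f (q 0) (fun i => w (Sum.inl i)) * b (fun i => w (Sum.inr i))
  let K₂ : (Fin 1 → V) → (Fin k ⊕ Fin l → V) → A := fun q w =>
    a (fun i => w (Sum.inl i)) * g (q 0) (fun i => w (Sum.inr i))
  have h1 : ∀ u : Fin 1 ⊕ Fin (k + l) → V, (k.factorial * l.factorial) •
      F (u (Sum.inl 0)) (fun i => u (Sum.inr i)) =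
      altSum (K₁ fun i => u (Sum.inl i)) (fun i => u (Sum.inr (finSumFinEquiv i))) +
      altSum (K₂ fun i => u (Sum.inl i)) (fun i => u (Sum.inr (finSumFinEquiv i))) := by
    intro u
    rw [hF, ContinuousAlternatingMap.add_apply, smul_add, wedge_eq_altSum', wedge_eq_altSum']
  rw [altSum_congr h1, altSum_add]
  let e : Fin 1 ⊕ (Fin k ⊕ Fin l) ≃ Fin 1 ⊕ Fin (k + l) :=
    Equiv.sumCongr (Equiv.refl _) finSumFinEquiv
  have red (K : (Fin 1 → V) → (Fin k ⊕ Fin l → V) → A) (v : Fin 1 ⊕ Fin (k + l) → V) :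
      altSum (fun u : Fin 1 ⊕ Fin (k + l) → V =>
        altSum (K fun i => u (Sum.inl i)) (fun i => u (Sum.inr (finSumFinEquiv i)))) v =
      (Fintype.card (Fin k ⊕ Fin l)).factorial • altSum (fun u : Fin 1 ⊕ (Fin k ⊕ Fin l) → V =>
        K (fun i => u (Sum.inl i)) (fun i => u (Sum.inr i))) (fun i => v (e i)) := by
    rw [← altSum_partial_right, altSum_reindex e]
    rfl
  rw [red, red]
  have z1 (v : Fin 1 ⊕ (Fin k ⊕ Fin l) → V) : altSum (fun u : Fin 1 ⊕ (Fin k ⊕ Fin l) → V =>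
        K₁ (fun i => u (Sum.inl i)) (fun i => u (Sum.inr i))) v = 0 := by
    let K : (Fin 1 ⊕ Fin k → V) → (Fin l → V) → A := fun w q =>
      f (w (Sum.inl 0)) (fun i => w (Sum.inr i)) * b q
    have h2 : ∀ u : Fin 1 ⊕ (Fin k ⊕ Fin l) → V,
        K₁ (fun i => u (Sum.inl i)) (fun i => u (Sum.inr i)) =
        (fun w : (Fin 1 ⊕ Fin k) ⊕ Fin l → V =>
          K (fun i => w (Sum.inl i)) (fun i => w (Sum.inr i)))
          (fun i => u (Equiv.sumAssoc _ _ _ i)) := fun u => rfl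
    rw [altSum_congr h2, ← altSum_reindex (Equiv.sumAssoc (Fin 1) (Fin k) (Fin l))
      (fun w : (Fin 1 ⊕ Fin k) ⊕ Fin l → V => K (fun i => w (Sum.inl i)) (fun j => w (Sum.inr j)))]
    refine nsmul_eq_zero_of_real (n := (Fintype.card (Fin 1 ⊕ Fin k)).factorial)
      (by positivity) ?_
    rw [← altSum_partial]
    have h3 : ∀ (w : Fin 1 ⊕ Fin k → V) (q : Fin l → V), altSum (fun p => K p q) w =
        k.factorial • (ContinuousAlternatingMap.alternatizeUncurryFin f
          (fun i => w ((c k).symm i)) * b q) := by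
      intro w q
      simp only [K]
      rw [altSum_mul_right (μ := Fin 1), ← smul_mul_assoc, key]
      simp
    simp only [h3]
    rw [altSum_nsmul]
    have h4 := (altSum_reindex (Equiv.sumCongr (c k) (Equiv.refl (Fin l))).symm _
      (fun i => v (Equiv.sumAssoc (Fin 1) (Fin k) (Fin l) i))).symm.trans
        (altSum_mul_eq_zero_of_wedge_eq_zero hf _)
    rw [show (0 : A) = k.factorial • 0 by simp, ← h4]
    rfl
  have z2 (v : Fin 1 ⊕ (Fin k ⊕ Fin l) → V) : altSum (fun u : Fin 1 ⊕ (Fin k ⊕ Fin l) → V =>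
        K₂ (fun i => u (Sum.inl i)) (fun i => u (Sum.inr i))) v = 0 := by
    let K : (Fin k → V) → (Fin 1 ⊕ Fin l → V) → A := fun q w =>
      a q * g (w (Sum.inl 0)) (fun i => w (Sum.inr i))
    -- Carries the direction of differentiation past the arguments of `a`, to stand beside `g`. The
    -- sign `(-1)^k` of the Leibniz rule plays no role because this term is shown to vanish.
    let e' : Fin k ⊕ (Fin 1 ⊕ Fin l) ≃ Fin 1 ⊕ (Fin k ⊕ Fin l) :=
      ((Equiv.sumAssoc _ _ _).symm.trans (Equiv.sumCongr (Equiv.sumComm _ _) (Equiv.refl _))).trans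
        (Equiv.sumAssoc _ _ _)
    have h2 : ∀ u : Fin 1 ⊕ (Fin k ⊕ Fin l) → V,
        K₂ (fun i => u (Sum.inl i)) (fun i => u (Sum.inr i)) =
        (fun w : Fin k ⊕ (Fin 1 ⊕ Fin l) → V =>
          K (fun i => w (Sum.inl i)) (fun i => w (Sum.inr i)))
          (fun i => u (e' i)) := fun u => rfl
    rw [altSum_congr h2, ← altSum_reindex e' (fun w : Fin k ⊕ (Fin 1 ⊕ Fin l) → V =>
      K (fun i => w (Sum.inl i)) (fun j => w (Sum.inr j)))]
    refine nsmul_eq_zero_of_real (n := (Fintype.card (Fin 1 ⊕ Fin l)).factorial)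
      (by positivity) ?_
    rw [← altSum_partial_right]
    have h3 : ∀ (w : Fin 1 ⊕ Fin l → V) (q : Fin k → V), altSum (fun p => K q p) w =
        l.factorial • (a q * ContinuousAlternatingMap.alternatizeUncurryFin g
          (fun i => w ((c l).symm i))) := by
      intro w q
      simp only [K]
      rw [altSum_mul_left, ← mul_smul_comm, key]
      simp
    simp only [h3]
    rw [altSum_nsmul]
    have h4 := (altSum_reindex (Equiv.sumCongr (Equiv.refl (Fin k)) (c l)).symm _
      (fun i => v (e' i))).symm.trans (altSum_mul_eq_zero_of_wedge_eq_zero hg _)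
    rw [show (0 : A) = l.factorial • 0 by simp, ← h4]
    rfl
  rw [z1, z2]
  simp

end Uncurry

/-! ### Smoothness and exterior derivatives of wedge products -/

section WedgeNorm

open Equiv

variable {V : Type*} [NormedAddCommGroup V] [NormedSpace ℝ V]
  {A : Type*} [NormedCommRing A] [NormedAlgebra ℝ A] {k l : ℕ}

/-- Each permutation contributes at most `‖a‖ ‖b‖ ∏ ‖v i‖`, and multiplying by `k! l! ≥ 1` only
enlarges the left side. The bound makes the wedge product a bounded bilinear map, so it is smooth
and obeys the product rule. -/
theorem norm_wedge_le (a : V [⋀^Fin k]→L[ℝ] A) (b : V [⋀^Fin l]→L[ℝ] A) :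
    ‖wedge a b‖ ≤ (Fintype.card (Perm (Fin k ⊕ Fin l)) : ℝ) * ‖a‖ * ‖b‖ := by
  refine ContinuousAlternatingMap.opNorm_le_bound _ (by positivity) fun v => ?_
  have h1 : ‖wedge a b v‖ ≤ ‖(k.factorial * l.factorial) • wedge a b v‖ := by
    rw [← Nat.cast_smul_eq_nsmul ℝ, norm_smul, Real.norm_natCast]
    refine le_mul_of_one_le_left (norm_nonneg _) ?_
    exact_mod_cast Nat.one_le_iff_ne_zero.2 (by positivity)
  refine h1.trans ?_
  rw [wedge_eq_altSum', altSum]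
  refine (norm_sum_le _ _).trans ?_
  rw [← Finset.card_univ, mul_assoc, mul_assoc, ← nsmul_eq_mul]
  refine Finset.sum_le_card_nsmul _ _ _ fun s _ => ?_
  have h2 : ∀ (u : ℤˣ) (x : A), ‖u • x‖ = ‖x‖ := by
    intro u x
    rcases Int.units_eq_one_or u with rfl | rfl <;> simp [Units.smul_def]
  rw [h2]
  refine (norm_mul_le _ _).trans ?_
  refine (mul_le_mul (a.le_opNorm _) (b.le_opNorm _) (norm_nonneg _) (by positivity)).trans ?_
  have h3 : ∏ i, ‖v i‖ = (∏ i : Fin k, ‖v (finSumFinEquiv (s (Sum.inl i)))‖) *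
      ∏ i : Fin l, ‖v (finSumFinEquiv (s (Sum.inr i)))‖ := by
    rw [← Fintype.prod_sumElim
      (fun i => ‖v (finSumFinEquiv (s (Sum.inl i)))‖) (fun i => ‖v (finSumFinEquiv (s (Sum.inr i)))‖)]
    refine (Fintype.prod_equiv (s.trans finSumFinEquiv) _ _ ?_).symm
    rintro (i | i) <;> rfl
  rw [h3]
  exact le_of_eq (by ring)

theorem isBoundedBilinearMap_wedge (V : Type*) [NormedAddCommGroup V] [NormedSpace ℝ V]
    (A : Type*) [NormedCommRing A] [NormedAlgebra ℝ A] (k l : ℕ) :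
    IsBoundedBilinearMap ℝ (fun p : (V [⋀^Fin k]→L[ℝ] A) × (V [⋀^Fin l]→L[ℝ] A) =>
      wedge p.1 p.2) where
  add_left := wedge_add_left
  smul_left c a b := wedge_smul_left c a b
  add_right := wedge_add_right
  smul_right c a b := wedge_smul_right c a b
  bound := ⟨Fintype.card (Perm (Fin k ⊕ Fin l)), by
    exact_mod_cast Fintype.card_pos, norm_wedge_le⟩

variable {E : Type*} [NormedAddCommGroup E] [NormedSpace ℝ E]

theorem _root_.IsBoundedBilinearMap.contDiffOn_comp {P Q R : Type*} [NormedAddCommGroup P]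
    [NormedSpace ℝ P] [NormedAddCommGroup Q] [NormedSpace ℝ Q] [NormedAddCommGroup R]
    [NormedSpace ℝ R] {f : P → Q → R} (hf : IsBoundedBilinearMap ℝ (fun p : P × Q => f p.1 p.2))
    {s : Set E} {n : WithTop ℕ∞} {p : E → P} {q : E → Q} (hp : ContDiffOn ℝ n p s)
    (hq : ContDiffOn ℝ n q s) : ContDiffOn ℝ n (fun y => f (p y) (q y)) s :=
  hf.contDiff.comp_contDiffOn (hp.prodMk hq)

theorem _root_.IsBoundedBilinearMap.fderiv_comp_apply {P Q R : Type*} [NormedAddCommGroup P]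
    [NormedSpace ℝ P] [NormedAddCommGroup Q] [NormedSpace ℝ Q] [NormedAddCommGroup R]
    [NormedSpace ℝ R] {f : P → Q → R} (hf : IsBoundedBilinearMap ℝ (fun p : P × Q => f p.1 p.2))
    {x : E} {p : E → P} {q : E → Q} (hp : DifferentiableAt ℝ p x)
    (hq : DifferentiableAt ℝ q x) (u : E) :
    fderiv ℝ (fun y => f (p y) (q y)) x u = f (fderiv ℝ p x u) (q x) + f (p x) (fderiv ℝ q x u) := by
  have hd := ((hf.hasFDerivAt (p x, q x)).comp x
    (hp.hasFDerivAt.prodMk hq.hasFDerivAt)).fderiv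
  simp only [Function.comp_def] at hd
  rw [hd]
  simp [IsBoundedBilinearMap.deriv, add_comm]

theorem ContDiffOn.wedge {s : Set E} {n : WithTop ℕ∞} {p : E → V [⋀^Fin k]→L[ℝ] A}
    {q : E → V [⋀^Fin l]→L[ℝ] A} (hp : ContDiffOn ℝ n p s) (hq : ContDiffOn ℝ n q s) :
    ContDiffOn ℝ n (fun y => HKTorus.wedge (p y) (q y)) s := by
  have h := IsBoundedBilinearMap.contDiffOn_comp (f := HKTorus.wedge)
    (isBoundedBilinearMap_wedge V A k l) hp hq
  exact h

theorem ContDiffOn.wedgePow {s : Set E} {n : WithTop ℕ∞} {p : E → V [⋀^Fin 2]→L[ℝ] A}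
    (hp : ContDiffOn ℝ n p s) (m : ℕ) :
    ContDiffOn ℝ n (fun y => HKTorus.wedgePow (p y) m) s := by
  induction m with
  | zero => exact contDiffOn_const
  | succ m ih => exact ContDiffOn.wedge ih hp

theorem isBoundedLinearMap_compContinuousAlternatingMap {A B : Type*} [NormedAddCommGroup A]
    [NormedSpace ℝ A] [NormedAddCommGroup B] [NormedSpace ℝ B] (f : A →L[ℝ] B) :
    IsBoundedLinearMap ℝ
      (fun a : V [⋀^Fin k]→L[ℝ] A => f.compContinuousAlternatingMap a) :=
  IsLinearMap.with_bound ⟨fun a b => by ext; simp, fun c a => by ext; simp⟩ ‖f‖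
    fun a => f.norm_compContinuousAlternatingMap_le a

theorem ContDiffOn.complexForm {s : Set E} {n : WithTop ℕ∞} {p q : E → V [⋀^Fin k]→L[ℝ] ℝ}
    (hp : ContDiffOn ℝ n p s) (hq : ContDiffOn ℝ n q s) :
    ContDiffOn ℝ n (fun y => HKTorus.complexForm (p y) (q y)) s := by
  have h1 := (isBoundedLinearMap_compContinuousAlternatingMap (V := V) (k := k)
    Complex.ofRealCLM).contDiff.comp_contDiffOn hp
  have h2 := (isBoundedLinearMap_compContinuousAlternatingMap (V := V) (k := k)
    (Complex.I • Complex.ofRealCLM)).contDiff.comp_contDiffOn hq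
  exact h1.add h2

theorem extDeriv_wedge_eq_zero {p : V → V [⋀^Fin k]→L[ℝ] A} {q : V → V [⋀^Fin l]→L[ℝ] A} {x : V}
    (hp : DifferentiableAt ℝ p x) (hq : DifferentiableAt ℝ q x)
    (h1 : wedge (extDeriv p x) (q x) = 0) (h2 : wedge (p x) (extDeriv q x) = 0) :
    extDeriv (fun y => wedge (p y) (q y)) x = 0 := by
  refine alternatizeUncurryFin_eq_zero_of_wedge (fun u => ?_) h1 h2
  have h := IsBoundedBilinearMap.fderiv_comp_apply (f := wedge (V := V) (A := A) (k := k) (l := l))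
    (isBoundedBilinearMap_wedge V A k l) hp hq u
  exact h

end WedgeNorm

/-! ### Forms of type `(k, 0)` on one vector space. -/

section TypeTop

open Equiv

variable {V : Type*} [AddCommGroup V] [Module ℝ V] [TopologicalSpace V] {k l : ℕ}

/-- A complex form is complex linear in every argument with respect to `J`. -/
def IsTopAt (J : V → V) (w : V [⋀^Fin k]→L[ℝ] ℂ) : Prop :=
  ∀ (v : Fin k → V) (j : Fin k), w (Function.update v j (J (v j))) = Complex.I * w v

/-- In each summand of the signed sum the `j`-th vector is an argument of exactly one of the two
factors, and that factor releases the scalar `i`. -/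
theorem IsTopAt.wedge {J : V → V} {a : V [⋀^Fin k]→L[ℝ] ℂ} {b : V [⋀^Fin l]→L[ℝ] ℂ}
    (ha : IsTopAt J a) (hb : IsTopAt J b) : IsTopAt J (HKTorus.wedge a b) := by
  intro v j
  refine nsmul_left_cancel_of_real (n := k.factorial * l.factorial) (by positivity) ?_
  rw [← mul_smul_comm, wedge_eq_altSum', wedge_eq_altSum', ← altSum_mul_left]
  unfold altSum
  refine Finset.sum_congr rfl fun s _ => ?_
  congr 1
  obtain ⟨j', hj'⟩ : ∃ j', finSumFinEquiv (s j') = j :=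
    ⟨s.symm (finSumFinEquiv.symm j), by simp⟩
  have hu : ∀ i, Function.update v j (J (v j)) (finSumFinEquiv (s i)) =
      Function.update (fun i => v (finSumFinEquiv (s i))) j'
        (J (v (finSumFinEquiv (s j')))) i := by
    intro i
    rw [hj']
    by_cases h : i = j'
    · subst h; rw [hj']; simp
    · rw [Function.update_of_ne h, Function.update_of_ne]
      rintro rfl
      exact h (by simpa using hj'.symm)
  simp only [hu]
  rcases j' with j' | j'
  · have h1 := ha (fun i => v (finSumFinEquiv (s (Sum.inl i)))) j'
    have h2 : (fun i : Fin k => Function.update (fun i => v (finSumFinEquiv (s i))) (Sum.inl j')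
        (J (v (finSumFinEquiv (s (Sum.inl j'))))) (Sum.inl i)) =
      Function.update (fun i => v (finSumFinEquiv (s (Sum.inl i)))) j'
        (J (v (finSumFinEquiv (s (Sum.inl j'))))) := by
      ext i; by_cases h : i = j' <;> simp [h, Function.update]
    have h3 : (fun i : Fin l => Function.update (fun i => v (finSumFinEquiv (s i))) (Sum.inl j')
        (J (v (finSumFinEquiv (s (Sum.inl j'))))) (Sum.inr i)) =
      (fun i => v (finSumFinEquiv (s (Sum.inr i)))) := by
      ext i; simp [Function.update]
    rw [h2, h1, h3, mul_assoc]
  · have h1 := hb (fun i => v (finSumFinEquiv (s (Sum.inr i)))) j'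
    have h2 : (fun i : Fin l => Function.update (fun i => v (finSumFinEquiv (s i))) (Sum.inr j')
        (J (v (finSumFinEquiv (s (Sum.inr j'))))) (Sum.inr i)) =
      Function.update (fun i => v (finSumFinEquiv (s (Sum.inr i)))) j'
        (J (v (finSumFinEquiv (s (Sum.inr j'))))) := by
      ext i; by_cases h : i = j' <;> simp [h, Function.update]
    have h3 : (fun i : Fin k => Function.update (fun i => v (finSumFinEquiv (s i))) (Sum.inr j')
        (J (v (finSumFinEquiv (s (Sum.inr j'))))) (Sum.inl i)) =
      (fun i => v (finSumFinEquiv (s (Sum.inl i)))) := by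
      ext i; simp [Function.update]
    rw [h2, h1, h3, mul_left_comm]

theorem IsTopAt.wedgePow {J : V → V} {a : V [⋀^Fin 2]→L[ℝ] ℂ} (ha : IsTopAt J a) (m : ℕ) :
    IsTopAt J (HKTorus.wedgePow a m) := by
  induction m with
  | zero => intro v j; exact j.elim0
  | succ m ih => exact ih.wedge ha

theorem isTopAt_one {J : V → V} {a : V [⋀^Fin 1]→L[ℝ] ℂ}
    (h : ∀ v, a ![J v] = Complex.I * a ![v]) : IsTopAt J a := by
  intro v j
  have h1 : v = ![v 0] := by ext i; fin_cases i; rfl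
  have h2 : Function.update v j (J (v j)) = ![J (v 0)] := by
    ext i; fin_cases i; fin_cases j; simp
  rw [h2, h, ← h1]

theorem map_pair_swap (a : V [⋀^Fin 2]→L[ℝ] ℂ) (v w : V) : a ![v, w] = -a ![w, v] := by
  have := a.toAlternatingMap.map_swap ![w, v] (i := 0) (j := 1) (by simp)
  have h : ![w, v] ∘ (swap 0 1 : Perm (Fin 2)) = ![v, w] := by
    ext i; fin_cases i <;> rfl
  rw [h] at this
  exact this

theorem isTopAt_two {J : V → V} {a : V [⋀^Fin 2]→L[ℝ] ℂ}
    (h : ∀ v w, a ![J v, w] = Complex.I * a ![v, w]) : IsTopAt J a := by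
  intro v j
  have h1 : v = ![v 0, v 1] := by ext i; fin_cases i <;> rfl
  fin_cases j
  · have h2 : Function.update v 0 (J (v 0)) = ![J (v 0), v 1] := by
      ext i; fin_cases i <;> simp
    change a (Function.update v 0 (J (v 0))) = _
    rw [h2, h, ← h1]
  · have h2 : Function.update v 1 (J (v 1)) = ![v 0, J (v 1)] := by
      ext i; fin_cases i <;> simp
    change a (Function.update v 1 (J (v 1))) = _
    rw [h2, map_pair_swap, h, map_pair_swap, ← h1]
    ring

/-- A form of type `(k, 0)` vanishes when `k` exceeds the complex dimension. -/
theorem IsTopAt.eq_zero [FiniteDimensional ℝ V] {J : V →ₗ[ℝ] V} (hJ : ∀ v, J (J v) = -v)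
    {a : V [⋀^Fin k]→L[ℝ] ℂ} (ha : IsTopAt J a) (hk : Module.finrank ℝ V < 2 * k) : a = 0 := by
  -- `J² = -1` makes `V` a complex vector space of half the real dimension, and `a` becomes complex
  -- multilinear.
  let φ : ℂ →ₐ[ℝ] Module.End ℝ V := Complex.lift ⟨J, by ext v; simp [hJ]⟩
  have hφ : ∀ (z : ℂ) (v : V), φ z v = z.re • v + z.im • J v := by
    intro z v
    simp [φ, Complex.lift_apply, Complex.liftAux_apply, Algebra.algebraMap_eq_smul_one]
  let _ : Module ℂ V := Module.compHom V φ.toRingHom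
  have hsmul : ∀ (z : ℂ) (v : V), z • v = z.re • v + z.im • J v := hφ
  have : IsScalarTower ℝ ℂ V := ⟨fun r z v => by
    rw [hsmul, hsmul, smul_add, smul_smul, smul_smul]; simp⟩
  have : FiniteDimensional ℂ V := FiniteDimensional.right ℝ ℂ V
  have hdim : Module.finrank ℂ V < k := by
    have := Module.finrank_mul_finrank ℝ ℂ V
    rw [Complex.finrank_real_complex] at this
    omega
  let a' : V [⋀^Fin k]→ₗ[ℂ] ℂ :=
    { toFun := a
      map_update_add' := fun {inst} v i x y => by
        obtain rfl : inst = instDecidableEqFin k := Subsingleton.elim _ _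
        exact a.map_update_add v i x y
      map_update_smul' := fun {inst} v i z x => by
        obtain rfl : inst = instDecidableEqFin k := Subsingleton.elim _ _
        have h1 := a.map_update_add v i (z.re • x) (z.im • J x)
        have h2 := a.map_update_smul v i z.re x
        have h3 := a.map_update_smul v i z.im (J x)
        have h4 := ha (Function.update v i x) i
        simp only [Function.update_self, Function.update_idem] at h4
        rw [hsmul]
        refine h1.trans ?_
        rw [h2, h3]
        rw [h4]
        conv_rhs => rw [← Complex.re_add_im z]
        simp only [Complex.real_smul, smul_eq_mul]
        ring
      map_eq_zero_of_eq' := fun v i j h hij => a.toAlternatingMap.map_eq_zero_of_eq v h hij }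
  ext v
  -- More vectors than the complex dimension are dependent, and an alternating map kills them.
  have : ¬ LinearIndependent ℂ v := fun h => by
    have := h.fintype_card_le_finrank
    simp at this
    omega
  exact a'.map_linearDependent v this

end TypeTop

/-! ### Quaternionic bases and forms of type `(2n, 0)` -/

section QuaternionicBasis

variable {V : Type*} [AddCommGroup V] [Module ℝ V]

/-- The operators `1, J₁, J₂, J₃`. -/
def quatOp (J : Fin 3 → V →ₗ[ℝ] V) : Fin 4 → V →ₗ[ℝ] V :=
  ![LinearMap.id, J 0, J 1, J 2]

variable {B : V →ₗ[ℝ] V →ₗ[ℝ] ℝ} {J : Fin 3 → V →ₗ[ℝ] V}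

/-- The matrices `stdForm i` are left multiplication by the imaginary units in the basis `1, i, j,
k`, with the images as rows. Hence the same matrices give the standard forms and the action on a
quaternionic line. -/
theorem quatOp_mul (sq : ∀ i v, J i (J i v) = -v)
    (mul : ∀ i v, J i (J (i + 1) v) = J (i + 2) v)
    (anti : ∀ i v, J i (J (i + 1) v) = -J (i + 1) (J i v)) (i : Fin 3) (p : Fin 4) (v : V) :
    J i (quatOp J p v) = ∑ q, stdForm i p q • quatOp J q v := by
  have m0 : J 0 (J 1 v) = J 2 v := mul 0 v
  have m1 : J 1 (J 2 v) = J 0 v := mul 1 v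
  have m2 : J 2 (J 0 v) = J 1 v := mul 2 v
  have a0 : J 0 (J 1 v) = -J 1 (J 0 v) := anti 0 v
  have a1 : J 1 (J 2 v) = -J 2 (J 1 v) := anti 1 v
  have a2 : J 2 (J 0 v) = -J 0 (J 2 v) := anti 2 v
  have b0 : J 1 (J 0 v) = -J 2 v := by rw [← m0, a0, neg_neg]
  have b1 : J 2 (J 1 v) = -J 0 v := by rw [← m1, a1, neg_neg]
  have b2 : J 0 (J 2 v) = -J 1 v := by rw [← m2, a2, neg_neg]
  fin_cases i <;> fin_cases p <;>
    simp [quatOp, stdForm, Fin.sum_univ_four, sq, m0, m1, m2, b0, b1, b2]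

theorem skew_of_hermitian (sq : ∀ i v, J i (J i v) = -v)
    (herm : ∀ i v w, B (J i v) (J i w) = B v w) (i : Fin 3) (v w : V) :
    B (J i v) w = -B v (J i w) := by
  have := herm i v (J i w)
  rw [sq, map_neg] at this
  linarith

/-- Skewness moves the operator on `y` over to `x`. The product of operators is again a combination
of `1, J₁, J₂, J₃`, and only its component along `1` pairs nontrivially with `y`. -/
theorem quatOp_inner (sq : ∀ i v, J i (J i v) = -v)
    (mul : ∀ i v, J i (J (i + 1) v) = J (i + 2) v)
    (anti : ∀ i v, J i (J (i + 1) v) = -J (i + 1) (J i v))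
    (herm : ∀ i v w, B (J i v) (J i w) = B v w) {x y : V} (h : ∀ i, B (J i x) y = 0)
    (p q : Fin 4) : B (quatOp J p x) (quatOp J q y) = if p = q then B x y else 0 := by
  have hs := fun i => skew_of_hermitian sq herm i x y
  have h' : ∀ i, B x (J i y) = 0 := fun i => by linarith [hs i, h i]
  have hq : ∀ i : Fin 3, ∀ p : Fin 4, B (quatOp J p x) (J i y) =
      -∑ r, stdForm i p r * B (quatOp J r x) y := by
    intro i p
    have := skew_of_hermitian sq herm i (quatOp J p x) y
    rw [quatOp_mul sq mul anti] at this
    rw [map_sum, LinearMap.sum_apply] at this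
    simp only [map_smul, LinearMap.smul_apply, smul_eq_mul] at this
    linarith
  have h0 : ∀ r : Fin 4, B (quatOp J r x) y = if r = 0 then B x y else 0 := by
    intro r
    fin_cases r <;> simp [quatOp, h]
  have hq' : ∀ i : Fin 3, ∀ p : Fin 4, B (quatOp J p x) (J i y) = -(stdForm i p 0 * B x y) := by
    intro i p
    rw [hq]
    simp [h0]
  fin_cases q
  · simpa [quatOp] using h0 p
  · have := hq' 0 p
    fin_cases p <;> simpa [quatOp, stdForm] using this
  · have := hq' 1 p
    fin_cases p <;> simpa [quatOp, stdForm] using this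
  · have := hq' 2 p
    fin_cases p <;> simpa [quatOp, stdForm] using this

/-- Gram–Schmidt over the quaternions: each new unit vector is orthogonal to the quaternionic lines
of all previous ones. Its orthogonality to its own `Jᵢ`-images is automatic by skewness. -/
theorem exists_quaternionic_orthonormal [FiniteDimensional ℝ V] {m : ℕ}
    (hm : Module.finrank ℝ V = 4 * m) (symm : ∀ v w, B v w = B w v)
    (pos : ∀ v, v ≠ 0 → 0 < B v v) (sq : ∀ i v, J i (J i v) = -v)
    (herm : ∀ i v w, B (J i v) (J i w) = B v w) (k : ℕ) (hk : k ≤ m) :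
    ∃ e : Fin k → V, (∀ a b, B (e a) (e b) = if a = b then 1 else 0) ∧
      ∀ i a b, B (J i (e a)) (e b) = 0 := by
  induction k with
  | zero => exact ⟨fun a => a.elim0, fun a => a.elim0, fun _ a => a.elim0⟩
  | succ k ih =>
    obtain ⟨e, he, hJ⟩ := ih (by omega)
    let F : V →ₗ[ℝ] (Fin k × Fin 4 → ℝ) := LinearMap.pi fun p => B (quatOp J p.2 (e p.1))
    -- These are `4k` linear conditions on a space of dimension `4m` with `k < m`.
    have hF : F.ker ≠ ⊥ := LinearMap.ker_ne_bot_of_finrank_lt (by simp [hm]; omega)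
    obtain ⟨v, hv, hv0⟩ := Submodule.exists_mem_ne_zero_of_ne_bot hF
    have hFv : ∀ a p, B (quatOp J p (e a)) v = 0 := by
      intro a p
      exact congrFun (LinearMap.mem_ker.1 hv) (a, p)
    have hpos := pos v hv0
    let u : V := (Real.sqrt (B v v))⁻¹ • v
    have hu : B u u = 1 := by
      simp only [u, map_smul, LinearMap.smul_apply, smul_eq_mul]
      have h1 : Real.sqrt (B v v) ≠ 0 := (Real.sqrt_pos.2 hpos).ne'
      have h2 := Real.mul_self_sqrt hpos.le
      field_simp
      nlinarith
    have hFu : ∀ a p, B (quatOp J p (e a)) u = 0 := by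
      intro a p
      simp [u, hFv]
    have h0 : ∀ a, B (e a) u = 0 := fun a => hFu a 0
    have h1 : ∀ i a, B (J i (e a)) u = 0 := by
      intro i a
      fin_cases i
      · exact hFu a 1
      · exact hFu a 2
      · exact hFu a 3
    refine ⟨Fin.snoc (α := fun _ => V) e u, ?_, ?_⟩
    · intro a b
      refine Fin.lastCases ?_ (fun a => ?_) a <;> refine Fin.lastCases ?_ (fun b => ?_) b
      · simp [hu]
      · simp [symm u, h0, (Fin.castSucc_lt_last b).ne']
      · simp [h0, (Fin.castSucc_lt_last a).ne]
      · simp [he]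
    · intro i a b
      refine Fin.lastCases ?_ (fun a => ?_) a <;> refine Fin.lastCases ?_ (fun b => ?_) b
      · have := skew_of_hermitian sq herm i u u
        rw [symm u] at this
        simp
        linarith
      · have := skew_of_hermitian sq herm i u (e b)
        rw [symm u, h1] at this
        simpa using this
      · simp [h1]
      · simp [hJ]

/-- A quaternionic Hermitian vector space has an orthonormal basis adapted to the quaternions. -/
theorem exists_quaternionic_basis [FiniteDimensional ℝ V] {m : ℕ}
    (hm : Module.finrank ℝ V = 4 * m) (symm : ∀ v w, B v w = B w v)
    (pos : ∀ v, v ≠ 0 → 0 < B v v) (sq : ∀ i v, J i (J i v) = -v)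
    (mul : ∀ i v, J i (J (i + 1) v) = J (i + 2) v)
    (anti : ∀ i v, J i (J (i + 1) v) = -J (i + 1) (J i v))
    (herm : ∀ i v w, B (J i v) (J i w) = B v w) :
    ∃ b : Module.Basis (Fin m × Fin 4) ℝ V,
      (∀ p q, B (b p) (b q) = if p = q then 1 else 0) ∧
      ∀ i p q, B (J i (b p)) (b q) = if p.1 = q.1 then stdForm i p.2 q.2 else 0 := by
  obtain ⟨e, he, hJ⟩ := exists_quaternionic_orthonormal hm symm pos sq herm m le_rfl
  let f : Fin m × Fin 4 → V := fun p => quatOp J p.2 (e p.1)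
  have hf : ∀ p q, B (f p) (f q) = if p = q then 1 else 0 := by
    intro p q
    rw [quatOp_inner sq mul anti herm (fun i => hJ i _ _), he]
    by_cases h1 : p.1 = q.1 <;> by_cases h2 : p.2 = q.2 <;> simp [h1, h2, Prod.ext_iff]
  have hli : LinearIndependent ℝ f := by
    rw [Fintype.linearIndependent_iff]
    intro c hc q
    have := congrArg (fun x => B x (f q)) hc
    simpa [map_sum, LinearMap.sum_apply, hf] using this
  by_cases hm0 : Nonempty (Fin m × Fin 4)
  · refine ⟨basisOfLinearIndependentOfCardEqFinrank hli (by simp [hm, mul_comm]), ?_, ?_⟩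
    · simpa using hf
    · intro i p q
      simp only [coe_basisOfLinearIndependentOfCardEqFinrank, f]
      rw [quatOp_mul sq mul anti, map_sum, LinearMap.sum_apply]
      simp only [map_smul, LinearMap.smul_apply, smul_eq_mul]
      simp only [quatOp_inner sq mul anti herm (fun i => hJ i _ _), he]
      simp
  · have hm1 : Fintype.card (Fin m × Fin 4) = Module.finrank ℝ V := by simp [hm, mul_comm]
    have hempty : IsEmpty (Fin m × Fin 4) := not_nonempty_iff.1 hm0
    have : Subsingleton V := Module.finrank_zero_iff.1 (by rw [← hm1]; simp)
    exact ⟨Module.Basis.empty V, fun p => hempty.elim p, fun _ p => hempty.elim p⟩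

end QuaternionicBasis

/-! ### Vanishing of wedge products for reasons of type. -/

section TypeVanishing

variable {V : Type*} [AddCommGroup V] [Module ℝ V] [TopologicalSpace V] {k : ℕ}

theorem complexForm_apply (a b : V [⋀^Fin k]→L[ℝ] ℝ) (v : Fin k → V) :
    complexForm a b v = a v + Complex.I * b v := by
  simp [complexForm]

theorem wedgePow_compContinuousLinearMap {W : Type*} [AddCommGroup W] [Module ℝ W]
    [TopologicalSpace W] (f : W →L[ℝ] V) (a : V [⋀^Fin 2]→L[ℝ] ℂ) (m : ℕ) :
    (wedgePow a m).compContinuousLinearMap f = wedgePow (a.compContinuousLinearMap f) m := by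
  induction m with
  | zero => rfl
  | succ m ih =>
    change (wedge _ _).compContinuousLinearMap f = wedge _ _
    rw [wedge_compContinuousLinearMap, ih]

section Pair

variable {A : Type*} [NormedAddCommGroup A] [NormedSpace ℝ A]

theorem pair_add_left (b : V [⋀^Fin 2]→L[ℝ] A) (v v' w : V) :
    b ![v + v', w] = b ![v, w] + b ![v', w] := by
  have h : ∀ x : V, Function.update ![0, w] 0 x = ![x, w] := fun x => by
    ext i; fin_cases i <;> rfl
  have := b.map_update_add ![0, w] 0 v v'
  rwa [h, h, h] at this

theorem pair_smul_left (b : V [⋀^Fin 2]→L[ℝ] A) (c : ℝ) (v w : V) :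
    b ![c • v, w] = c • b ![v, w] := by
  have h : ∀ x : V, Function.update ![0, w] 0 x = ![x, w] := fun x => by
    ext i; fin_cases i <;> rfl
  have := b.map_update_smul ![0, w] 0 c v
  rwa [h, h] at this

theorem pair_neg_left (b : V [⋀^Fin 2]→L[ℝ] A) (v w : V) :
    b ![-v, w] = -b ![v, w] := by
  have := pair_smul_left b (-1) v w
  simpa using this

end Pair

/-- Contraction of a `2`-form in the second argument. -/
noncomputable def contractRight (b : V [⋀^Fin 2]→L[ℝ] ℂ) (w : V) : V →L[ℝ] ℂ where
  toFun v := b ![v, w]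
  map_add' v v' := pair_add_left b v v' w
  map_smul' c v := pair_smul_left b c v w
  cont := b.cont.comp (continuous_pi fun i => by
    refine Fin.cases ?_ (fun j => ?_) i
    · exact continuous_id
    · exact continuous_const)

/-- A continuous linear form as a `1`-form. -/
noncomputable def oneForm (f : V →L[ℝ] ℂ) : V [⋀^Fin 1]→L[ℝ] ℂ :=
  ContinuousAlternatingMap.ofSubsingleton ℝ V ℂ (0 : Fin 1) f

variable [FiniteDimensional ℝ V] {J : V →L[ℝ] V} {n : ℕ} {S : V [⋀^Fin 2]→L[ℝ] ℂ}

/-- The product has type `(2n + 1, 0)`, one degree above the complex dimension `2n`. -/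
theorem wedge_wedgePow_eq_zero (hdim : Module.finrank ℝ V = 4 * n) (hJ : ∀ v, J (J v) = -v)
    (hS : ∀ v w, S ![J v, w] = Complex.I * S ![v, w]) (f : V →L[ℝ] ℂ)
    (hf : ∀ v, f (J v) = Complex.I * f v) : wedge (wedgePow S n) (oneForm f) = 0 := by
  have h1 : IsTopAt (J : V →ₗ[ℝ] V) (wedgePow S n) := (isTopAt_two hS).wedgePow n
  have h2 : IsTopAt (J : V →ₗ[ℝ] V) (oneForm f) := isTopAt_one fun v => hf v
  exact (h1.wedge h2).eq_zero hJ (by omega)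

/-- A `(2n, 0)`-form annihilates the `(2, 0)`-forms in complex dimension `2n`. -/
theorem wedge_wedgePow_two_zero (hdim : Module.finrank ℝ V = 4 * n) (hJ : ∀ v, J (J v) = -v)
    (hS : ∀ v w, S ![J v, w] = Complex.I * S ![v, w]) {b : V [⋀^Fin 2]→L[ℝ] ℂ}
    (hb : ∀ v w, b ![J v, w] = Complex.I * b ![v, w]) : wedge (wedgePow S n) b = 0 := by
  -- Contracting a `(2,0)`-form leaves a `(1,0)`-form; the factor `1/2` compensates for
  -- skew-symmetrization counting `b` twice.
  refine wedge_eq_zero_of_skew (h := fun w => oneForm ((2 : ℂ)⁻¹ • contractRight b w)) ?_ ?_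
  · intro x y
    change _ = (2 : ℂ)⁻¹ * b ![x, y] - (2 : ℂ)⁻¹ * b ![y, x]
    rw [map_pair_swap b y x]
    ring
  · intro w
    refine wedge_wedgePow_eq_zero hdim hJ hS _ fun v => ?_
    change (2 : ℂ)⁻¹ * b ![J v, w] = Complex.I * ((2 : ℂ)⁻¹ * b ![v, w])
    rw [hb]
    ring

/-- A `(2n, 0)`-form annihilates the `(1, 1)`-forms in complex dimension `2n`. -/
theorem wedge_wedgePow_one_one (hdim : Module.finrank ℝ V = 4 * n) (hJ : ∀ v, J (J v) = -v)
    (hS : ∀ v w, S ![J v, w] = Complex.I * S ![v, w]) {b : V [⋀^Fin 2]→L[ℝ] ℂ}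
    (hb : ∀ v w, b ![J v, J w] = b ![v, w]) : wedge (wedgePow S n) b = 0 := by
  have hb' : ∀ v w, b ![J v, w] = -b ![v, J w] := by
    intro v w
    have := hb v (J w)
    rw [hJ, map_pair_swap, pair_neg_left, neg_neg, map_pair_swap] at this
    rw [← this, neg_neg]
  -- Here `h w` is the `(1,0)`-part of `b(·, w)`. The added terms `b(J x, y)` are symmetric in `x`
  -- and `y` for a `(1,1)`-form, so skew-symmetrization removes them and leaves `b`.
  refine wedge_eq_zero_of_skew (h := fun w => oneForm ((2 : ℂ)⁻¹ •
    (contractRight b w - Complex.I • (contractRight b w).comp J))) ?_ ?_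
  · intro x y
    change _ = (2 : ℂ)⁻¹ * (b ![x, y] - Complex.I * b ![J x, y]) -
      (2 : ℂ)⁻¹ * (b ![y, x] - Complex.I * b ![J y, x])
    rw [map_pair_swap b y x, map_pair_swap b (J y) x, hb' x y]
    ring
  · intro w
    refine wedge_wedgePow_eq_zero hdim hJ hS _ fun v => ?_
    change (2 : ℂ)⁻¹ * (b ![J v, w] - Complex.I * b ![J (J v), w]) =
      Complex.I * ((2 : ℂ)⁻¹ * (b ![v, w] - Complex.I * b ![J v, w]))
    rw [hJ, pair_neg_left]
    linear_combination ((2 : ℂ)⁻¹ * b ![J v, w]) * Complex.I_mul_I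

end TypeVanishing

/-! ### Differential forms in charts -/

section CompContinuousLinearMap

variable {E F G : Type*} [NormedAddCommGroup E] [NormedSpace ℝ E] [NormedAddCommGroup F]
  [NormedSpace ℝ F] [NormedAddCommGroup G] [NormedSpace ℝ G] {k : ℕ}

/-- Serves to pass from smooth families of multilinear maps back to smooth families of alternating
ones. -/
theorem isBoundedLinearMap_alternatization : IsBoundedLinearMap ℝ
    (fun f : ContinuousMultilinearMap ℝ (fun _ : Fin k => E) G => f.alternatization) := by
  refine IsLinearMap.with_bound ⟨fun f g => map_add _ f g, fun c f => ?_⟩ (k.factorial) fun f => ?_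
  · ext v
    simp [ContinuousMultilinearMap.alternatization_apply_apply, Finset.smul_sum, smul_comm c]
  · refine ContinuousAlternatingMap.opNorm_le_bound _ (by positivity) fun v => ?_
    rw [ContinuousMultilinearMap.alternatization_apply_apply]
    refine (norm_sum_le _ _).trans ?_
    have hc : k.factorial = (Finset.univ : Finset (Equiv.Perm (Fin k))).card := by
      rw [Finset.card_univ, Fintype.card_perm, Fintype.card_fin]
    rw [hc, mul_assoc, ← nsmul_eq_mul]
    refine Finset.sum_le_card_nsmul _ _ _ fun s _ => ?_
    have h2 : ∀ (u : ℤˣ) (x : G), ‖u • x‖ = ‖x‖ := by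
      intro u x
      rcases Int.units_eq_one_or u with rfl | rfl <;> simp [Units.smul_def]
    rw [h2]
    refine (f.le_opNorm _).trans (le_of_eq ?_)
    rw [← Equiv.prod_comp s fun i => ‖v i‖]
    rfl

theorem _root_.ContDiffAt.compContinuousLinearMap {P : Type*} [NormedAddCommGroup P]
    [NormedSpace ℝ P] {n : WithTop ℕ∞} {x : P} {a : P → F [⋀^Fin k]→L[ℝ] G} {f : P → E →L[ℝ] F}
    (ha : ContDiffAt ℝ n a x) (hf : ContDiffAt ℝ n f x) :
    ContDiffAt ℝ n (fun y => (a y).compContinuousLinearMap (f y)) x := by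
  have h1 : ContDiffAt ℝ n (fun y =>
      ContinuousMultilinearMap.compContinuousLinearMapContinuousMultilinear ℝ
        (fun _ : Fin k => E) (fun _ => F) G (fun _ => f y)
        ((a y).toContinuousMultilinearMap)) x := by
    refine ContDiffAt.clm_apply ?_ ?_
    · exact ((ContinuousMultilinearMap.contDiff _).contDiffAt).comp x
        (contDiffAt_pi.2 fun _ => hf)
    · exact (ContinuousAlternatingMap.toContinuousMultilinearMapCLM ℝ
        (E := F) (F := G) (ι := Fin k)).contDiff.contDiffAt.comp x ha
  have h2 := ((isBoundedLinearMap_alternatization (E := E) (G := G)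
    (k := k)).contDiff.contDiffAt.comp x h1).const_smul ((k.factorial : ℝ)⁻¹)
  refine h2.congr_of_eventuallyEq (Filter.Eventually.of_forall fun y => ?_)
  -- Alternating a form that is already alternating multiplies it by `k!`, so dividing by `k!`
  -- recovers the pullback.
  have h3 : (((a y).compContinuousLinearMap (f y)).toContinuousMultilinearMap).alternatization =
      (k.factorial : ℝ) • (a y).compContinuousLinearMap (f y) := by
    apply ContinuousAlternatingMap.toAlternatingMap_injective
    rw [ContinuousMultilinearMap.alternatization_apply_toAlternatingMap]
    refine (AlternatingMap.coe_alternatization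
      ((a y).compContinuousLinearMap (f y)).toAlternatingMap).trans ?_
    ext v
    simp [Nat.cast_smul_eq_nsmul]
  change _ = (k.factorial : ℝ)⁻¹ •
    (((a y).compContinuousLinearMap (f y)).toContinuousMultilinearMap).alternatization
  rw [h3, smul_smul, inv_mul_cancel₀ (by positivity), one_smul]

end CompContinuousLinearMap

/-! ### Local representatives of forms, their pullbacks and exterior derivatives. -/

section Charts

open Set Filter Topology

variable {d e : ℕ} {X : Type*} [TopologicalSpace X] [ChartedSpace (Euc d) X]
  {Y : Type*} [TopologicalSpace Y] [ChartedSpace (Euc e) Y]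
  {A : Type*} [NormedAddCommGroup A] [NormedSpace ℝ A] {k : ℕ}

/-- The derivative of the inverse chart, as an endomorphism of the model space. -/
noncomputable def chartInv (x₀ : X) (y : Euc d) : Euc d →L[ℝ] Euc d :=
  mfderiv 𝓘(ℝ, Euc d) (𝓡 d) (extChartAt (𝓡 d) x₀).symm y

variable (d e) in
/-- The derivative of a map, as a linear map between the model spaces. -/
noncomputable def rawDeriv (f : Y → X) (y : Y) : Euc e →L[ℝ] Euc d :=
  mfderiv (𝓡 e) (𝓡 d) f y

/-- A form with its values regarded as forms on the model space. -/
def rawForm (τ : DForm d X k A) (x : X) : Euc d [⋀^Fin k]→L[ℝ] A := τ x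

theorem inChart_eq (x₀ : X) (τ : DForm d X k A) (y : Euc d) :
    inChart x₀ τ y = (rawForm τ ((extChartAt (𝓡 d) x₀).symm y)).compContinuousLinearMap
      (chartInv x₀ y) := rfl

variable (d e) in
/-- A map written in charts. -/
noncomputable def mapInChart (f : Y → X) (y₀ : Y) (x₀ : X) : Euc e → Euc d :=
  extChartAt (𝓡 d) x₀ ∘ f ∘ (extChartAt (𝓡 e) y₀).symm

variable [IsManifold (𝓡 d) ∞ X] [IsManifold (𝓡 e) ∞ Y]

theorem mdifferentiableAt_extChartAt_symm' {x₀ : X} {y : Euc d}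
    (hy : y ∈ (extChartAt (𝓡 d) x₀).target) :
    MDifferentiableAt 𝓘(ℝ, Euc d) (𝓡 d) (extChartAt (𝓡 d) x₀).symm y :=
  ((contMDiffOn_extChartAt_symm (n := ∞) x₀).contMDiffAt
    ((isOpen_extChartAt_target x₀).mem_nhds hy)).mdifferentiableAt (by simp)

theorem chartInv_eq (x₀ : X) (y : Euc d) : chartInv x₀ y =
    mfderivWithin 𝓘(ℝ, Euc d) (𝓡 d) (extChartAt (𝓡 d) x₀).symm (range (𝓡 d)) y := by
  rw [ModelWithCorners.range_eq_univ, mfderivWithin_univ]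
  rfl

theorem chartInv_self (x₀ : X) :
    chartInv x₀ (extChartAt (𝓡 d) x₀ x₀) = ContinuousLinearMap.id ℝ (Euc d) := by
  rw [chartInv_eq]
  exact mfderivWithin_range_extChartAt_symm

theorem isInvertible_chartInv {x₀ : X} {y : Euc d} (hy : y ∈ (extChartAt (𝓡 d) x₀).target) :
    (chartInv x₀ y).IsInvertible := by
  rw [chartInv_eq]
  exact isInvertible_mfderivWithin_extChartAt_symm hy

theorem dForm_eq (τ : DForm d X k A) (x : X) :
    dForm τ x = extDeriv (inChart x τ) (extChartAt (𝓡 d) x x) := by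
  unfold dForm
  rw [mfderiv_extChartAt_self]
  ext v
  rfl

theorem contDiffAt_mapInChart {f : Y → X} (hf : ContMDiff (𝓡 e) (𝓡 d) ∞ f) {y₀ : Y} {x₀ : X}
    {y : Euc e} (hy : y ∈ (extChartAt (𝓡 e) y₀).target)
    (hfy : f ((extChartAt (𝓡 e) y₀).symm y) ∈ (extChartAt (𝓡 d) x₀).source) :
    ContDiffAt ℝ ∞ (mapInChart d e f y₀ x₀) y := by
  rw [← contMDiffAt_iff_contDiffAt]
  refine ContMDiffAt.comp y (contMDiffAt_extChartAt' ?_) (hf.contMDiffAt.comp y ?_)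
  · simpa using hfy
  · exact (contMDiffOn_extChartAt_symm (n := ∞) y₀).contMDiffAt
      ((isOpen_extChartAt_target y₀).mem_nhds hy)

theorem eventually_mem_source {f : Y → X} (hf : ContMDiff (𝓡 e) (𝓡 d) ∞ f) {y₀ : Y} {x₀ : X}
    {y : Euc e} (hy : y ∈ (extChartAt (𝓡 e) y₀).target)
    (hfy : f ((extChartAt (𝓡 e) y₀).symm y) ∈ (extChartAt (𝓡 d) x₀).source) :
    ∀ᶠ z in 𝓝 y, z ∈ (extChartAt (𝓡 e) y₀).target ∧
      f ((extChartAt (𝓡 e) y₀).symm z) ∈ (extChartAt (𝓡 d) x₀).source := by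
  refine Filter.Eventually.and ((isOpen_extChartAt_target y₀).mem_nhds hy) ?_
  have h1 : ContinuousAt (fun z => f ((extChartAt (𝓡 e) y₀).symm z)) y :=
    hf.continuous.continuousAt.comp (continuousAt_extChartAt_symm'' hy)
  exact h1.eventually ((isOpen_extChartAt_source x₀).mem_nhds hfy)

/-- The chain rule for two factorizations of `f ∘ chart⁻¹`, which agree near `y`. -/
theorem rawDeriv_comp_chartInv {f : Y → X} (hf : ContMDiff (𝓡 e) (𝓡 d) ∞ f) {y₀ : Y} {x₀ : X}
    {y : Euc e} (hy : y ∈ (extChartAt (𝓡 e) y₀).target)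
    (hfy : f ((extChartAt (𝓡 e) y₀).symm y) ∈ (extChartAt (𝓡 d) x₀).source) :
    (rawDeriv d e f ((extChartAt (𝓡 e) y₀).symm y)).comp (chartInv y₀ y) =
      (chartInv x₀ (mapInChart d e f y₀ x₀ y)).comp (fderiv ℝ (mapInChart d e f y₀ x₀) y) := by
  have h1 : mfderiv 𝓘(ℝ, Euc e) (𝓡 d) (f ∘ (extChartAt (𝓡 e) y₀).symm) y =
      (rawDeriv d e f ((extChartAt (𝓡 e) y₀).symm y)).comp (chartInv y₀ y) :=
    mfderiv_comp y (hf.mdifferentiable (by simp) _) (mdifferentiableAt_extChartAt_symm' hy)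
  have h2 : f ∘ (extChartAt (𝓡 e) y₀).symm =ᶠ[𝓝 y]
      (extChartAt (𝓡 d) x₀).symm ∘ mapInChart d e f y₀ x₀ := by
    filter_upwards [eventually_mem_source hf hy hfy] with z hz
    exact ((extChartAt (𝓡 d) x₀).left_inv hz.2).symm
  have hm : mapInChart d e f y₀ x₀ y ∈ (extChartAt (𝓡 d) x₀).target :=
    (extChartAt (𝓡 d) x₀).map_source hfy
  have h3 : mfderiv 𝓘(ℝ, Euc e) (𝓡 d) ((extChartAt (𝓡 d) x₀).symm ∘ mapInChart d e f y₀ x₀) y =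
      (chartInv x₀ (mapInChart d e f y₀ x₀ y)).comp
        (mfderiv 𝓘(ℝ, Euc e) 𝓘(ℝ, Euc d) (mapInChart d e f y₀ x₀) y) :=
    mfderiv_comp y (mdifferentiableAt_extChartAt_symm' hm)
      (((contDiffAt_mapInChart hf hy hfy).differentiableAt (by simp)).mdifferentiableAt)
  rw [mfderiv_eq_fderiv] at h3
  exact h1.symm.trans (h2.mfderiv_eq.trans h3)

/-- The chart at `x₀` only has to contain the image point. Smoothness of a pullback can thus be
checked near each point with a chart chosen for that point. -/
theorem inChart_pullback {f : Y → X} (hf : ContMDiff (𝓡 e) (𝓡 d) ∞ f) (τ : DForm d X k A) {y₀ : Y}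
    {x₀ : X} {y : Euc e} (hy : y ∈ (extChartAt (𝓡 e) y₀).target)
    (hfy : f ((extChartAt (𝓡 e) y₀).symm y) ∈ (extChartAt (𝓡 d) x₀).source) :
    inChart y₀ (pullback f τ) y = (inChart x₀ τ (mapInChart d e f y₀ x₀ y)).compContinuousLinearMap
      (fderiv ℝ (mapInChart d e f y₀ x₀) y) := by
  have h1 : inChart y₀ (pullback f τ) y =
      (rawForm τ (f ((extChartAt (𝓡 e) y₀).symm y))).compContinuousLinearMap
        ((rawDeriv d e f ((extChartAt (𝓡 e) y₀).symm y)).comp (chartInv y₀ y)) := rfl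
  rw [h1, rawDeriv_comp_chartInv hf hy hfy, inChart_eq]
  have h2 : (extChartAt (𝓡 d) x₀).symm (mapInChart d e f y₀ x₀ y) =
      f ((extChartAt (𝓡 e) y₀).symm y) := (extChartAt (𝓡 d) x₀).left_inv hfy
  rw [h2]
  rfl

theorem SmoothForm.contDiffAt {τ : DForm d X k A} (hτ : SmoothForm τ) {x₀ : X} {y : Euc d}
    (hy : y ∈ (extChartAt (𝓡 d) x₀).target) : ContDiffAt ℝ ∞ (inChart x₀ τ) y :=
  (hτ x₀).contDiffAt ((isOpen_extChartAt_target x₀).mem_nhds hy)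

theorem SmoothForm.differentiableAt {τ : DForm d X k A} (hτ : SmoothForm τ) (x : X) :
    DifferentiableAt ℝ (inChart x τ) (extChartAt (𝓡 d) x x) :=
  (hτ.contDiffAt (mem_extChartAt_target x)).differentiableAt (by simp)

/-- In the preferred charts at `y` and `f y`, whose derivatives at their own centres are the
identity, this is naturality of the exterior derivative on vector spaces. -/
theorem dForm_pullback {f : Y → X} (hf : ContMDiff (𝓡 e) (𝓡 d) ∞ f) {τ : DForm d X k A}
    (hτ : SmoothForm τ) : dForm (pullback (e := e) f τ) = pullback f (dForm τ) := by
  funext y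
  have hy := mem_extChartAt_target (I := 𝓡 e) y
  have hfy : f ((extChartAt (𝓡 e) y).symm (extChartAt (𝓡 e) y y)) ∈
      (extChartAt (𝓡 d) (f y)).source := by
    rw [extChartAt_to_inv]
    exact mem_extChartAt_source (f y)
  have h0 : mapInChart d e f y (f y) (extChartAt (𝓡 e) y y) = extChartAt (𝓡 d) (f y) (f y) := by
    simp [mapInChart]
  have h1 : inChart y (pullback f τ) =ᶠ[𝓝 (extChartAt (𝓡 e) y y)] fun z =>
      (inChart (f y) τ (mapInChart d e f y (f y) z)).compContinuousLinearMap
        (fderiv ℝ (mapInChart d e f y (f y)) z) := by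
    filter_upwards [eventually_mem_source hf hy hfy] with z hz
    exact inChart_pullback hf τ hz.1 hz.2
  have h2 := rawDeriv_comp_chartInv hf hy hfy
  rw [h0, chartInv_self, chartInv_self, ContinuousLinearMap.comp_id, ContinuousLinearMap.id_comp,
    extChartAt_to_inv] at h2
  rw [dForm_eq, h1.extDeriv_eq, extDeriv_pullback (r := ∞), h0, ← h2]
  · rw [← dForm_eq]
    rfl
  · rw [h0]
    exact hτ.differentiableAt (f y)
  · exact contDiffAt_mapInChart hf hy hfy
  · simpa using (WithTop.coe_le_coe.2 le_top : ((2 : ℕ∞) : WithTop ℕ∞) ≤ ∞)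

theorem SmoothForm.pullback {f : Y → X} (hf : ContMDiff (𝓡 e) (𝓡 d) ∞ f) {τ : DForm d X k A}
    (hτ : SmoothForm τ) : SmoothForm (HKTorus.pullback (e := e) f τ) := by
  intro y₀ y hy
  refine ContDiffAt.contDiffWithinAt ?_
  have hfy := mem_extChartAt_source (I := 𝓡 d) (f ((extChartAt (𝓡 e) y₀).symm y))
  set x₀ := f ((extChartAt (𝓡 e) y₀).symm y) with hx₀
  have h1 : inChart y₀ (HKTorus.pullback f τ) =ᶠ[𝓝 y] fun z =>
      (inChart x₀ τ (mapInChart d e f y₀ x₀ z)).compContinuousLinearMap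
        (fderiv ℝ (mapInChart d e f y₀ x₀) z) := by
    filter_upwards [eventually_mem_source hf hy hfy] with z hz
    exact inChart_pullback hf τ hz.1 hz.2
  have hm := contDiffAt_mapInChart hf hy hfy
  have h2 : ContDiffAt ℝ ∞ (fun z => inChart x₀ τ (mapInChart d e f y₀ x₀ z)) y :=
    ContDiffAt.comp (g := inChart x₀ τ) y
      (hτ.contDiffAt ((extChartAt (𝓡 d) x₀).map_source hfy)) hm
  have h3 : ContDiffAt ℝ ∞ (fderiv ℝ (mapInChart d e f y₀ x₀)) y := hm.fderiv_right (by simp)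
  refine ContDiffAt.congr_of_eventuallyEq ?_ h1
  exact h2.compContinuousLinearMap h3

theorem inChart_wedge {l : ℕ} {A : Type*} [NormedCommRing A] [NormedAlgebra ℝ A]
    (p : DForm d X k A) (q : DForm d X l A) (x₀ : X) :
    inChart x₀ (fun x => wedge (p x) (q x)) =
      fun y => wedge (inChart x₀ p y) (inChart x₀ q y) := by
  funext y
  exact wedge_compContinuousLinearMap _ _ _

theorem inChart_wedgePow (p : DForm d X 2 ℂ) (m : ℕ) (x₀ : X) :
    inChart x₀ (fun x => wedgePow (p x) m) = fun y => wedgePow (inChart x₀ p y) m := by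
  funext y
  exact wedgePow_compContinuousLinearMap _ _ _

theorem inChart_complexForm (p q : DForm d X k ℝ) (x₀ : X) :
    inChart x₀ (fun x => complexForm (p x) (q x)) =
      fun y => complexForm (inChart x₀ p y) (inChart x₀ q y) := rfl

theorem inChart_add (p q : DForm d X k A) (x₀ : X) :
    inChart x₀ (fun x => p x + q x) = fun y => inChart x₀ p y + inChart x₀ q y := rfl

theorem SmoothForm.add {p q : DForm d X k A} (hp : SmoothForm p) (hq : SmoothForm q) :
    SmoothForm (fun x => p x + q x) := fun x₀ => by
  rw [inChart_add]
  exact (hp x₀).add (hq x₀)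

theorem SmoothForm.wedge {l : ℕ} {A : Type*} [NormedCommRing A] [NormedAlgebra ℝ A]
    {p : DForm d X k A} {q : DForm d X l A} (hp : SmoothForm p) (hq : SmoothForm q) :
    SmoothForm (fun x => HKTorus.wedge (p x) (q x)) := fun x₀ => by
  rw [inChart_wedge]
  exact ContDiffOn.wedge (hp x₀) (hq x₀)

theorem SmoothForm.wedgePow {p : DForm d X 2 ℂ} (hp : SmoothForm p) (m : ℕ) :
    SmoothForm (fun x => HKTorus.wedgePow (p x) m) := fun x₀ => by
  rw [inChart_wedgePow]
  exact ContDiffOn.wedgePow (hp x₀) m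

theorem SmoothForm.complexForm {p q : DForm d X k ℝ} (hp : SmoothForm p) (hq : SmoothForm q) :
    SmoothForm (fun x => HKTorus.complexForm (p x) (q x)) := fun x₀ => by
  rw [inChart_complexForm]
  exact ContDiffOn.complexForm (hp x₀) (hq x₀)

theorem extDeriv_compContinuousAlternatingMap {E : Type*} [NormedAddCommGroup E] [NormedSpace ℝ E]
    {A B : Type*} [NormedAddCommGroup A] [NormedSpace ℝ A] [NormedAddCommGroup B] [NormedSpace ℝ B]
    (f : A →L[ℝ] B) {p : E → E [⋀^Fin k]→L[ℝ] A} {x : E} (hp : DifferentiableAt ℝ p x) :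
    extDeriv (fun y => f.compContinuousAlternatingMap (p y)) x =
      f.compContinuousAlternatingMap (extDeriv p x) := by
  have h := ((isBoundedLinearMap_compContinuousAlternatingMap (V := E) (k := k) f).hasFDerivAt
    (x := p x)).comp x hp.hasFDerivAt
  have h' : fderiv ℝ (fun y => f.compContinuousAlternatingMap (p y)) x = _ := h.fderiv
  ext v
  simp only [extDeriv, h']
  simp [ContinuousAlternatingMap.alternatizeUncurryFin_apply]
  rfl

theorem dForm_complexForm {p q : DForm d X k ℝ} (hp : SmoothForm p) (hq : SmoothForm q) (x : X) :
    dForm (fun x => complexForm (p x) (q x)) x = complexForm (dForm p x) (dForm q x) := by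
  rw [dForm_eq, dForm_eq, dForm_eq, inChart_complexForm]
  have h1 := extDeriv_compContinuousAlternatingMap Complex.ofRealCLM (hp.differentiableAt x)
  have h2 := extDeriv_compContinuousAlternatingMap (Complex.I • Complex.ofRealCLM)
    (hq.differentiableAt x)
  have d1 := (isBoundedLinearMap_compContinuousAlternatingMap (V := Euc d) (k := k)
    Complex.ofRealCLM).differentiableAt.comp _ (hp.differentiableAt x)
  have d2 := (isBoundedLinearMap_compContinuousAlternatingMap (V := Euc d) (k := k)
    (Complex.I • Complex.ofRealCLM)).differentiableAt.comp _ (hq.differentiableAt x)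
  have h := extDeriv_add d1 d2
  exact h.trans (congrArg₂ (· + ·) h1 h2)

theorem dForm_wedge_eq_zero {l : ℕ} {A : Type*} [NormedCommRing A] [NormedAlgebra ℝ A]
    {p : DForm d X k A} {q : DForm d X l A} (hp : SmoothForm p) (hq : SmoothForm q) {x : X}
    (h1 : wedge (dForm p x) (q x) = 0) (h2 : wedge (p x) (dForm q x) = 0) :
    dForm (fun x => wedge (p x) (q x)) x = 0 := by
  have hx : ∀ {j : ℕ} (r : DForm d X j A), inChart x r (extChartAt (𝓡 d) x x) = rawForm r x := by
    intro j r
    rw [inChart_eq, chartInv_self, extChartAt_to_inv]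
    rfl
  rw [dForm_eq, inChart_wedge]
  refine extDeriv_wedge_eq_zero (hp.differentiableAt x) (hq.differentiableAt x) ?_ ?_
  · rw [hx, ← dForm_eq]
    exact h1
  · rw [hx, ← dForm_eq]
    exact h2

end Charts

/-! ### Bilinear forms and endomorphism fields in charts -/

section Sections

open Set Filter Topology

variable {d e : ℕ} {X : Type*} [TopologicalSpace X] [ChartedSpace (Euc d) X]
  {Y : Type*} [TopologicalSpace Y] [ChartedSpace (Euc e) Y]

/-- A field of bilinear forms written in a chart. -/
noncomputable def bilinInChart (x₀ : X)
    (B : ∀ x : X, TangentSpace (𝓡 d) x →L[ℝ] TangentSpace (𝓡 d) x →L[ℝ] ℝ) (y : Euc d) :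
    Euc d →L[ℝ] Euc d →L[ℝ] ℝ :=
  ContinuousLinearMap.bilinearComp (E := Euc d) (F := Euc d) (G := ℝ)
    (B ((extChartAt (𝓡 d) x₀).symm y)) (chartInv x₀ y) (chartInv x₀ y)

/-- A field of endomorphisms written in a chart. -/
noncomputable def endInChart (x₀ : X) (J : EndField d X) (y : Euc d) : Euc d →L[ℝ] Euc d :=
  (chartInv x₀ y).inverse.comp
    (ContinuousLinearMap.comp (J ((extChartAt (𝓡 d) x₀).symm y) : Euc d →L[ℝ] Euc d)
      (chartInv x₀ y))

variable [IsManifold (𝓡 d) ∞ X] [IsManifold (𝓡 e) ∞ Y]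

/-- The link between smooth sections of the tangent bundle and coordinate expressions: near `x₀` the
trivialization of the bundle is given by the derivative of the chart. -/
theorem eventually_symmL_eq (x₀ : X) : ∀ᶠ x in 𝓝 x₀,
    x ∈ (chartAt (Euc d) x₀).source ∧ (extChartAt (𝓡 d) x₀).symm (extChartAt (𝓡 d) x₀ x) = x ∧
    ∀ v : Euc d, (trivializationAt (Euc d) (TangentSpace (𝓡 d)) x₀).symm x v =
      chartInv x₀ (extChartAt (𝓡 d) x₀ x) v := by
  filter_upwards [(chartAt (Euc d) x₀).open_source.mem_nhds (mem_chart_source _ x₀)] with x hx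
  have hx' : x ∈ (extChartAt (𝓡 d) x₀).source := by simpa using hx
  refine ⟨hx, (extChartAt (𝓡 d) x₀).left_inv hx', fun v => ?_⟩
  have h := TangentBundle.symmL_trivializationAt (I := 𝓡 d) hx
  rw [chartInv_eq]
  have hb : x ∈ (trivializationAt (Euc d) (TangentSpace (𝓡 d)) x₀).baseSet := by simpa using hx
  rw [← Bundle.Trivialization.symmL_apply (R := ℝ) _ hb]
  exact congrArg (fun L => L v) h

theorem inCoordinates_bilin {x₀ : X}
    (B : ∀ x : X, TangentSpace (𝓡 d) x →L[ℝ] TangentSpace (𝓡 d) x →L[ℝ] ℝ) : ∀ᶠ x in 𝓝 x₀,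
    ContinuousLinearMap.inCoordinates (Euc d) (TangentSpace (𝓡 d)) (Euc d →L[ℝ] ℝ)
      (fun x : X => TangentSpace (𝓡 d) x →L[ℝ] ℝ) x₀ x x₀ x (B x) =
      bilinInChart x₀ B (extChartAt (𝓡 d) x₀ x) := by
  filter_upwards [eventually_symmL_eq (d := d) x₀] with x hx
  ext v w
  rw [inCoordinates_apply_eq₂ (by simpa using hx.1) (by simpa using hx.1)
    (Set.mem_univ _), hx.2.2, hx.2.2]
  -- `x` and its image under the chart and back are equal but not definitionally so; generalizing
  -- the base point allows the substitution.
  have h : ∀ z, z = x → B x (chartInv x₀ (extChartAt (𝓡 d) x₀ x) v)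
      (chartInv x₀ (extChartAt (𝓡 d) x₀ x) w) = B z (chartInv x₀ (extChartAt (𝓡 d) x₀ x) v)
      (chartInv x₀ (extChartAt (𝓡 d) x₀ x) w) := by rintro z rfl; rfl
  refine Eq.trans ?_ (h _ hx.2.1)
  have h' : ∀ r : ℝ,
      Bundle.Trivialization.linearMapAt ℝ (trivializationAt ℝ (Bundle.Trivial X ℝ) x₀) x r = r :=
    fun r => by
      rw [Bundle.Trivialization.linearMapAt_apply]
      exact if_pos (Set.mem_univ _)
  exact h' _

theorem contMDiffAt_bilin_iff {x₀ : X}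
    (B : ∀ x : X, TangentSpace (𝓡 d) x →L[ℝ] TangentSpace (𝓡 d) x →L[ℝ] ℝ) :
    ContMDiffAt (𝓡 d) ((𝓡 d).prod 𝓘(ℝ, Euc d →L[ℝ] Euc d →L[ℝ] ℝ)) ∞
      (fun x => Bundle.TotalSpace.mk' (Euc d →L[ℝ] Euc d →L[ℝ] ℝ)
        (E := fun x : X => TangentSpace (𝓡 d) x →L[ℝ] TangentSpace (𝓡 d) x →L[ℝ] ℝ) x (B x)) x₀ ↔
    ContDiffAt ℝ ∞ (bilinInChart x₀ B) (extChartAt (𝓡 d) x₀ x₀) := by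
  rw [contMDiffAt_hom_bundle]
  have h1 := inCoordinates_bilin (x₀ := x₀) B
  constructor
  · rintro ⟨-, h⟩
    have h2 : ContMDiffAt (𝓡 d) 𝓘(ℝ, Euc d →L[ℝ] Euc d →L[ℝ] ℝ) ∞
        (fun x => bilinInChart x₀ B (extChartAt (𝓡 d) x₀ x)) x₀ :=
      h.congr_of_eventuallyEq (h1.mono fun x hx => hx.symm)
    rw [← contMDiffAt_iff_contDiffAt]
    have h3 := ((contMDiffOn_extChartAt_symm (n := ∞) x₀).contMDiffAt
      ((isOpen_extChartAt_target (I := 𝓡 d) x₀).mem_nhds (mem_extChartAt_target x₀)))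
    have h4 := ContMDiffAt.comp_of_eq h2 h3 (extChartAt_to_inv x₀)
    refine h4.congr_of_eventuallyEq ?_
    filter_upwards [(isOpen_extChartAt_target (I := 𝓡 d) x₀).mem_nhds (mem_extChartAt_target x₀)]
      with y hy
    simp only [Function.comp_apply]
    rw [(extChartAt (𝓡 d) x₀).right_inv hy]
  · intro h
    refine ⟨contMDiffAt_id, ?_⟩
    have h2 : ContMDiffAt (𝓡 d) 𝓘(ℝ, Euc d →L[ℝ] Euc d →L[ℝ] ℝ) ∞
        (fun x => bilinInChart x₀ B (extChartAt (𝓡 d) x₀ x)) x₀ :=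
      ContMDiffAt.comp (g := bilinInChart x₀ B) x₀ h.contMDiffAt
        (contMDiffAt_extChartAt' (mem_chart_source _ _))
    exact h2.congr_of_eventuallyEq h1

theorem contMDiffAt_endField {x₀ : X} (J : EndField d X)
    (h : ContDiffAt ℝ ∞ (endInChart x₀ J) (extChartAt (𝓡 d) x₀ x₀)) :
    ContMDiffAt (𝓡 d) ((𝓡 d).prod 𝓘(ℝ, Euc d →L[ℝ] Euc d)) ∞
    (fun x => (Bundle.TotalSpace.mk' (Euc d →L[ℝ] Euc d) x (J x) :
      Bundle.TotalSpace (Euc d →L[ℝ] Euc d)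
        (fun x : X => TangentSpace (𝓡 d) x →L[ℝ] TangentSpace (𝓡 d) x))) x₀ := by
  rw [contMDiffAt_hom_bundle]
  refine ⟨contMDiffAt_id, ?_⟩
  have h2 : ContMDiffAt (𝓡 d) 𝓘(ℝ, Euc d →L[ℝ] Euc d) ∞
      (fun x => endInChart x₀ J (extChartAt (𝓡 d) x₀ x)) x₀ :=
    ContMDiffAt.comp (g := endInChart x₀ J) x₀ h.contMDiffAt
      (contMDiffAt_extChartAt' (mem_chart_source _ _))
  refine h2.congr_of_eventuallyEq ?_
  filter_upwards [eventually_symmL_eq (d := d) x₀] with x hx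
  have hb : x ∈ (trivializationAt (Euc d) (TangentSpace (𝓡 d)) x₀).baseSet := by simpa using hx.1
  have hinv : (chartInv x₀ (extChartAt (𝓡 d) x₀ x)).IsInvertible :=
    isInvertible_chartInv ((extChartAt (𝓡 d) x₀).map_source (by simpa using hx.1))
  obtain ⟨L, hL⟩ := hinv
  have h3 : ∀ u : Euc d,
      (trivializationAt (Euc d) (TangentSpace (𝓡 d)) x₀).continuousLinearMapAt ℝ x u =
        (chartInv x₀ (extChartAt (𝓡 d) x₀ x)).inverse u := by
    intro u
    have h4 := (trivializationAt (Euc d) (TangentSpace (𝓡 d)) x₀).symmL_continuousLinearMapAt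
      (R := ℝ) hb u
    rw [Bundle.Trivialization.symmL_apply (R := ℝ) _ hb, hx.2.2] at h4
    rw [← hL] at h4 ⊢
    rw [ContinuousLinearMap.inverse_equiv]
    exact (L.symm_apply_eq.2 h4.symm).symm
  ext1 v
  have h5 := h3 (J x (chartInv x₀ (extChartAt (𝓡 d) x₀ x) v))
  have h6 : ∀ z, z = x → J x (chartInv x₀ (extChartAt (𝓡 d) x₀ x) v) =
      J z (chartInv x₀ (extChartAt (𝓡 d) x₀ x) v) := by rintro z rfl; rfl
  have h7 := h6 _ hx.2.1
  have h8 := hx.2.2 v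
  change (trivializationAt (Euc d) (TangentSpace (𝓡 d)) x₀).continuousLinearMapAt ℝ x
    (J x ((trivializationAt (Euc d) (TangentSpace (𝓡 d)) x₀).symmL ℝ x v)) = _
  rw [Bundle.Trivialization.symmL_apply (R := ℝ) _ hb, h8]
  refine h5.trans ?_
  rw [h7]
  rfl

end Sections

/-! ### The Nijenhuis tensor -/

section LocalNijenhuis

open VectorField

variable {E : Type*} [NormedAddCommGroup E] [NormedSpace ℝ E]

theorem isBoundedBilinearMap_apply_vecCons {A : Type*} [NormedAddCommGroup A] [NormedSpace ℝ A]
    {k : ℕ} (w : Fin k → E) : IsBoundedBilinearMap ℝ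
      (fun p : (E [⋀^Fin (k + 1)]→L[ℝ] A) × E => p.1 (Matrix.vecCons p.2 w)) where
  add_left _ _ _ := rfl
  smul_left _ _ _ := rfl
  add_right a v v' := a.toAlternatingMap.map_vecCons_add w v v'
  smul_right c a v := a.toAlternatingMap.map_vecCons_smul w c v
  bound := ⟨∏ i, ‖w i‖ + 1, by positivity, fun a v => by
    refine (a.le_opNorm _).trans ?_
    rw [Fin.prod_univ_succ]
    simp only [Matrix.cons_val_zero, Matrix.cons_val_succ]
    have h : 0 ≤ ‖a‖ * ‖v‖ := by positivity
    nlinarith⟩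

theorem fderiv_apply_vecCons {A : Type*} [NormedAddCommGroup A] [NormedSpace ℝ A]
    {k : ℕ} (w : Fin k → E) {a : E → E [⋀^Fin (k + 1)]→L[ℝ] A} {V : E → E} {p : E}
    (ha : DifferentiableAt ℝ a p) (hV : DifferentiableAt ℝ V p) (u : E) :
    fderiv ℝ (fun y => a y (Matrix.vecCons (V y) w)) p u =
      fderiv ℝ a p u (Matrix.vecCons (V p) w) + a p (Matrix.vecCons (fderiv ℝ V p u) w) := by
  have h := IsBoundedBilinearMap.fderiv_comp_apply
    (f := fun (a : E [⋀^Fin (k + 1)]→L[ℝ] A) (v : E) => a (Matrix.vecCons v w))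
    (isBoundedBilinearMap_apply_vecCons w) ha hV u
  exact h

/-- The Nijenhuis tensor in terms of the derivative of the almost complex structure. -/
theorem lieBracket_nijenhuis {J : E → E →L[ℝ] E} {V W : E → E} {p : E}
    (hJ : DifferentiableAt ℝ J p) (hV : DifferentiableAt ℝ V p) (hW : DifferentiableAt ℝ W p)
    (sq : ∀ v, J p (J p v) = -v) :
    lieBracket ℝ (fun y => J y (V y)) (fun y => J y (W y)) p
      - J p (lieBracket ℝ (fun y => J y (V y)) W p)
      - J p (lieBracket ℝ V (fun y => J y (W y)) p) - lieBracket ℝ V W p =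
    fderiv ℝ J p (J p (V p)) (W p) - fderiv ℝ J p (J p (W p)) (V p)
      + J p (fderiv ℝ J p (W p) (V p)) - J p (fderiv ℝ J p (V p) (W p)) := by
  have h : ∀ U : E → E, DifferentiableAt ℝ U p → ∀ u, fderiv ℝ (fun y => J y (U y)) p u =
      fderiv ℝ J p u (U p) + J p (fderiv ℝ U p u) := by
    intro U hU u
    rw [fderiv_clm_apply hJ hU]
    simp [add_comm]
  -- All terms with derivatives of `V` and `W` cancel by `J² = -1`; this is the tensoriality of the
  -- Nijenhuis expression.
  simp only [lieBracket_eq, h V hV, h W hW, map_sub, map_add, sq]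
  abel

/-- The `2`-form has no component of type `(0, 2)`. -/
def NoZeroTwo {V : Type*} [AddCommGroup V] [Module ℝ V] [TopologicalSpace V] (J : V → V)
    (b : V [⋀^Fin 2]→L[ℝ] ℂ) : Prop :=
  ∀ v w, Complex.I * b ![J v, w] + Complex.I * b ![v, J w] - b ![J v, J w] + b ![v, w] = 0

variable {J : E → E →L[ℝ] E} {p : E}

/-- Differentiates the type identity `a(J v, w) = i a(v, w)` in the direction `u`, so that
derivatives of `J` can be traded for derivatives of `a`. -/
theorem fderiv_type {k : ℕ} (hJ : DifferentiableAt ℝ J p) {a : E → E [⋀^Fin (k + 1)]→L[ℝ] ℂ}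
    (ha : DifferentiableAt ℝ a p) (w : Fin k → E)
    (htype : ∀ᶠ y in nhds p, ∀ v,
      a y (Matrix.vecCons (J y v) w) = Complex.I * a y (Matrix.vecCons v w)) (u v : E) :
    fderiv ℝ a p u (Matrix.vecCons (J p v) w) + a p (Matrix.vecCons (fderiv ℝ J p u v) w) =
      Complex.I * fderiv ℝ a p u (Matrix.vecCons v w) := by
  have h1 := fderiv_apply_vecCons w ha (hJ.clm_apply (differentiableAt_const v)) u
  have h2 : (fun y => a y (Matrix.vecCons (J y v) w)) =ᶠ[nhds p]
      fun y => Complex.I * a y (Matrix.vecCons v w) := htype.mono fun y hy => hy v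
  have h3 := fderiv_apply_vecCons w ha (differentiableAt_const v) u
  have h4 : DifferentiableAt ℝ (fun y => a y (Matrix.vecCons v w)) p :=
    DifferentiableAt.comp (g := fun q : (E [⋀^Fin (k + 1)]→L[ℝ] ℂ) × E =>
      q.1 (Matrix.vecCons q.2 w)) p
      ((isBoundedBilinearMap_apply_vecCons (E := E) (A := ℂ) w).differentiableAt (a p, v))
      (ha.prodMk (differentiableAt_const v))
  have h5 : fderiv ℝ (fun y => J y v) p u = fderiv ℝ J p u v := by
    rw [fderiv_clm_apply hJ (differentiableAt_const v)]
    simp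
  have h6 : a p (Matrix.vecCons (fderiv ℝ (fun _ : E => v) p u) w) = 0 := by
    rw [fderiv_fun_const]
    exact (a p).map_coord_zero 0 rfl
  rw [h5] at h1
  rw [← h1, h2.fderiv_eq, fderiv_const_mul h4]
  rw [h6, add_zero] at h3
  rw [← h3]
  rfl

/-- After derivatives of `J` are replaced by derivatives of `a`, the left side becomes `da(v + iJv,
w + iJw)`, expanded complex bilinearly. This is the `(0,2)`-component of `da`. -/
theorem oneForm_nijenhuis (hJ : DifferentiableAt ℝ J p) {a : E → E [⋀^Fin 1]→L[ℝ] ℂ}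
    (ha : DifferentiableAt ℝ a p)
    (htype : ∀ᶠ y in nhds p, ∀ w, a y ![J y w] = Complex.I * a y ![w])
    (hd : NoZeroTwo (J p) (extDeriv a p)) (v w : E) :
    a p ![fderiv ℝ J p (J p v) w - fderiv ℝ J p (J p w) v
      + J p (fderiv ℝ J p w v) - J p (fderiv ℝ J p v w)] = 0 := by
  have h0 := htype.self_of_nhds
  have hA : ∀ u w, fderiv ℝ a p u ![J p w] + a p ![fderiv ℝ J p u w] =
      Complex.I * fderiv ℝ a p u ![w] := fderiv_type hJ ha ![] htype
  have hext : ∀ u v, extDeriv a p ![u, v] = fderiv ℝ a p u ![v] - fderiv ℝ a p v ![u] := by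
    intro u v
    rw [extDeriv, ContinuousAlternatingMap.alternatizeUncurryFin_apply, Fin.sum_univ_two]
    have e0 : Fin.removeNth 0 ![u, v] = ![v] := by ext i; fin_cases i; rfl
    have e1 : Fin.removeNth 1 ![u, v] = ![u] := by ext i; fin_cases i; rfl
    rw [e0, e1]
    simp [sub_eq_add_neg]
  have hadd : ∀ u v, a p ![u + v] = a p ![u] + a p ![v] := fun u v =>
    (isBoundedBilinearMap_apply_vecCons (E := E) (A := ℂ) ![]).add_right (a p) u v
  have hsub : ∀ u v, a p ![u - v] = a p ![u] - a p ![v] := fun u v => by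
    rw [eq_sub_iff_add_eq, ← hadd, sub_add_cancel]
  rw [hsub, hadd, hsub, h0, h0]
  have := hd v w
  simp only [hext] at this
  linear_combination hA (J p v) w - hA (J p w) v + Complex.I * hA w v - Complex.I * hA v w + this
    + (fderiv ℝ a p w ![v] - fderiv ℝ a p v ![w]) * Complex.I_mul_I

/-- The analogue for `S`: the value comes from expanding `dS(v + iJv, w + iJw, z) = 0`. -/
theorem twoForm_nijenhuis (hJ : DifferentiableAt ℝ J p) {S : E → E [⋀^Fin 2]→L[ℝ] ℂ}
    (hS : DifferentiableAt ℝ S p)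
    (htype : ∀ᶠ y in nhds p, ∀ v w, S y ![J y v, w] = Complex.I * S y ![v, w])
    (hd : extDeriv S p = 0) (v w z : E) :
    S p ![fderiv ℝ J p (J p v) w - fderiv ℝ J p (J p w) v
      + J p (fderiv ℝ J p w v) - J p (fderiv ℝ J p v w), z] = 0 := by
  have h0 := htype.self_of_nhds
  have hA : ∀ u v w, fderiv ℝ S p u ![J p v, w] + S p ![fderiv ℝ J p u v, w] =
      Complex.I * fderiv ℝ S p u ![v, w] := fun u v w =>
    fderiv_type hJ hS ![w] (htype.mono fun y hy v => hy v w) u v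
  have hext : ∀ u v w, fderiv ℝ S p u ![v, w] - fderiv ℝ S p v ![u, w]
      + fderiv ℝ S p w ![u, v] = 0 := by
    intro u v w
    have : extDeriv S p ![u, v, w] = 0 := by rw [hd]; rfl
    rw [← this, extDeriv, ContinuousAlternatingMap.alternatizeUncurryFin_apply,
      Fin.sum_univ_three]
    have e0 : Fin.removeNth 0 ![u, v, w] = ![v, w] := by ext i; fin_cases i <;> rfl
    have e1 : Fin.removeNth 1 ![u, v, w] = ![u, w] := by ext i; fin_cases i <;> rfl
    have e2 : Fin.removeNth 2 ![u, v, w] = ![u, v] := by ext i; fin_cases i <;> rfl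
    rw [e0, e1, e2]
    simp [sub_eq_add_neg]
  have hsk : ∀ v w, S p ![v, w] = - S p ![w, v] := fun v w => map_pair_swap _ v w
  have h1 : ∀ v w, S p ![v, J p w] = Complex.I * S p ![v, w] := fun v w => by
    rw [hsk, h0, hsk w v]
    ring
  have hadd : ∀ u v, S p ![u + v, z] = S p ![u, z] + S p ![v, z] := fun u v =>
    pair_add_left (S p) u v z
  have hsub : ∀ u v, S p ![u - v, z] = S p ![u, z] - S p ![v, z] := fun u v => by
    rw [eq_sub_iff_add_eq, ← hadd, sub_add_cancel]
  rw [hsub, hadd, hsub, h0, h0]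
  -- The four multiples of `hext` are that expansion. The instances of `hA` in the direction `z`,
  -- with `h1`, remove the derivative of `S` along `z`, which vanishes on the pair `v + iJv`, `w +
  -- iJw` by type.
  linear_combination hA (J p v) w z - hA (J p w) v z + Complex.I * hA w v z
    - Complex.I * hA v w z + Complex.I * hext (J p v) w z + Complex.I * hext v (J p w) z
    - hext (J p v) (J p w) z + hext v w z - Complex.I * hA z v w + hA z v (J p w)
    - h1 (fderiv ℝ J p z v) w
    + (fderiv ℝ S p w ![v, z] - fderiv ℝ S p v ![w, z] - fderiv ℝ S p z ![v, w]) * Complex.I_mul_I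

end LocalNijenhuis

/-! ### The Nijenhuis tensor on a manifold, computed in a chart. -/

section Nijenhuis

open Set Filter Topology VectorField

variable {d : ℕ} {X : Type*} [TopologicalSpace X] [ChartedSpace (Euc d) X]
  [IsManifold (𝓡 d) ∞ X]

/-- A vector field written in a chart. -/
noncomputable def fieldInChart (x₀ : X) (V : ∀ x : X, TangentSpace (𝓡 d) x) (y : Euc d) : Euc d :=
  (chartInv x₀ y).inverse (V ((extChartAt (𝓡 d) x₀).symm y) : Euc d)

theorem mlieBracket_eq (V W : ∀ x : X, TangentSpace (𝓡 d) x) (x : X) :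
    mlieBracket (𝓡 d) V W x =
      lieBracket ℝ (fieldInChart x V) (fieldInChart x W) (extChartAt (𝓡 d) x x) := by
  have h : ∀ V : ∀ x : X, TangentSpace (𝓡 d) x,
      mpullbackWithin 𝓘(ℝ, Euc d) (𝓡 d) (extChartAt (𝓡 d) x).symm V (range (𝓡 d)) =
        fieldInChart x V := by
    intro V
    funext y
    rw [mpullbackWithin_apply, ← chartInv_eq]
    rfl
  rw [← mlieBracketWithin_univ, mlieBracketWithin_apply, h, h, mfderiv_extChartAt_self]
  simp only [ModelWithCorners.range_eq_univ, preimage_univ, inter_univ, lieBracketWithin_univ]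
  have h' : ∀ u : Euc d, (ContinuousLinearMap.id ℝ (Euc d)).inverse u = u := fun u => by
    rw [ContinuousLinearMap.inverse_id]
    rfl
  exact h' _

theorem SmoothFieldAt.differentiableAt {V : ∀ x : X, TangentSpace (𝓡 d) x} {x : X}
    (hV : SmoothFieldAt V x) :
    DifferentiableAt ℝ (fieldInChart x V) (extChartAt (𝓡 d) x x) := by
  have h1 : ContMDiffWithinAt (𝓡 d) ((𝓡 d).prod 𝓘(ℝ, Euc d)) 1
    (fun y => (Bundle.TotalSpace.mk' (Euc d) y (V y) : TangentBundle (𝓡 d) X)) univ x :=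
    (ContMDiffAt.of_le hV (by simp)).contMDiffWithinAt
  have h2 := contMDiffWithinAt_mpullbackWithin_extChartAt_symm (n := ∞) h1
    uniqueMDiffOn_univ (mem_univ x)
    (WithTop.coe_le_coe.2 (le_top : (1 : ℕ∞) + 1 ≤ ⊤))
  rw [contMDiffWithinAt_vectorSpace_iff_contDiffWithinAt] at h2
  have h3 := (h2.differentiableWithinAt (by simp)).differentiableAt (by
    rw [preimage_univ, inter_univ]
    exact (isOpen_extChartAt_target x).mem_nhds (mem_extChartAt_target x))
  refine h3.congr_of_eventuallyEq (Eventually.of_forall fun y => ?_)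
  rw [mpullbackWithin_apply, ← chartInv_eq]
  rfl

theorem chartInv_endInChart {x₀ : X} (J : EndField d X) {y : Euc d}
    (hy : y ∈ (extChartAt (𝓡 d) x₀).target) (v : Euc d) :
    chartInv x₀ y (endInChart x₀ J y v) =
      (J ((extChartAt (𝓡 d) x₀).symm y) : Euc d →L[ℝ] Euc d) (chartInv x₀ y v) := by
  obtain ⟨L, hL⟩ := isInvertible_chartInv hy
  simp only [endInChart, ← hL, ContinuousLinearMap.inverse_equiv]
  exact L.apply_symm_apply _

theorem fieldInChart_apply_endField {x₀ : X} (J : EndField d X)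
    (V : ∀ x : X, TangentSpace (𝓡 d) x) {y : Euc d} (hy : y ∈ (extChartAt (𝓡 d) x₀).target) :
    fieldInChart x₀ (fun z => J z (V z)) y = endInChart x₀ J y (fieldInChart x₀ V y) := by
  obtain ⟨L, hL⟩ := isInvertible_chartInv hy
  simp only [endInChart, fieldInChart, ← hL, ContinuousLinearMap.inverse_equiv]
  refine congrArg L.symm ?_
  exact (congrArg (J ((extChartAt (𝓡 d) x₀).symm y) : Euc d →L[ℝ] Euc d)
    (L.apply_symm_apply _)).symm

theorem endInChart_self (J : EndField d X) (x : X) :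
    endInChart x J (extChartAt (𝓡 d) x x) = (J x : Euc d →L[ℝ] Euc d) := by
  rw [endInChart, chartInv_self, extChartAt_to_inv]
  rw [ContinuousLinearMap.inverse_id]
  rfl

theorem nijenhuis_eq {J : EndField d X} {x : X}
    (hJ : DifferentiableAt ℝ (endInChart x J) (extChartAt (𝓡 d) x x))
    (sq : ∀ v : TangentSpace (𝓡 d) x, J x (J x v) = -v) {V W : ∀ x : X, TangentSpace (𝓡 d) x}
    (hV : SmoothFieldAt V x) (hW : SmoothFieldAt W x) :
    ∃ v w : Euc d, nijenhuis J V W x =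
      fderiv ℝ (endInChart x J) (extChartAt (𝓡 d) x x)
          (endInChart x J (extChartAt (𝓡 d) x x) v) w
        - fderiv ℝ (endInChart x J) (extChartAt (𝓡 d) x x)
          (endInChart x J (extChartAt (𝓡 d) x x) w) v
        + endInChart x J (extChartAt (𝓡 d) x x)
          (fderiv ℝ (endInChart x J) (extChartAt (𝓡 d) x x) w v)
        - endInChart x J (extChartAt (𝓡 d) x x)
          (fderiv ℝ (endInChart x J) (extChartAt (𝓡 d) x x) v w) := by
  refine ⟨fieldInChart x V (extChartAt (𝓡 d) x x), fieldInChart x W (extChartAt (𝓡 d) x x), ?_⟩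
  have h := lieBracket_nijenhuis hJ hV.differentiableAt hW.differentiableAt (fun v => by
    rw [endInChart_self]
    exact sq v)
  refine Eq.trans ?_ h
  have hc : ∀ V : ∀ x : X, TangentSpace (𝓡 d) x, fieldInChart x (fun z => J z (V z))
      =ᶠ[𝓝 (extChartAt (𝓡 d) x x)] fun y => endInChart x J y (fieldInChart x V y) := by
    intro V
    filter_upwards [(isOpen_extChartAt_target (I := 𝓡 d) x).mem_nhds (mem_extChartAt_target x)]
      with y hy
    exact fieldInChart_apply_endField J V hy
  unfold nijenhuis
  rw [mlieBracket_eq, mlieBracket_eq, mlieBracket_eq, mlieBracket_eq,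
    (hc V).lieBracket_vectorField_eq (hc W), (hc V).lieBracket_vectorField_eq EventuallyEq.rfl,
    EventuallyEq.rfl.lieBracket_vectorField_eq (hc W)]
  rw [endInChart_self]
  rfl

/-- An almost complex structure is integrable at a point if it is determined by complex forms
`a`, `b` and `S` of types `(1, 0)`, `(1, 0)` and `(2, 0)`, with `S` closed and `da` and `db`
without components of type `(0, 2)`. -/
theorem nijenhuis_eq_zero {J : EndField d X} {x : X}
    (hJ : DifferentiableAt ℝ (endInChart x J) (extChartAt (𝓡 d) x x))
    (sq : ∀ v : TangentSpace (𝓡 d) x, J x (J x v) = -v) {a b : DForm d X 1 ℂ} {S : DForm d X 2 ℂ}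
    (ha : SmoothForm a) (hb : SmoothForm b) (hS : SmoothForm S)
    (ta : ∀ x v, a x ![J x v] = Complex.I * a x ![v])
    (tb : ∀ x v, b x ![J x v] = Complex.I * b x ![v])
    (tS : ∀ x v w, S x ![J x v, w] = Complex.I * S x ![v, w])
    (da : NoZeroTwo (J x) (dForm a x)) (db : NoZeroTwo (J x) (dForm b x)) (dS : dForm S x = 0)
    (nondeg : ∀ v, a x ![v] = 0 → b x ![v] = 0 → (∀ w, S x ![v, w] = 0) → v = 0)
    {V W : ∀ x : X, TangentSpace (𝓡 d) x}
    (hV : SmoothFieldAt V x) (hW : SmoothFieldAt W x) : nijenhuis J V W x = 0 := by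
  obtain ⟨v, w, h⟩ := nijenhuis_eq hJ sq hV hW
  have htarget := (isOpen_extChartAt_target (I := 𝓡 d) x).mem_nhds (mem_extChartAt_target x)
  have hx : ∀ {j : ℕ} (r : DForm d X j ℂ), inChart x r (extChartAt (𝓡 d) x x) = rawForm r x := by
    intro j r
    rw [inChart_eq, chartInv_self, extChartAt_to_inv]
    rfl
  have one : ∀ c : DForm d X 1 ℂ, SmoothForm c → (∀ x v, c x ![J x v] = Complex.I * c x ![v]) →
      NoZeroTwo (J x) (dForm c x) → c x ![nijenhuis J V W x] = 0 := by
    intro c hc tc dc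
    rw [dForm_eq] at dc
    have h1 := oneForm_nijenhuis hJ (hc.differentiableAt x) (by
      filter_upwards [htarget] with y hy u
      have h3 : inChart x c y ![endInChart x J y u] =
          rawForm c ((extChartAt (𝓡 d) x).symm y) ![chartInv x y (endInChart x J y u)] := by
        rw [inChart_eq, ContinuousAlternatingMap.compContinuousLinearMap_apply]
        congr 1
        ext i
        fin_cases i
        rfl
      have h4 : inChart x c y ![u] =
          rawForm c ((extChartAt (𝓡 d) x).symm y) ![chartInv x y u] := by
        rw [inChart_eq, ContinuousAlternatingMap.compContinuousLinearMap_apply]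
        congr 1
        ext i
        fin_cases i
        rfl
      rw [h3, h4, chartInv_endInChart J hy]
      exact tc _ _) (by
      rw [endInChart_self]
      exact dc) v w
    rw [← h, hx] at h1
    exact h1
  have two : ∀ u, S x ![nijenhuis J V W x, u] = 0 := by
    intro u
    have h1 := twoForm_nijenhuis hJ (hS.differentiableAt x) (by
      filter_upwards [htarget] with y hy u u'
      have h3 : ∀ u u', inChart x S y ![u, u'] =
          rawForm S ((extChartAt (𝓡 d) x).symm y) ![chartInv x y u, chartInv x y u'] := by
        intro u u'
        rw [inChart_eq, ContinuousAlternatingMap.compContinuousLinearMap_apply]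
        congr 1
        ext i
        fin_cases i <;> rfl
      rw [h3, h3, chartInv_endInChart J hy]
      exact tS _ _ _) (by
      rw [← dForm_eq]
      exact dS) v w u
    rw [← h, hx] at h1
    exact h1
  -- The value of the Nijenhuis tensor lies in the common kernel of `a`, `b` and `S`.
  exact nondeg _ (one a ha ta da) (one b hb tb db) two

end Nijenhuis

/-! ### The complex volume form -/

section GoodType

instance {d : ℕ} {X : Type*} [TopologicalSpace X] [ChartedSpace (Euc d) X] (x : X) :
    FiniteDimensional ℝ (TangentSpace (𝓡 d) x) :=
  inferInstanceAs (FiniteDimensional ℝ (Euc d))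

theorem finrank_tangentSpace {d : ℕ} {X : Type*} [TopologicalSpace X] [ChartedSpace (Euc d) X]
    (x : X) : Module.finrank ℝ (TangentSpace (𝓡 d) x) = d :=
  finrank_euclideanSpace_fin

theorem wedge_zero_left {V A : Type*} [AddCommGroup V] [Module ℝ V] [TopologicalSpace V]
    [NormedCommRing A] [NormedAlgebra ℝ A] {k l : ℕ} (b : V [⋀^Fin l]→L[ℝ] A) :
    wedge (0 : V [⋀^Fin k]→L[ℝ] A) b = 0 := by
  have := wedge_add_left (0 : V [⋀^Fin k]→L[ℝ] A) 0 b
  rw [add_zero] at this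
  exact left_eq_add.1 this

theorem wedge_zero_right {V A : Type*} [AddCommGroup V] [Module ℝ V] [TopologicalSpace V]
    [NormedCommRing A] [NormedAlgebra ℝ A] {k l : ℕ} (a : V [⋀^Fin k]→L[ℝ] A) :
    wedge a (0 : V [⋀^Fin l]→L[ℝ] A) = 0 := by
  have := wedge_add_right a (0 : V [⋀^Fin l]→L[ℝ] A) 0
  rw [add_zero] at this
  exact left_eq_add.1 this

variable {V : Type*} [AddCommGroup V] [Module ℝ V] [TopologicalSpace V]

/-- The `2`-form is of type `(2, 0)` or of type `(1, 1)`. -/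
def IsTwoZeroOrOneOne (J : V → V) (b : V [⋀^Fin 2]→L[ℝ] ℂ) : Prop :=
  (∀ v w, b ![J v, w] = Complex.I * b ![v, w]) ∨ ∀ v w, b ![J v, J w] = b ![v, w]

theorem IsTwoZeroOrOneOne.noZeroTwo {J : V → V} (hJ : ∀ v, J (J v) = -v)
    {b : V [⋀^Fin 2]→L[ℝ] ℂ} (h : IsTwoZeroOrOneOne J b) : NoZeroTwo J b := by
  intro v w
  rcases h with h | h
  · have h1 : ∀ v w, b ![v, J w] = Complex.I * b ![v, w] := fun v w => by
      rw [map_pair_swap, h, map_pair_swap b w v]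
      ring
    rw [h, h, h1]
    linear_combination b ![v, w] * Complex.I_mul_I
  · have h1 : b ![J v, w] = -b ![v, J w] := by
      have := h v (J w)
      rw [hJ, map_pair_swap, pair_neg_left, neg_neg, map_pair_swap] at this
      rw [← this, neg_neg]
    rw [h, h1]
    ring

theorem NoZeroTwo.comp {W : Type*} [AddCommGroup W] [Module ℝ W] [TopologicalSpace W]
    {J : V → V} {K : W → W} {b : W [⋀^Fin 2]→L[ℝ] ℂ} (h : NoZeroTwo K b) (f : V →L[ℝ] W)
    (hf : ∀ v, f (J v) = K (f v)) : NoZeroTwo J (b.compContinuousLinearMap f) := by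
  intro v w
  have h1 : ∀ v w, b.compContinuousLinearMap f ![v, w] = b ![f v, f w] := by
    intro v w
    rw [ContinuousAlternatingMap.compContinuousLinearMap_apply]
    congr 1
    ext i
    fin_cases i <;> rfl
  simp only [h1, hf]
  exact h _ _

theorem IsTwoZeroOrOneOne.wedge_wedgePow_eq_zero [FiniteDimensional ℝ V] {n : ℕ}
    (hdim : Module.finrank ℝ V = 4 * n) {J : V →L[ℝ] V} (hJ : ∀ v, J (J v) = -v)
    {S b : V [⋀^Fin 2]→L[ℝ] ℂ} (hS : ∀ v w, S ![J v, w] = Complex.I * S ![v, w])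
    (hb : IsTwoZeroOrOneOne J b) : wedge (wedgePow S n) b = 0 := by
  rcases hb with hb | hb
  · exact wedge_wedgePow_two_zero hdim hJ hS hb
  · exact wedge_wedgePow_one_one hdim hJ hS hb

end GoodType

/-! ### Type and closedness of `Sⁿ ∧ a ∧ b`. -/

section VolForm

variable {d e : ℕ} {X : Type*} [TopologicalSpace X] [ChartedSpace (Euc e) X]
  [IsManifold (𝓡 e) ∞ X]

theorem dForm_wedgePow_eq_zero {S : DForm e X 2 ℂ} (hS : SmoothForm S) {x : X}
    (dS : dForm S x = 0) (m : ℕ) : dForm (fun x => wedgePow (S x) m) x = 0 := by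
  induction m with
  | zero =>
    rw [dForm_eq]
    have h : inChart x (fun x => wedgePow (S x) 0) = fun _ =>
        ContinuousAlternatingMap.constOfIsEmpty ℝ (Euc e) (Fin 0) (1 : ℂ) := rfl
    rw [h, extDeriv, fderiv_fun_const]
    exact map_zero (ContinuousAlternatingMap.alternatizeUncurryFinCLM ℝ (Euc e) ℂ)
  | succ m ih =>
    refine dForm_wedge_eq_zero (hS.wedgePow m) hS ?_ ?_
    · rw [ih]
      exact wedge_zero_left _
    · rw [dS]
      exact wedge_zero_right _

theorem SmoothForm.volForm {n : ℕ} {s₁ s₂ : DForm e X 2 ℝ} {p q r s : DForm e X 1 ℝ}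
    (h₁ : SmoothForm s₁) (h₂ : SmoothForm s₂) (hp : SmoothForm p) (hq : SmoothForm q)
    (hr : SmoothForm r) (hs : SmoothForm s) : SmoothForm (HKTorus.volForm n s₁ s₂ p q r s) :=
  (((h₁.complexForm h₂).wedgePow n).wedge (hp.complexForm hq)).wedge (hr.complexForm hs)

theorem isTypeTop_volForm {n : ℕ} {s₁ s₂ : DForm e X 2 ℝ} {p q r s : DForm e X 1 ℝ}
    {J : EndField e X}
    (tS : ∀ x v w, complexForm (s₁ x) (s₂ x) ![J x v, w] =
      Complex.I * complexForm (s₁ x) (s₂ x) ![v, w])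
    (ta : ∀ x v, complexForm (p x) (q x) ![J x v] = Complex.I * complexForm (p x) (q x) ![v])
    (tb : ∀ x v, complexForm (r x) (s x) ![J x v] = Complex.I * complexForm (r x) (s x) ![v]) :
    IsTypeTop J (HKTorus.volForm n s₁ s₂ p q r s) := fun x =>
  (((isTopAt_two (tS x)).wedgePow n).wedge (isTopAt_one (ta x))).wedge (isTopAt_one (tb x))

theorem dForm_complexForm_pullback_eq_zero {k : ℕ} {M : Type*} [TopologicalSpace M]
    [ChartedSpace (Euc d) M] [IsManifold (𝓡 d) ∞ M] {π : X → M} {s₁ s₂ : DForm d M k ℝ}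
    (hπ : ContMDiff (𝓡 e) (𝓡 d) ∞ π) (h₁ : SmoothForm s₁) (h₂ : SmoothForm s₂)
    (c₁ : dForm s₁ = 0) (c₂ : dForm s₂ = 0) (x : X) :
    dForm (fun x => complexForm (pullback (e := e) π s₁ x) (pullback π s₂ x)) x = 0 := by
  rw [dForm_complexForm (h₁.pullback hπ) (h₂.pullback hπ), dForm_pullback hπ h₁,
    dForm_pullback hπ h₂, c₁, c₂]
  ext v
  rw [complexForm_apply]
  simp [pullback]

theorem dForm_volForm_eq_zero {n : ℕ} {M : Type*} [TopologicalSpace M]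
    [ChartedSpace (Euc (4 * n)) M] [IsManifold (𝓡 (4 * n)) ∞ M] {π : X → M}
    {s₁ s₂ : DForm (4 * n) M 2 ℝ} {p q r s : DForm e X 1 ℝ}
    (hπ : ContMDiff (𝓡 e) (𝓡 (4 * n)) ∞ π)
    (h₁ : SmoothForm s₁) (h₂ : SmoothForm s₂) (c₁ : dForm s₁ = 0) (c₂ : dForm s₂ = 0)
    (hp : SmoothForm p) (hq : SmoothForm q) (hr : SmoothForm r) (hs : SmoothForm s)
    {K : EndField (4 * n) M} (sq : ∀ m v, K m (K m v) = -v)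
    (tS : ∀ m v w, complexForm (s₁ m) (s₂ m) ![K m v, w] =
      Complex.I * complexForm (s₁ m) (s₂ m) ![v, w])
    {a b : DForm (4 * n) M 2 ℂ}
    (da : dForm (fun x => complexForm (p x) (q x)) = pullback π a)
    (db : dForm (fun x => complexForm (r x) (s x)) = pullback π b)
    (ta : ∀ m, IsTwoZeroOrOneOne (K m) (a m)) (tb : ∀ m, IsTwoZeroOrOneOne (K m) (b m)) :
    dForm (volForm n (pullback π s₁) (pullback π s₂) p q r s) = 0 := by
  have hS : SmoothForm fun x => complexForm (pullback (e := e) π s₁ x) (pullback π s₂ x) :=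
    (h₁.pullback hπ).complexForm (h₂.pullback hπ)
  have dS := dForm_complexForm_pullback_eq_zero hπ h₁ h₂ c₁ c₂
  -- The vanishing takes place on `M`, where the complex dimension is `2n`, and is then pulled back;
  -- on `X` it would not follow from the type alone.
  have key : ∀ (c : DForm (4 * n) M 2 ℂ), (∀ m, IsTwoZeroOrOneOne (K m) (c m)) → ∀ x : X,
      wedge (wedgePow (complexForm (pullback (e := e) π s₁ x) (pullback π s₂ x)) n)
        (pullback π c x) = 0 := by
    intro c hc x
    have h := IsTwoZeroOrOneOne.wedge_wedgePow_eq_zero 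
      (V := TangentSpace (𝓡 (4 * n)) (π x)) (n := n) (finrank_tangentSpace _)
      (J := K (π x)) (sq (π x)) (tS (π x)) (hc (π x))
    have h1 := wedge_compContinuousLinearMap (rawDeriv (4 * n) e π x)
      (wedgePow (complexForm (rawForm s₁ (π x)) (rawForm s₂ (π x))) n) (rawForm c (π x))
    rw [wedgePow_compContinuousLinearMap] at h1
    refine h1.symm.trans ?_
    refine (congrArg (fun t => ContinuousAlternatingMap.compContinuousLinearMap t
      (rawDeriv (4 * n) e π x)) h).trans ?_
    rfl
  funext x
  refine dForm_wedge_eq_zero ((hS.wedgePow n).wedge (hp.complexForm hq)) (hr.complexForm hs) ?_ ?_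
  · rw [dForm_wedge_eq_zero (hS.wedgePow n) (hp.complexForm hq), wedge_zero_left]
    · rw [dForm_wedgePow_eq_zero hS (dS x), wedge_zero_left]
    · rw [da]
      exact key a ta x
  · rw [db]
    exact wedge_wedge_eq_zero _ (key b tb x)

end VolForm

/-! ### Quaternionic structures on the total space -/

section QuaternionicLift

variable {V U : Type*} [AddCommGroup V] [Module ℝ V] [AddCommGroup U] [Module ℝ U]
  {P : V →ₗ[ℝ] U} {f : Fin 4 → V →ₗ[ℝ] ℝ}

/-- A surjection together with linear forms dual to vectors of its kernel gives an isomorphism. -/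
theorem bijective_prod_of_dual [FiniteDimensional ℝ V] [FiniteDimensional ℝ U]
    (hdim : Module.finrank ℝ V = Module.finrank ℝ U + 4) (hP : Function.Surjective P)
    (e : Fin 4 → V) (he : ∀ j, P (e j) = 0) (hf : ∀ i j, f i (e j) = if i = j then 1 else 0) :
    Function.Bijective (P.prod (LinearMap.pi f)) := by
  have hsurj : Function.Surjective (P.prod (LinearMap.pi f)) := by
    rintro ⟨u, c⟩
    obtain ⟨v, rfl⟩ := hP u
    refine ⟨v + ∑ j, (c j - f j v) • e j, Prod.ext ?_ ?_⟩
    · simp [he]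
    · ext i
      simp [hf]
  refine ⟨?_, hsurj⟩
  exact (LinearMap.injective_iff_surjective_of_finrank_eq_finrank (by simp [hdim])).2 hsurj

/-- The quaternionic structure on `V ≅ U × ℝ⁴` built from one on `U` and the standard one. -/
theorem exists_quaternionic_lift (hb : Function.Bijective (P.prod (LinearMap.pi f)))
    (I : Fin 3 → U →ₗ[ℝ] U) : ∃ J : Fin 3 → V →ₗ[ℝ] V, ∀ i v, P (J i v) = I i (P v) ∧
      ∀ q, f q (J i v) = ∑ p, stdForm i p q * f p v := by
  let Φ := LinearEquiv.ofBijective _ hb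
  -- Conjugates `I i` times right multiplication of row vectors by `stdForm i` with the splitting;
  -- hence column `q` of the matrix appears in the `q`-th coordinate.
  refine ⟨fun i => Φ.symm.toLinearMap ∘ₗ ((I i).prodMap (Matrix.vecMulLinear (stdForm i))) ∘ₗ
    Φ.toLinearMap, fun i v => ?_⟩
  have h : Φ (Φ.symm (((I i).prodMap (Matrix.vecMulLinear (stdForm i))) (Φ v))) =
    ((I i).prodMap (Matrix.vecMulLinear (stdForm i))) (Φ v) := Φ.apply_symm_apply _
  refine ⟨congrArg Prod.fst h, fun q => ?_⟩
  have h2 := congrFun (congrArg Prod.snd h) q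
  refine Eq.trans h2 ?_
  simp only [LinearMap.prodMap_apply, Matrix.vecMulLinear_apply, Matrix.vecMul, dotProduct]
  refine Finset.sum_congr rfl fun p _ => mul_comm _ _

theorem eq_of_prod (hb : Function.Bijective (P.prod (LinearMap.pi f))) {v w : V}
    (h1 : P v = P w) (h2 : ∀ q, f q v = f q w) : v = w :=
  hb.1 (Prod.ext h1 (funext h2))

variable {I : Fin 3 → U →ₗ[ℝ] U} {J : Fin 3 → V →ₗ[ℝ] V}

theorem quaternionic_lift_sq (hb : Function.Bijective (P.prod (LinearMap.pi f)))
    (hP : ∀ i v, P (J i v) = I i (P v)) (hf : ∀ i v q, f q (J i v) = ∑ p, stdForm i p q * f p v)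
    (sq : ∀ i v, I i (I i v) = -v) (i : Fin 3) (v : V) : J i (J i v) = -v := by
  refine eq_of_prod hb ?_ fun q => ?_
  · rw [hP, hP, sq, map_neg]
  · simp only [hf, map_neg, Fin.sum_univ_four]
    fin_cases i <;> fin_cases q <;> simp [stdForm]

theorem quaternionic_lift_mul (hb : Function.Bijective (P.prod (LinearMap.pi f)))
    (hP : ∀ i v, P (J i v) = I i (P v)) (hf : ∀ i v q, f q (J i v) = ∑ p, stdForm i p q * f p v)
    (mul : ∀ i v, I i (I (i + 1) v) = I (i + 2) v) (i : Fin 3) (v : V) :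
    J i (J (i + 1) v) = J (i + 2) v := by
  refine eq_of_prod hb ?_ fun q => ?_
  · rw [hP, hP, hP, mul]
  · simp only [hf, Fin.sum_univ_four]
    fin_cases i <;> fin_cases q <;> simp [stdForm]

theorem quaternionic_lift_anticomm (hb : Function.Bijective (P.prod (LinearMap.pi f)))
    (hP : ∀ i v, P (J i v) = I i (P v)) (hf : ∀ i v q, f q (J i v) = ∑ p, stdForm i p q * f p v)
    (anti : ∀ i v, I i (I (i + 1) v) = -I (i + 1) (I i v)) (i : Fin 3) (v : V) :
    J i (J (i + 1) v) = -J (i + 1) (J i v) := by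
  refine eq_of_prod hb ?_ fun q => ?_
  · rw [map_neg, hP, hP, hP, hP, anti]
  · simp only [map_neg, hf, Fin.sum_univ_four]
    fin_cases i <;> fin_cases q <;> simp [stdForm]

theorem quaternionic_lift_hermitian (hf : ∀ i v q, f q (J i v) = ∑ p, stdForm i p q * f p v)
    (i : Fin 3) (v w : V) : ∑ q, f q (J i v) * f q (J i w) = ∑ q, f q v * f q w := by
  simp only [hf, Fin.sum_univ_four]
  fin_cases i <;> simp [stdForm] <;> ring

end QuaternionicLift

/-! ### Vertical vectors and the derivative of the bundle projection. -/

section TorusBundle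

open Set Filter Topology

variable {d e : ℕ} {M : Type*} [TopologicalSpace M] [ChartedSpace (Euc d) M]
  {X : Type*} [TopologicalSpace X] [ChartedSpace (Euc e) X] [MulAction Torus4 X] {π : X → M}

theorem IsPrincipalTorusBundle.proj_smul (hπ : IsPrincipalTorusBundle d e π) (t : Torus4) (x : X) :
    π (t • x) = π x := by
  obtain ⟨U, φ, -, hm, hs, -, -, -, h⟩ := hπ.locally_trivial (π x)
  have hx : x ∈ φ.source := by rw [hs]; exact hm
  have h1 := (h x hx).2 t
  have h2 := (h _ h1.1).1
  rw [← h2, h1.2]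

variable [IsManifold (𝓡 d) ∞ M] [IsManifold (𝓡 e) ∞ X]

theorem torusExp_zero (j : Fin 4) : torusExp j 0 = 1 := by
  fin_cases j <;> simp [torusExp]

/-- The projection is constant along orbits. -/
theorem IsPrincipalTorusBundle.rawDeriv_fundamentalField (hπ : IsPrincipalTorusBundle d e π)
    (j : Fin 4) (x : X) : rawDeriv d e π x (fundamentalField j x : Euc e) = 0 := by
  by_cases h : MDifferentiableAt 𝓘(ℝ, ℝ) (𝓡 e) (fun t : ℝ => torusExp j t • x) 0
  · have h1 := mfderiv_comp (I := 𝓘(ℝ, ℝ)) (I' := 𝓡 e) (I'' := 𝓡 d) (0 : ℝ) (g := π)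
      (f := fun t : ℝ => torusExp j t • x) (hπ.smooth_proj.mdifferentiable (by simp) _) h
    have h2 : π ∘ (fun t : ℝ => torusExp j t • x) = fun _ => π x :=
      funext fun t => hπ.proj_smul _ _
    have h3 : mfderiv 𝓘(ℝ, ℝ) (𝓡 d) (π ∘ (fun t : ℝ => torusExp j t • x)) 0 = 0 := by
      rw [h2]
      exact mfderiv_const
    have h4 : torusExp j 0 • x = x := by rw [torusExp_zero, one_smul]
    have h5 : rawDeriv d e π (torusExp j 0 • x) (fundamentalField j x : Euc e) = 0 :=
      (congrArg (fun L => L (1 : ℝ)) (h1.symm.trans h3))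
    rwa [h4] at h5
  -- If the orbit curve were not differentiable, its derivative would be zero by convention, so the
  -- claim holds in this case too.
  · have h1 : fundamentalField j x = (0 : Euc e) := by
      unfold fundamentalField
      rw [mfderiv_zero_of_not_mdifferentiableAt h]
      rfl
    rw [h1, map_zero]

/-- A local trivialization supplies a smooth local section through `x`, whose derivative is a right
inverse. -/
theorem IsPrincipalTorusBundle.surjective_rawDeriv (hπ : IsPrincipalTorusBundle d e π) (x : X) :
    Function.Surjective (rawDeriv d e π x) := by
  obtain ⟨U, φ, hU, hm, hs, ht, -, hφ, h⟩ := hπ.locally_trivial (π x)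
  have hx : x ∈ φ.source := by rw [hs]; exact hm
  let s : M → X := fun m => φ.symm (m, (φ x).2)
  have hsx : s (π x) = x := by
    have h1 : (π x, (φ x).2) = φ x := Prod.ext (h x hx).1.symm rfl
    change φ.symm _ = _
    rw [h1]
    exact φ.left_inv hx
  have hmem : ∀ m ∈ U, (m, (φ x).2) ∈ φ.target := fun m hm => by
    rw [ht]
    exact ⟨hm, mem_univ _⟩
  have hs1 : ContMDiffAt (𝓡 d) (𝓡 e) ∞ s (π x) := by
    refine ContMDiffAt.comp (π x) (hφ.contMDiffAt (φ.open_target.mem_nhds (hmem _ hm))) ?_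
    exact contMDiffAt_id.prodMk contMDiffAt_const
  have h2 : π ∘ s =ᶠ[𝓝 (π x)] id := by
    filter_upwards [hU.mem_nhds hm] with m hm
    have h3 : s m ∈ φ.source := φ.map_target (hmem m hm)
    have h4 := (h _ h3).1
    change π (s m) = m
    rw [← h4]
    change (φ (φ.symm _)).1 = m
    rw [φ.right_inv (hmem m hm)]
  have h3 := mfderiv_comp (I := 𝓡 d) (I' := 𝓡 e) (I'' := 𝓡 d) (π x) (g := π) (f := s)
    (hπ.smooth_proj.mdifferentiable (by simp) _) (hs1.mdifferentiableAt (by simp))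
  rw [h2.mfderiv_eq, mfderiv_id] at h3
  intro u
  have h4 : u = rawDeriv d e π (s (π x)) (rawDeriv e d s (π x) u) := congrArg (fun L => L u) h3
  rw [hsx] at h4
  exact ⟨_, h4.symm⟩

end TorusBundle

/-! ### The metric of the total space -/

section BilinearForms

open Set Filter Topology Bornology

variable {E : Type*} [NormedAddCommGroup E] [NormedSpace ℝ E]

/-- A `1`-form as a continuous linear form. -/
noncomputable def dualOfForm (a : E [⋀^Fin 1]→L[ℝ] ℝ) : E →L[ℝ] ℝ :=
  (ContinuousAlternatingMap.ofSubsingleton ℝ E ℝ (0 : Fin 1)).symm a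

theorem dualOfForm_apply (a : E [⋀^Fin 1]→L[ℝ] ℝ) (v : E) : dualOfForm a v = a ![v] := by
  change a (fun _ => v) = _
  congr 1
  ext i
  fin_cases i
  rfl

theorem isBoundedLinearMap_dualOfForm :
    IsBoundedLinearMap ℝ (dualOfForm : (E [⋀^Fin 1]→L[ℝ] ℝ) → E →L[ℝ] ℝ) := by
  refine IsLinearMap.with_bound ⟨fun a b => rfl, fun c a => rfl⟩ 1 fun a => ?_
  refine ContinuousLinearMap.opNorm_le_bound _ (by positivity) fun v => ?_
  rw [dualOfForm_apply]
  refine (a.le_opNorm _).trans ?_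
  simp

/-- A `2`-form as a continuous bilinear form. -/
noncomputable def bilinOfForm (a : E [⋀^Fin 2]→L[ℝ] ℝ) : E →L[ℝ] E →L[ℝ] ℝ :=
  isBoundedLinearMap_dualOfForm.toContinuousLinearMap.comp a.curryLeft

theorem bilinOfForm_apply (a : E [⋀^Fin 2]→L[ℝ] ℝ) (v w : E) :
    bilinOfForm a v w = a ![v, w] :=
  dualOfForm_apply _ w

theorem _root_.ContDiffAt.bilinOfForm {P : Type*} [NormedAddCommGroup P] [NormedSpace ℝ P]
    {n : WithTop ℕ∞} {x : P} {a : P → E [⋀^Fin 2]→L[ℝ] ℝ} (ha : ContDiffAt ℝ n a x) :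
    ContDiffAt ℝ n (fun y => HKTorus.bilinOfForm (a y)) x := by
  have h : IsBoundedLinearMap ℝ
      (HKTorus.bilinOfForm : (E [⋀^Fin 2]→L[ℝ] ℝ) → E →L[ℝ] E →L[ℝ] ℝ) := by
    refine IsLinearMap.with_bound ⟨fun a b => rfl, fun c a => rfl⟩ 1 fun a => ?_
    refine ContinuousLinearMap.opNorm_le_bound _ (by positivity) fun v => ?_
    refine ContinuousLinearMap.opNorm_le_bound _ (by positivity) fun w => ?_
    rw [bilinOfForm_apply]
    refine (a.le_opNorm _).trans ?_
    simp [Fin.prod_univ_two, mul_assoc]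
  exact ContDiffAt.comp (g := HKTorus.bilinOfForm) x h.contDiff.contDiffAt ha

theorem _root_.ContDiffAt.bilinearComp {P F : Type*} [NormedAddCommGroup P] [NormedSpace ℝ P]
    [NormedAddCommGroup F] [NormedSpace ℝ F] {n : WithTop ℕ∞} {x : P} {B : P → E →L[ℝ] E →L[ℝ] ℝ}
    {A : P → F →L[ℝ] E} (hB : ContDiffAt ℝ n B x) (hA : ContDiffAt ℝ n A x) :
    ContDiffAt ℝ n (fun y => (B y).bilinearComp (A y) (A y)) x := by
  have hf₁ : ContDiff ℝ n fun C : F →L[ℝ] E →L[ℝ] ℝ => C.flip :=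
    (IsLinearMap.with_bound ⟨fun _ _ => rfl, fun _ _ => rfl⟩ 1 fun C => by
      rw [ContinuousLinearMap.opNorm_flip, one_mul] : IsBoundedLinearMap ℝ _).contDiff
  have hf₂ : ContDiff ℝ n fun C : F →L[ℝ] F →L[ℝ] ℝ => C.flip :=
    (IsLinearMap.with_bound ⟨fun _ _ => rfl, fun _ _ => rfl⟩ 1 fun C => by
      rw [ContinuousLinearMap.opNorm_flip, one_mul] : IsBoundedLinearMap ℝ _).contDiff
  exact hf₂.contDiffAt.comp x ((hf₁.contDiffAt.comp x (hB.clm_comp hA)).clm_comp hA)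

/-- Definiteness makes `B` injective into the dual space, which has the same dimension. -/
theorem isInvertible_of_pos [FiniteDimensional ℝ E] {B : E →L[ℝ] E →L[ℝ] ℝ}
    (pos : ∀ v, v ≠ 0 → 0 < B v v) : B.IsInvertible := by
  have hinj : Function.Injective B.toLinearMap := by
    rw [injective_iff_map_eq_zero]
    intro v hv
    by_contra h
    have h1 := pos v h
    have h2 : B v = 0 := hv
    rw [h2] at h1
    exact lt_irrefl _ h1
  have hd : Module.finrank ℝ E = Module.finrank ℝ (E →L[ℝ] ℝ) := by
    rw [← (LinearMap.toContinuousLinearMap (𝕜 := ℝ) (E := E) (F' := ℝ)).finrank_eq]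
    exact (Subspace.dual_finrank_eq (K := ℝ) (V := E)).symm
  refine ⟨(LinearEquiv.ofInjectiveOfFinrankEq B.toLinearMap hinj hd).toContinuousLinearEquiv, ?_⟩
  ext v w
  rfl

/-- By compactness of the unit sphere there is `m > 0` with `B v v ≥ m ‖v‖²`, which bounds the unit
ball of `B`. -/
theorem isVonNBounded_of_pos [FiniteDimensional ℝ E] {B : E →L[ℝ] E →L[ℝ] ℝ}
    (pos : ∀ v, v ≠ 0 → 0 < B v v) : IsVonNBounded ℝ {v : E | B v v < 1} := by
  have hcont : Continuous fun v => B v v := B.continuous.clm_apply continuous_id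
  have : ProperSpace E := FiniteDimensional.proper_real E
  obtain ⟨m, hm, h⟩ := (isCompact_sphere (0 : E) 1).exists_forall_le' hcont.continuousOn
    (a := 0) fun v hv => pos v (by
      rintro rfl
      simp at hv)
  rw [NormedSpace.isVonNBounded_iff, isBounded_iff_forall_norm_le]
  refine ⟨Real.sqrt m⁻¹, fun v hv => ?_⟩
  refine Real.le_sqrt_of_sq_le ?_
  by_cases hv0 : v = 0
  · simp [hv0, hm.le]
  have hn : 0 < ‖v‖ := norm_pos_iff.2 hv0
  have h1 := h (‖v‖⁻¹ • v) (by simp [norm_smul, hn.ne'])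
  simp only [map_smul, smul_apply, smul_eq_mul] at h1
  have h2 : B v v < 1 := hv
  rw [le_inv_comm₀ (by positivity) hm]
  calc m ≤ ‖v‖⁻¹ * (‖v‖⁻¹ * B v v) := h1
    _ ≤ ‖v‖⁻¹ * (‖v‖⁻¹ * 1) := by gcongr
    _ = (‖v‖ ^ 2)⁻¹ := by field_simp

end BilinearForms

/-! ### Smoothness and positivity of the metric on the total space. -/

section Sections

open Set Filter Topology

variable {d e : ℕ} {M : Type*} [TopologicalSpace M] [ChartedSpace (Euc d) M]
  {X : Type*} [TopologicalSpace X] [ChartedSpace (Euc e) X]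
  [IsManifold (𝓡 d) ∞ M] [IsManifold (𝓡 e) ∞ X]

/-- An almost complex structure is smooth if it is given by a metric and a smooth `2`-form. -/
theorem contDiffAt_endInChart {x₀ : X}
    {G : ∀ x : X, TangentSpace (𝓡 e) x →L[ℝ] TangentSpace (𝓡 e) x →L[ℝ] ℝ}
    (hG : ContDiffAt ℝ ∞ (bilinInChart x₀ G) (extChartAt (𝓡 e) x₀ x₀))
    (pos : ∀ x v, v ≠ 0 → 0 < G x v v) {J : EndField e X} {τ : DForm e X 2 ℝ} (hτ : SmoothForm τ)
    (h : ∀ x v w, G x (J x v) w = τ x ![v, w]) :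
    ContDiffAt ℝ ∞ (endInChart x₀ J) (extChartAt (𝓡 e) x₀ x₀) := by
  have hinv : ∀ y ∈ (extChartAt (𝓡 e) x₀).target, (bilinInChart x₀ G y).IsInvertible := by
    intro y hy
    refine isInvertible_of_pos fun v hv => ?_
    refine pos ((extChartAt (𝓡 e) x₀).symm y) (chartInv x₀ y v : Euc e) ?_
    obtain ⟨L, hL⟩ := isInvertible_chartInv hy
    rw [← hL]
    exact fun h0 => hv (L.map_eq_zero_iff.1 h0)
  -- In coordinates `J` is the inverse of the metric composed with the `2`-form, and inversion of
  -- operators is smooth.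
  have h1 : endInChart x₀ J =ᶠ[𝓝 (extChartAt (𝓡 e) x₀ x₀)] fun y =>
      (bilinInChart x₀ G y).inverse.comp (bilinOfForm (inChart x₀ τ y)) := by
    filter_upwards [(isOpen_extChartAt_target (I := 𝓡 e) x₀).mem_nhds (mem_extChartAt_target x₀)]
      with y hy
    have h2 : ∀ v, bilinInChart x₀ G y (endInChart x₀ J y v) = bilinOfForm (inChart x₀ τ y) v := by
      intro v
      ext w
      rw [bilinOfForm_apply, inChart_eq, ContinuousAlternatingMap.compContinuousLinearMap_apply]
      change G ((extChartAt (𝓡 e) x₀).symm y) (chartInv x₀ y (endInChart x₀ J y v) : Euc e)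
        (chartInv x₀ y w : Euc e) = _
      rw [chartInv_endInChart J hy]
      refine (h _ _ _).trans ?_
      change rawForm τ _ _ = _
      congr 1
      ext i
      fin_cases i <;> rfl
    obtain ⟨L, hL⟩ := hinv y hy
    ext1 v
    rw [ContinuousLinearMap.comp_apply, ← h2, ← hL, ContinuousLinearMap.inverse_equiv]
    exact (L.symm_apply_apply _).symm
  refine ContDiffAt.congr_of_eventuallyEq ?_ h1
  obtain ⟨L, hL⟩ := hinv _ (mem_extChartAt_target x₀)
  have h3 := contDiffAt_map_inverse (n := ∞) L
  rw [hL] at h3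
  exact ContDiffAt.clm_comp
    (ContDiffAt.comp (g := ContinuousLinearMap.inverse) _ h3 hG)
    (hτ.contDiffAt (mem_extChartAt_target x₀)).bilinOfForm

/-- The bilinear forms `π^* g + ∑ θ_q ⊗ θ_q` on the tangent spaces of the total space. -/
noncomputable def totalBilin (π : X → M) (g : RiemMetric d M) (θ : Fin 4 → DForm e X 1 ℝ) (x : X) :
    TangentSpace (𝓡 e) x →L[ℝ] TangentSpace (𝓡 e) x →L[ℝ] ℝ :=
  (ContinuousLinearMap.bilinearComp (E := Euc d) (F := Euc d) (G := ℝ) (g.inner (π x))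
    (rawDeriv d e π x) (rawDeriv d e π x) +
      ∑ q, (dualOfForm (rawForm (θ q) x)).smulRight (dualOfForm (rawForm (θ q) x)) :
    Euc e →L[ℝ] Euc e →L[ℝ] ℝ)

theorem totalBilin_apply (π : X → M) (g : RiemMetric d M) (θ : Fin 4 → DForm e X 1 ℝ) (x : X)
    (v w : TangentSpace (𝓡 e) x) : totalBilin π g θ x v w =
      g.inner (π x) (mfderiv (𝓡 e) (𝓡 d) π x v) (mfderiv (𝓡 e) (𝓡 d) π x w) +
        ∑ q, θ q x ![v] * θ q x ![w] := by
  have h : ∀ v w : Euc e, (∑ q, (dualOfForm (rawForm (θ q) x)).smulRight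
      (dualOfForm (rawForm (θ q) x)) : Euc e →L[ℝ] Euc e →L[ℝ] ℝ) v w =
        ∑ q, rawForm (θ q) x ![v] * rawForm (θ q) x ![w] := by
    intro v w
    simp [dualOfForm_apply]
  exact congrArg (fun t => g.inner (π x) (mfderiv (𝓡 e) (𝓡 d) π x v)
    (mfderiv (𝓡 e) (𝓡 d) π x w) + t) (h v w)

theorem contDiffAt_totalBilin {π : X → M} (hπ : ContMDiff (𝓡 e) (𝓡 d) ∞ π) (g : RiemMetric d M)
    {θ : Fin 4 → DForm e X 1 ℝ} (hθ : ∀ q, SmoothForm (θ q)) (x₀ : X) :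
    ContDiffAt ℝ ∞ (bilinInChart x₀ (totalBilin π g θ)) (extChartAt (𝓡 e) x₀ x₀) := by
  have hy := mem_extChartAt_target (I := 𝓡 e) x₀
  have hfy : π ((extChartAt (𝓡 e) x₀).symm (extChartAt (𝓡 e) x₀ x₀)) ∈
      (extChartAt (𝓡 d) (π x₀)).source := by
    rw [extChartAt_to_inv]
    exact mem_extChartAt_source (π x₀)
  have h0 : mapInChart d e π x₀ (π x₀) (extChartAt (𝓡 e) x₀ x₀) =
      extChartAt (𝓡 d) (π x₀) (π x₀) := by
    simp [mapInChart]
  have hg := (contMDiffAt_bilin_iff (x₀ := π x₀) g.inner).1 (g.contMDiff (π x₀))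
  have h1 : bilinInChart x₀ (totalBilin π g θ) =ᶠ[𝓝 (extChartAt (𝓡 e) x₀ x₀)] fun y =>
      (bilinInChart (π x₀) g.inner (mapInChart d e π x₀ (π x₀) y)).bilinearComp
        (fderiv ℝ (mapInChart d e π x₀ (π x₀)) y) (fderiv ℝ (mapInChart d e π x₀ (π x₀)) y) +
      ∑ q, (dualOfForm (inChart x₀ (θ q) y)).smulRight (dualOfForm (inChart x₀ (θ q) y)) := by
    filter_upwards [eventually_mem_source hπ hy hfy] with y hy
    ext v w
    have h2 := rawDeriv_comp_chartInv hπ hy.1 hy.2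
    have h3 : (extChartAt (𝓡 d) (π x₀)).symm (mapInChart d e π x₀ (π x₀) y) =
      π ((extChartAt (𝓡 e) x₀).symm y) := (extChartAt (𝓡 d) (π x₀)).left_inv hy.2
    have h4 : ∀ u, rawDeriv d e π ((extChartAt (𝓡 e) x₀).symm y) (chartInv x₀ y u) =
        chartInv (π x₀) (mapInChart d e π x₀ (π x₀) y)
          (fderiv ℝ (mapInChart d e π x₀ (π x₀)) y u) := fun u => congrArg (fun L => L u) h2
    have h5 : ∀ z, z = π ((extChartAt (𝓡 e) x₀).symm y) → ∀ a b : Euc d,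
        (g.inner z : Euc d →L[ℝ] Euc d →L[ℝ] ℝ) a b =
          (g.inner (π ((extChartAt (𝓡 e) x₀).symm y)) : Euc d →L[ℝ] Euc d →L[ℝ] ℝ) a b := by
      rintro z rfl a b
      rfl
    have h6 : ∀ q u, inChart x₀ (θ q) y ![u] =
        rawForm (θ q) ((extChartAt (𝓡 e) x₀).symm y) ![chartInv x₀ y u] := by
      intro q u
      rw [inChart_eq, ContinuousAlternatingMap.compContinuousLinearMap_apply]
      congr 1
      ext i
      fin_cases i
      rfl
    refine (totalBilin_apply π g θ ((extChartAt (𝓡 e) x₀).symm y) (chartInv x₀ y v : Euc e)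
      (chartInv x₀ y w : Euc e)).trans ?_
    refine (congrArg₂ (· + ·) ((congrArg₂ (fun a b : Euc d =>
      (g.inner (π ((extChartAt (𝓡 e) x₀).symm y)) : Euc d →L[ℝ] Euc d →L[ℝ] ℝ) a b) (h4 v)
        (h4 w)).trans (h5 _ h3 _ _).symm) (Finset.sum_congr rfl fun q _ =>
          congrArg₂ (· * ·) (h6 q v).symm (h6 q w).symm)).trans ?_
    simp [dualOfForm_apply]
    rfl
  refine ContDiffAt.congr_of_eventuallyEq ?_ h1
  have hm := contDiffAt_mapInChart hπ hy hfy
  refine ContDiffAt.add (ContDiffAt.bilinearComp ?_ (hm.fderiv_right (by simp))) ?_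
  · rw [← h0] at hg
    exact ContDiffAt.comp (g := bilinInChart (π x₀) g.inner) _ hg hm
  · refine ContDiffAt.sum fun q _ => ?_
    have h4 : ContDiffAt ℝ ∞ (fun y => dualOfForm (inChart x₀ (θ q) y)) (extChartAt (𝓡 e) x₀ x₀) :=
      isBoundedLinearMap_dualOfForm.contDiff.contDiffAt.comp _ ((hθ q).contDiffAt hy)
    exact h4.smulRight h4

/-- A nonzero vector either has nonzero projection, where `g` is positive, or is vertical and
detected by some `θ q`. -/
theorem totalBilin_pos {π : X → M} (g : RiemMetric d M) {θ : Fin 4 → DForm e X 1 ℝ} {x : X}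
    (h : ∀ v, rawDeriv d e π x v = 0 → (∀ q, rawForm (θ q) x ![v] = 0) → v = 0)
    (v : TangentSpace (𝓡 e) x) (hv : v ≠ 0) : 0 < totalBilin π g θ x v v := by
  rw [totalBilin_apply]
  have h1 : 0 ≤ ∑ q, θ q x ![v] * θ q x ![v] :=
    Finset.sum_nonneg fun q _ => mul_self_nonneg _
  by_cases h2 : mfderiv (𝓡 e) (𝓡 d) π x v = 0
  · have h3 : ∑ q, θ q x ![v] * θ q x ![v] ≠ 0 := by
      intro h3
      rw [Finset.sum_eq_zero_iff_of_nonneg fun q _ => mul_self_nonneg _] at h3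
      exact hv (h v h2 fun q => mul_self_eq_zero.1 (h3 q (Finset.mem_univ q)))
    rw [h2, map_zero, zero_add]
    exact lt_of_le_of_ne h1 h3.symm
  · exact add_pos_of_pos_of_nonneg (g.pos _ _ h2) h1

/-- The metric `π^* g + ∑ θ_q ⊗ θ_q`. -/
noncomputable def totalMetric {π : X → M} (hπ : ContMDiff (𝓡 e) (𝓡 d) ∞ π) (g : RiemMetric d M)
    {θ : Fin 4 → DForm e X 1 ℝ} (hθ : ∀ q, SmoothForm (θ q))
    (h : ∀ x v, rawDeriv d e π x v = 0 → (∀ q, rawForm (θ q) x ![v] = 0) → v = 0) :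
    RiemMetric e X where
  inner := totalBilin π g θ
  symm x v w := by
    rw [totalBilin_apply, totalBilin_apply, g.symm]
    simp only [mul_comm]
  pos x v hv := totalBilin_pos g (h x) v hv
  isVonNBounded x := isVonNBounded_of_pos (E := Euc e) (B := totalBilin π g θ x)
    (totalBilin_pos g (h x))
  contMDiff x := (contMDiffAt_bilin_iff _).2 (contDiffAt_totalBilin hπ g hθ x)

end Sections

/-! ### The forms of the total space -/

section HyperKahlerRelations

variable {d : ℕ} {M : Type*} [TopologicalSpace M] [ChartedSpace (Euc d) M]
  [IsManifold (𝓡 d) ∞ M] {g : RiemMetric d M} {I : Fin 3 → EndField d M}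
  {σ : Fin 3 → DForm d M 2 ℝ}

theorem IsHyperHermitian.form_left (hM : IsHyperHermitian g I σ) (i : Fin 3) (m : M)
    (v w : TangentSpace (𝓡 d) m) :
    σ (i + 1) m ![I i m v, w] = -σ (i + 2) m ![v, w] := by
  rw [← hM.fundamental, ← hM.fundamental, ← neg_eq_iff_eq_neg.2 (hM.anticomm i m v), hM.mul,
    map_neg, neg_apply]

theorem IsHyperHermitian.form_left' (hM : IsHyperHermitian g I σ) (i : Fin 3) (m : M)
    (v w : TangentSpace (𝓡 d) m) :
    σ (i + 2) m ![I i m v, w] = σ (i + 1) m ![v, w] := by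
  have h : ∀ i : Fin 3, i + 2 + 1 = i ∧ i + 2 + 2 = i + 1 := by decide
  have h1 := hM.mul (i + 2) m v
  rw [(h i).1, (h i).2] at h1
  rw [← hM.fundamental, ← hM.fundamental, h1]

theorem IsHyperHermitian.form_apply_apply (hM : IsHyperHermitian g I σ) (i : Fin 3) (m : M)
    (v w : TangentSpace (𝓡 d) m) : σ i m ![I i m v, I i m w] = σ i m ![v, w] := by
  rw [← hM.fundamental, ← hM.fundamental, hM.hermitian]

/-- Moving `I i` through the commuting endomorphism reduces this to `g` being Hermitian. It makes
`γ` of type `(1,1)` for all three structures. -/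
theorem IsInSp.form_apply_apply {γ : DForm d M 2 ℝ} (hγ : IsInSp g I γ)
    (hM : IsHyperHermitian g I σ) (i : Fin 3) (m : M) (v w : TangentSpace (𝓡 d) m) :
    γ m ![I i m v, I i m w] = γ m ![v, w] := by
  obtain ⟨B, hB, hc⟩ := hγ m
  rw [← hB, ← hB, hc, hM.hermitian]

/-- The cyclic quaternion relations make `σ_{i+1} + i σ_{i+2}` a `(2,0)`-form for `Iᵢ`. -/
theorem IsHyperHermitian.complexForm_left (hM : IsHyperHermitian g I σ) (i : Fin 3) (m : M)
    (v w : TangentSpace (𝓡 d) m) :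
    complexForm (σ (i + 1) m) (σ (i + 2) m) ![I i m v, w] =
      Complex.I * complexForm (σ (i + 1) m) (σ (i + 2) m) ![v, w] := by
  rw [complexForm_apply, complexForm_apply, hM.form_left, hM.form_left']
  push_cast
  linear_combination (-(σ (i + 2) m ![v, w] : ℂ)) * Complex.I_mul_I

end HyperKahlerRelations

/-! ### The fundamental forms on the total space in the splitting. -/

section CheckForms

theorem stdForm_mul (i : Fin 3) (c : Fin 4 → ℝ) (q : Fin 4) : ∑ p, stdForm i p q * c p =
    (![![-c 1, c 0, -c 3, c 2], ![-c 2, c 3, c 0, -c 1], ![-c 3, -c 2, c 1, c 0]] :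
      Fin 3 → Fin 4 → ℝ) i q := by
  fin_cases i <;> fin_cases q <;> simp [stdForm, Fin.sum_univ_four]

/-- With `c` and `r` the coordinates in the order `ξ, η, ν, α`, the three rows are the vertical
parts `ξ∧η + ν∧α`, `ξ∧ν + α∧η` and `ξ∧α + η∧ν`. -/
theorem stdForm_apply (i : Fin 3) (c r : Fin 4 → ℝ) :
    ∑ q, (∑ p, stdForm i p q * c p) * r q =
      (![(c 0 * r 1 - r 0 * c 1) + (c 2 * r 3 - r 2 * c 3),
        (c 0 * r 2 - r 0 * c 2) + (c 3 * r 1 - r 3 * c 1),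
        (c 0 * r 3 - r 0 * c 3) + (c 1 * r 2 - r 1 * c 2)] : Fin 3 → ℝ) i := by
  rw [Finset.sum_congr rfl fun q _ => congrArg (· * r q) (stdForm_mul i c q), Fin.sum_univ_four]
  fin_cases i <;> simp <;> ring

variable {d e : ℕ} {M : Type*} [TopologicalSpace M] [ChartedSpace (Euc d) M]
  {X : Type*} [TopologicalSpace X] [ChartedSpace (Euc e) X]

theorem pullback_two_apply {A : Type*} [NormedAddCommGroup A] [NormedSpace ℝ A] (π : X → M)
    (τ : DForm d M 2 A) (x : X) (v w : TangentSpace (𝓡 e) x) :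
    pullback π τ x ![v, w] =
      τ (π x) ![mfderiv (𝓡 e) (𝓡 d) π x v, mfderiv (𝓡 e) (𝓡 d) π x w] := by
  unfold pullback
  rw [ContinuousAlternatingMap.compContinuousLinearMap_apply]
  congr 1
  ext i
  fin_cases i <;> rfl

theorem omegaCheck_apply (π : X → M) (σ : Fin 3 → DForm d M 2 ℝ) (α ξ η ν : DForm e X 1 ℝ)
    (i : Fin 3) (x : X) (v w : TangentSpace (𝓡 e) x) :
    omegaCheck π σ α ξ η ν i x ![v, w] =
      σ i (π x) ![mfderiv (𝓡 e) (𝓡 d) π x v, mfderiv (𝓡 e) (𝓡 d) π x w] +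
        ∑ q, (∑ p, stdForm i p q * (![ξ, η, ν, α] : Fin 4 → DForm e X 1 ℝ) p x ![v]) *
          (![ξ, η, ν, α] : Fin 4 → DForm e X 1 ℝ) q x ![w] := by
  have h1 : ∀ (τ : DForm d M 2 ℝ) (a b c r : DForm e X 1 ℝ),
      (pullback π τ x + wedge (a x) (b x) + wedge (c x) (r x) :
        TangentSpace (𝓡 e) x [⋀^Fin 2]→L[ℝ] ℝ) ![v, w] =
      τ (π x) ![mfderiv (𝓡 e) (𝓡 d) π x v, mfderiv (𝓡 e) (𝓡 d) π x w] +
        (a x ![v] * b x ![w] - a x ![w] * b x ![v]) +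
        (c x ![v] * r x ![w] - c x ![w] * r x ![v]) := by
    intro τ a b c r
    rw [ContinuousAlternatingMap.add_apply, ContinuousAlternatingMap.add_apply]
    exact congrArg₂ (· + ·) (congrArg₂ (· + ·) (pullback_two_apply π τ x v w)
      (wedge_one_one _ _ v w)) (wedge_one_one _ _ v w)
  have h2 := fun i => stdForm_apply i (fun p => (![ξ, η, ν, α] : Fin 4 → DForm e X 1 ℝ) p x ![v])
    (fun p => (![ξ, η, ν, α] : Fin 4 → DForm e X 1 ℝ) p x ![w])
  rw [h2]
  fin_cases i
  · exact (h1 (σ 0) ξ η ν α).trans (add_assoc _ _ _)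
  · exact (h1 (σ 1) ξ ν α η).trans (add_assoc _ _ _)
  · exact (h1 (σ 2) ξ α η ν).trans (add_assoc _ _ _)

variable [IsManifold (𝓡 d) ∞ M] [IsManifold (𝓡 e) ∞ X]

theorem dForm_complexForm_eq_pullback {π : X → M} {p q : DForm e X 1 ℝ} (hp : SmoothForm p)
    (hq : SmoothForm q) {p' q' : DForm d M 2 ℝ} (dp : dForm p = pullback π p')
    (dq : dForm q = pullback π q') :
    dForm (fun x => complexForm (p x) (q x)) =
      pullback π (fun m => complexForm (p' m) (q' m)) := by
  funext x
  rw [dForm_complexForm hp hq, dp, dq]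
  rfl

theorem smoothForm_omegaCheck {π : X → M} (hπ : ContMDiff (𝓡 e) (𝓡 d) ∞ π)
    {σ : Fin 3 → DForm d M 2 ℝ} (hσ : ∀ i, SmoothForm (σ i)) {α ξ η ν : DForm e X 1 ℝ}
    (hα : SmoothForm α) (hξ : SmoothForm ξ) (hη : SmoothForm η) (hν : SmoothForm ν) (i : Fin 3) :
    SmoothForm (omegaCheck π σ α ξ η ν i) := by
  fin_cases i
  · exact (((hσ 0).pullback hπ).add (hξ.wedge hη)).add (hν.wedge hα)
  · exact (((hσ 1).pullback hπ).add (hξ.wedge hν)).add (hα.wedge hη)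
  · exact (((hσ 2).pullback hπ).add (hξ.wedge hα)).add (hη.wedge hν)

end CheckForms

section AdaptedBasis

variable {d : ℕ} {X : Type*} [TopologicalSpace X] [ChartedSpace (Euc d) X]
  [IsManifold (𝓡 d) ∞ X]

/-- A hyper-Hermitian structure is an `Sp(m)`-structure. -/
theorem IsHyperHermitian.isSpStructure {m : ℕ} (hd : d = 4 * m) {g : RiemMetric d X}
    {J : Fin 3 → EndField d X} {τ : Fin 3 → DForm d X 2 ℝ} (h : IsHyperHermitian g J τ) :
    IsSpStructure m g τ where
  smooth := h.smooth
  adapted x := by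
    obtain ⟨b, h1, h2⟩ := exists_quaternionic_basis (V := TangentSpace (𝓡 d) x) (m := m)
      (B := LinearMap.mk₂ ℝ (fun v w => g.inner x v w) (fun v v' w => by simp)
        (fun c v w => by simp) (fun v w w' => by simp) (fun c v w => by simp))
      (J := fun i => (J i x).toLinearMap) ((finrank_tangentSpace x).trans hd) (g.symm x) (g.pos x)
      (fun i => (h.complex i).sq x) (fun i => h.mul i x) (fun i => h.anticomm i x)
      (fun i => h.hermitian i x)
    exact ⟨b, h1, fun i p q => (h.fundamental i x _ _).symm.trans (h2 i p q)⟩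

end AdaptedBasis

/-! ### The almost complex structures of the total space -/

section TotalSpace

variable {d : ℕ} {M : Type*} [TopologicalSpace M] [ChartedSpace (Euc d) M]
  [IsManifold (𝓡 d) ∞ M] {X : Type*} [TopologicalSpace X] [ChartedSpace (Euc (d + 4)) X]
  [IsManifold (𝓡 (d + 4)) ∞ X] [MulAction Torus4 X] {π : X → M} {α ξ η ν : DForm (d + 4) X 1 ℝ}

/-- The projection and the connection forms identify `T_x X` with `T_{π x} M × ℝ⁴`. -/
theorem bijective_projection_connection (hπ : IsPrincipalTorusBundle d (d + 4) π)
    (hconn : IsConnection ![α, ξ, η, ν]) (x : X) :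
    Function.Bijective ((rawDeriv d (d + 4) π x).toLinearMap.prod (LinearMap.pi fun q : Fin 4 =>
      (dualOfForm (rawForm ((![ξ, η, ν, α] : Fin 4 → DForm (d + 4) X 1 ℝ) q) x)).toLinearMap)) := by
  refine bijective_prod_of_dual (by simp) (hπ.surjective_rawDeriv x)
    -- The connection lists its components as `α, ξ, η, ν`, whereas the quaternionic frame is `ξ, η,
    -- ν, α`; hence the cyclic shift of indices.
    ![fundamentalField 1 x, fundamentalField 2 x, fundamentalField 3 x, fundamentalField 0 x] ?_ ?_
  · intro j
    fin_cases j <;> exact hπ.rawDeriv_fundamentalField _ x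
  · intro i j
    have h := fun i j => hconn.vertical i j x
    refine (dualOfForm_apply _ _).trans ?_
    fin_cases i <;> fin_cases j
    · exact h 1 1
    · exact h 1 2
    · exact h 1 3
    · exact h 1 0
    · exact h 2 1
    · exact h 2 2
    · exact h 2 3
    · exact h 2 0
    · exact h 3 1
    · exact h 3 2
    · exact h 3 3
    · exact h 3 0
    · exact h 0 1
    · exact h 0 2
    · exact h 0 3
    · exact h 0 0

/-- The almost complex structures of the total space. -/
theorem exists_total_endField (hπ : IsPrincipalTorusBundle d (d + 4) π)
    (hconn : IsConnection ![α, ξ, η, ν]) (I : Fin 3 → EndField d M) :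
    ∃ J : Fin 3 → EndField (d + 4) X, ∀ i x v,
      rawDeriv d (d + 4) π x (J i x v) = I i (π x) (rawDeriv d (d + 4) π x v) ∧
      ∀ q, (![ξ, η, ν, α] : Fin 4 → DForm (d + 4) X 1 ℝ) q x ![J i x v] =
        ∑ p, stdForm i p q * (![ξ, η, ν, α] : Fin 4 → DForm (d + 4) X 1 ℝ) p x ![v] := by
  choose J hJ using fun x => exists_quaternionic_lift (V := Euc (d + 4)) (U := Euc d)
    (bijective_projection_connection hπ hconn x)
    (fun i => (I i (π x) : Euc d →L[ℝ] Euc d).toLinearMap)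
  have toEnd : ∀ L : Euc (d + 4) →ₗ[ℝ] Euc (d + 4), ∃ K : Euc (d + 4) →L[ℝ] Euc (d + 4),
      ∀ v, K v = L v := fun L => ⟨LinearMap.toContinuousLinearMap L, fun _ => rfl⟩
  have h : ∀ i x, ∃ K : TangentSpace (𝓡 (d + 4)) x →L[ℝ] TangentSpace (𝓡 (d + 4)) x,
      ∀ v, K v = J x i v := fun i x => toEnd (J x i)
  choose K hK using h
  refine ⟨K, fun i x v => ?_⟩
  rw [hK]
  refine ⟨(hJ x i v).1, fun q => ?_⟩
  refine ((dualOfForm_apply _ _).symm.trans ((hJ x i v).2 q)).trans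
    (Finset.sum_congr rfl fun p _ => ?_)
  exact congrArg (stdForm i p q * ·) (dualOfForm_apply
    (rawForm ((![ξ, η, ν, α] : Fin 4 → DForm (d + 4) X 1 ℝ) p) x) v)

end TotalSpace

theorem apply_eq_zero_of_complexForm {V : Type*} [AddCommGroup V] [Module ℝ V] [TopologicalSpace V]
    {k : ℕ} {a b : V [⋀^Fin k]→L[ℝ] ℝ} {v : Fin k → V} (h : complexForm a b v = 0) :
    a v = 0 ∧ b v = 0 := by
  rw [complexForm_apply] at h
  have h1 := congrArg Complex.re h
  have h2 := congrArg Complex.im h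
  simp at h1 h2
  exact ⟨h1, h2⟩

end HKTorus

/-! ### Assembly on the total space. -/

theorem theorem1p2 (n : ℕ)
    {M : Type*} [TopologicalSpace M] [ChartedSpace (Euc (4 * n)) M]
    [IsManifold (𝓡 (4 * n)) ∞ M] [T2Space M] [SecondCountableTopology M]
    {X : Type*} [TopologicalSpace X] [ChartedSpace (Euc (4 * n + 4)) X]
    [IsManifold (𝓡 (4 * n + 4)) ∞ X] [T2Space X] [SecondCountableTopology X]
    [MulAction Torus4 X]
    (g : RiemMetric (4 * n) M) (I : Fin 3 → EndField (4 * n) M)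
    (σ : Fin 3 → DForm (4 * n) M 2 ℝ) (hM : IsHyperKahler g I σ)
    (γ : DForm (4 * n) M 2 ℝ) (hγ_smooth : SmoothForm γ) (hγ_closed : dForm γ = 0)
    (hγ_sp : IsInSp g I γ)
    (π : X → M) (hπ : IsPrincipalTorusBundle (4 * n) (4 * n + 4) π)
    (α ξ η ν : DForm (4 * n + 4) X 1 ℝ) (hconn : IsConnection ![α, ξ, η, ν])
    (hα : dForm α = pullback π (σ 0)) (hξ : dForm ξ = -pullback π (σ 1))
    (hη : dForm η = -pullback π (σ 2)) (hν : dForm ν = pullback π γ) :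
    ∃ (gX : RiemMetric (4 * n + 4) X) (J : Fin 3 → EndField (4 * n + 4) X),
      (∀ (x : X) (v w : TangentSpace (𝓡 (4 * n + 4)) x),
        gX.inner x v w =
          g.inner (π x) (mfderiv (𝓡 (4 * n + 4)) (𝓡 (4 * n)) π x v)
              (mfderiv (𝓡 (4 * n + 4)) (𝓡 (4 * n)) π x w)
            + α x ![v] * α x ![w] + ξ x ![v] * ξ x ![w]
            + η x ![v] * η x ![w] + ν x ![v] * ν x ![w]) ∧
      IsSpStructure (n + 1) gX (omegaCheck π σ α ξ η ν) ∧
      IsHyperHermitian gX J (omegaCheck π σ α ξ η ν) ∧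
      ∀ i, SmoothForm (upsilonCheck n π σ α ξ η ν i) ∧
        IsTypeTop (J i) (upsilonCheck n π σ α ξ η ν i) ∧
        dForm (upsilonCheck n π σ α ξ η ν i) = 0 := by
  have hH := hM.toIsHyperHermitian
  have hp := hπ.smooth_proj
  have sα : SmoothForm α := hconn.smooth 0
  have sξ : SmoothForm ξ := hconn.smooth 1
  have sη : SmoothForm η := hconn.smooth 2
  have sν : SmoothForm ν := hconn.smooth 3
  set f : Fin 4 → DForm (4 * n + 4) X 1 ℝ := ![ξ, η, ν, α]
  have sf : ∀ q, SmoothForm (f q) := fun q => by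
    fin_cases q
    · exact sξ
    · exact sη
    · exact sν
    · exact sα
  have hbij := bijective_projection_connection hπ hconn
  have hinj : ∀ x v, rawDeriv (4 * n) (4 * n + 4) π x v = 0 → (∀ q, rawForm (f q) x ![v] = 0) →
      v = 0 := fun x v h1 h2 => eq_of_prod (hbij x) (h1.trans (map_zero _).symm) fun q =>
    ((dualOfForm_apply (rawForm (f q) x) v).trans (h2 q)).trans (map_zero _).symm
  obtain ⟨J, hJ⟩ := exists_total_endField hπ hconn I
  have hJP : ∀ i x v, mfderiv (𝓡 (4 * n + 4)) (𝓡 (4 * n)) π x (J i x v) =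
      I i (π x) (mfderiv (𝓡 (4 * n + 4)) (𝓡 (4 * n)) π x v) := fun i x v => (hJ i x v).1
  have hJf : ∀ i x v q, f q x ![J i x v] = ∑ p, stdForm i p q * f p x ![v] :=
    fun i x v => (hJ i x v).2
  have hJf' : ∀ i x v q, dualOfForm (rawForm (f q) x) (J i x v) =
      ∑ p, stdForm i p q * dualOfForm (rawForm (f p) x) v := fun i x v q =>
    (dualOfForm_apply _ _).trans ((hJf i x v q).trans
      (Finset.sum_congr rfl fun p _ =>
        congrArg (stdForm i p q * ·) (dualOfForm_apply (rawForm (f p) x) v).symm))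
  let gX := totalMetric hp g sf hinj
  have hgX : ∀ x v w, gX.inner x v w = g.inner (π x) (mfderiv (𝓡 (4 * n + 4)) (𝓡 (4 * n)) π x v)
      (mfderiv (𝓡 (4 * n + 4)) (𝓡 (4 * n)) π x w) + ∑ q, f q x ![v] * f q x ![w] :=
    totalBilin_apply π g f
  have sq : ∀ i x v, J i x (J i x v) = -v := fun i x v =>
    quaternionic_lift_sq (hbij x) (I := fun i => (I i (π x)).toLinearMap)
      (J := fun i => (J i x).toLinearMap) (fun i v => (hJ i x v).1) (fun i v => hJf' i x v)
      (fun i => (hH.complex i).sq (π x)) i v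
  have fund : ∀ i x v w, gX.inner x (J i x v) w = omegaCheck π σ α ξ η ν i x ![v, w] := by
    intro i x v w
    rw [hgX, omegaCheck_apply, hJP, hH.fundamental]
    simp only [hJf]
    rfl
  have sω := smoothForm_omegaCheck hp hH.smooth sα sξ sη sν
  have hdiff : ∀ i x, ContDiffAt ℝ ∞ (endInChart x (J i)) (extChartAt (𝓡 (4 * n + 4)) x x) :=
    fun i x => contDiffAt_endInChart (contDiffAt_totalBilin hp g sf x) gX.pos (sω i) (fund i)
  have hcol : ∀ i x v q, f q x ![J i x v] = (![![-f 1 x ![v], f 0 x ![v], -f 3 x ![v], f 2 x ![v]],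
      ![-f 2 x ![v], f 3 x ![v], f 0 x ![v], -f 1 x ![v]],
      ![-f 3 x ![v], -f 2 x ![v], f 1 x ![v], f 0 x ![v]]] : Fin 3 → Fin 4 → ℝ) i q :=
    fun i x v q => (hJf i x v q).trans (stdForm_mul i (fun p => f p x ![v]) q)
  have type_one : ∀ i (p q : DForm (4 * n + 4) X 1 ℝ),
      (∀ x v, p x ![J i x v] = -q x ![v]) → (∀ x v, q x ![J i x v] = p x ![v]) →
      ∀ x v, complexForm (p x) (q x) ![J i x v] = Complex.I * complexForm (p x) (q x) ![v] := by
    intro i p q h1 h2 x v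
    rw [complexForm_apply, complexForm_apply, h1, h2]
    push_cast
    linear_combination (-(q x ![v] : ℂ)) * Complex.I_mul_I
  have type_oneOne : ∀ i m (p q : TangentSpace (𝓡 (4 * n)) m [⋀^Fin 2]→L[ℝ] ℝ),
      (∀ v w, p ![I i m v, I i m w] = p ![v, w]) → (∀ v w, q ![I i m v, I i m w] = q ![v, w]) →
      IsTwoZeroOrOneOne (I i m) (complexForm p q) := by
    intro i m p q h1 h2
    refine Or.inr fun v w => ?_
    rw [complexForm_apply, complexForm_apply, h1, h2]
  have type_twoZero : ∀ i m (p q : TangentSpace (𝓡 (4 * n)) m [⋀^Fin 2]→L[ℝ] ℝ),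
      (∀ v w, p ![I i m v, w] = -q ![v, w]) → (∀ v w, q ![I i m v, w] = p ![v, w]) →
      IsTwoZeroOrOneOne (I i m) (complexForm p q) := by
    intro i m p q h1 h2
    refine Or.inl fun v w => ?_
    rw [complexForm_apply, complexForm_apply, h1, h2]
    push_cast
    linear_combination (-(q ![v, w] : ℂ)) * Complex.I_mul_I
  -- Collects what integrability and closedness need about the two `1`-form factors `p + iq` and `r
  -- + is` of the `i`-th volume form, including that together they detect all vertical directions.
  let D : Fin 3 → Prop := fun i =>
    ∃ (p q r s : DForm (4 * n + 4) X 1 ℝ) (a b : DForm (4 * n) M 2 ℂ),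
      SmoothForm p ∧ SmoothForm q ∧ SmoothForm r ∧ SmoothForm s ∧
      upsilonCheck n π σ α ξ η ν i =
        volForm n (pullback π (σ (i + 1))) (pullback π (σ (i + 2))) p q r s ∧
      (∀ x v, complexForm (p x) (q x) ![J i x v] = Complex.I * complexForm (p x) (q x) ![v]) ∧
      (∀ x v, complexForm (r x) (s x) ![J i x v] = Complex.I * complexForm (r x) (s x) ![v]) ∧
      dForm (fun x => complexForm (p x) (q x)) = pullback π a ∧
      dForm (fun x => complexForm (r x) (s x)) = pullback π b ∧
      (∀ m, IsTwoZeroOrOneOne (I i m) (a m)) ∧ (∀ m, IsTwoZeroOrOneOne (I i m) (b m)) ∧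
      ∀ x v, p x ![v] = 0 → q x ![v] = 0 → r x ![v] = 0 → s x ![v] = 0 →
        ∀ j, f j x ![v] = 0
  have hξ' : dForm ξ = pullback π (fun m => -σ 1 m) := hξ
  have hη' : dForm η = pullback π (fun m => -σ 2 m) := hη
  -- `d(ξ + iη) = -(σ₂ + iσ₃)` is `(2,0)` and `d(ν + iα) = γ + iσ₁` is `(1,1)`.
  have D0 : D 0 := by
    refine ⟨ξ, η, ν, α, _, _, sξ, sη, sν, sα, rfl,
      type_one 0 ξ η (fun x v => hcol 0 x v 0) (fun x v => hcol 0 x v 1),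
      type_one 0 ν α (fun x v => hcol 0 x v 2) (fun x v => hcol 0 x v 3),
      dForm_complexForm_eq_pullback sξ sη hξ' hη', dForm_complexForm_eq_pullback sν sα hν hα,
      fun m => type_twoZero 0 m _ _ (fun v w => ?_) (fun v w => ?_),
      fun m => type_oneOne 0 m _ _ (fun v w => hγ_sp.form_apply_apply hH 0 m v w)
        (fun v w => hH.form_apply_apply 0 m v w), fun x v h0 h1 h2 h3 j => ?_⟩
    · exact congrArg Neg.neg (hH.form_left 0 m v w)
    · exact congrArg Neg.neg (hH.form_left' 0 m v w)
    · fin_cases j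
      exacts [h0, h1, h2, h3]
  -- `d(ξ + iν) = -σ₂ + iγ` is `(1,1)` and `d(α + iη) = σ₁ - iσ₃ = -i(σ₃ + iσ₁)` is `(2,0)`.
  have D1 : D 1 := by
    refine ⟨ξ, ν, α, η, _, _, sξ, sν, sα, sη, rfl,
      type_one 1 ξ ν (fun x v => hcol 1 x v 0) (fun x v => hcol 1 x v 2),
      type_one 1 α η (fun x v => hcol 1 x v 3) (fun x v => hcol 1 x v 1),
      dForm_complexForm_eq_pullback sξ sν hξ' hν, dForm_complexForm_eq_pullback sα sη hα hη',
      fun m => type_oneOne 1 m _ _ (fun v w => ?_)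
        (fun v w => hγ_sp.form_apply_apply hH 1 m v w),
      fun m => type_twoZero 1 m _ _ (fun v w => ?_) (fun v w => ?_), fun x v h0 h2 h3 h1 j => ?_⟩
    · exact congrArg Neg.neg (hH.form_apply_apply 1 m v w)
    · exact (hH.form_left' 1 m v w).trans (neg_neg _).symm
    · exact neg_eq_iff_eq_neg.2 (hH.form_left 1 m v w)
    · fin_cases j
      exacts [h0, h1, h2, h3]
  -- `d(ξ + iα) = -σ₂ + iσ₁ = i(σ₁ + iσ₂)` is `(2,0)` and `d(η + iν) = -σ₃ + iγ` is `(1,1)`.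
  have D2 : D 2 := by
    refine ⟨ξ, α, η, ν, _, _, sξ, sα, sη, sν, rfl,
      type_one 2 ξ α (fun x v => hcol 2 x v 0) (fun x v => hcol 2 x v 3),
      type_one 2 η ν (fun x v => hcol 2 x v 1) (fun x v => hcol 2 x v 2),
      dForm_complexForm_eq_pullback sξ sα hξ' hα, dForm_complexForm_eq_pullback sη sν hη' hν,
      fun m => type_twoZero 2 m _ _ (fun v w => ?_) (fun v w => ?_),
      fun m => type_oneOne 2 m _ _ (fun v w => ?_)
        (fun v w => hγ_sp.form_apply_apply hH 2 m v w), fun x v h0 h3 h1 h2 j => ?_⟩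
    · exact congrArg Neg.neg (hH.form_left' 2 m v w)
    · exact hH.form_left 2 m v w
    · exact congrArg Neg.neg (hH.form_apply_apply 2 m v w)
    · fin_cases j
      exacts [h0, h1, h2, h3]
  have hD : ∀ i, D i := by
    intro i
    fin_cases i
    exacts [D0, D1, D2]
  have tS : ∀ i x v w,
      complexForm (pullback (e := 4 * n + 4) π (σ (i + 1)) x) (pullback π (σ (i + 2)) x)
        ![J i x v, w] = Complex.I * complexForm (pullback (e := 4 * n + 4) π (σ (i + 1)) x)
          (pullback π (σ (i + 2)) x) ![v, w] := by
    intro i x v w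
    have h := pullback_two_apply (e := 4 * n + 4) π
      (fun m => complexForm (σ (i + 1) m) (σ (i + 2) m)) x
    refine (h _ _).trans ?_
    rw [hJP, hH.complexForm_left]
    exact congrArg _ (h v w).symm
  have nij : ∀ i (V W : ∀ x : X, TangentSpace (𝓡 (4 * n + 4)) x) (x : X),
      SmoothFieldAt V x → SmoothFieldAt W x → nijenhuis (J i) V W x = 0 := by
    intro i V W x hV hW
    obtain ⟨p, q, r, s, a, b, sp, sq', sr, ss, -, ta, tb, da, db, ga, gb, h0⟩ := hD i
    have hno : ∀ c : DForm (4 * n) M 2 ℂ, (∀ m, IsTwoZeroOrOneOne (I i m) (c m)) →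
        NoZeroTwo (J i x) (pullback π c x) := fun c hc =>
      ((hc (π x)).noZeroTwo ((hH.complex i).sq (π x))).comp _ (hJP i x)
    refine nijenhuis_eq_zero ((hdiff i x).differentiableAt (by simp)) (sq i x)
      (sp.complexForm sq') (sr.complexForm ss)
      (((hH.smooth (i + 1)).pullback hp).complexForm ((hH.smooth (i + 2)).pullback hp))
      ta tb (tS i) (by rw [da]; exact hno a ga) (by rw [db]; exact hno b gb)
      (dForm_complexForm_pullback_eq_zero hp (hH.smooth _) (hH.smooth _) (hM.closed _)
        (hM.closed _) x) ?_ hV hW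
    intro v hv1 hv2 hv3
    have e1 := apply_eq_zero_of_complexForm hv1
    have e2 := apply_eq_zero_of_complexForm hv2
    refine hinj x v ?_ (h0 x v e1.1 e1.2 e2.1 e2.2)
    set u := mfderiv (𝓡 (4 * n + 4)) (𝓡 (4 * n)) π x v
    -- Tests nondegeneracy of `S` on a lift `w` of `I_{i+1} u`: the real part of `S(v, w)` is
    -- `g(I_{i+1} u, I_{i+1} u) = g(u, u)`, which forces `u = 0`.
    obtain ⟨w, hw⟩ := hπ.surjective_rawDeriv x (I (i + 1) (π x) u)
    have e3 := (apply_eq_zero_of_complexForm (hv3 w)).1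
    replace e3 := (pullback_two_apply π (σ (i + 1)) x v w).symm.trans e3
    rw [← hH.fundamental] at e3
    have e4 : g.inner (π x) (I (i + 1) (π x) u) (I (i + 1) (π x) u) = 0 :=
      (congrArg (fun t => g.inner (π x) (I (i + 1) (π x) u) t) hw.symm).trans e3
    rw [hH.hermitian] at e4
    by_contra hne
    exact (g.pos (π x) u hne).ne' e4
  have hyper : IsHyperHermitian gX J (omegaCheck π σ α ξ η ν) :=
    { complex := fun i => ⟨fun x => contMDiffAt_endField (J i) (hdiff i x), sq i, nij i⟩
      mul := fun i x v => quaternionic_lift_mul (hbij x) (I := fun i => (I i (π x)).toLinearMap)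
        (J := fun i => (J i x).toLinearMap) (fun i v => (hJ i x v).1) (fun i v => hJf' i x v)
        (fun i => hH.mul i (π x)) i v
      anticomm := fun i x v => quaternionic_lift_anticomm (hbij x)
        (I := fun i => (I i (π x)).toLinearMap)
        (J := fun i => (J i x).toLinearMap) (fun i v => (hJ i x v).1) (fun i v => hJf' i x v)
        (fun i => hH.anticomm i (π x)) i v
      hermitian := fun i x v w => by
        rw [hgX, hgX, hJP, hJP, hH.hermitian]
        have h := quaternionic_lift_hermitian (J := fun i => (J i x : Euc (4 * n + 4) →L[ℝ] _).toLinearMap)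
          (f := fun q => (dualOfForm (rawForm (f q) x)).toLinearMap) (fun i v => hJf' i x v) i v w
        have e : ∀ v w, ∑ q, f q x ![v] * f q x ![w] =
            ∑ q, dualOfForm (rawForm (f q) x) v * dualOfForm (rawForm (f q) x) w := fun v w =>
          Finset.sum_congr rfl fun q _ => congrArg₂ (· * ·)
            (dualOfForm_apply (rawForm (f q) x) v).symm (dualOfForm_apply (rawForm (f q) x) w).symm
        exact congrArg _ ((e _ _).trans (h.trans (e v w).symm))
      fundamental := fund
      smooth := sω }
  refine ⟨gX, J, fun x v w => ?_, hyper.isSpStructure (by ring), hyper, fun i => ?_⟩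
  · rw [hgX, Fin.sum_univ_four]
    change _ + (ξ x ![v] * ξ x ![w] + η x ![v] * η x ![w] + ν x ![v] * ν x ![w] +
      α x ![v] * α x ![w]) = _
    ring
  · obtain ⟨p, q, r, s, a, b, sp, sq', sr, ss, hup, ta, tb, da, db, ga, gb, -⟩ := hD i
    rw [hup]
    exact ⟨((hH.smooth _).pullback hp).volForm ((hH.smooth _).pullback hp) sp sq' sr ss,
      isTypeTop_volForm (tS i) ta tb,
      dForm_volForm_eq_zero hp (hH.smooth _) (hH.smooth _) (hM.closed _) (hM.closed _) sp sq' sr ss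
        (hH.complex i).sq (hH.complexForm_left i) da db ga gb⟩
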